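/- **Conventions.** Let $n\ge 1$ be an integer and $0<d<n$ real. Let $\Omega\subset\mathbb R^n$ be open, $\delta(y)=\operatorname{dist}(y,\partial\Omega)$, and let $\sigma$ be $d$-dimensional Hausdorff measure; $B(x,r)$ denotes an open ball and $\fint$ denotes an average with respect to Lebesgue measure or $\sigma$. * $\partial\Omega$ is *$d$-Ahlfors regular with constant $A>0$* if it is nonempty and $\frac1A r^d\le\sigma(B(\xi,r)\cap\partial\Omega)\le A r^d$ for all $\xi\in\partial\Omega$ and all real $r$ with $0<r\le\operatorname{diam}\partial\Omega$. * For $x\in\partial\Omega$, $y\in\Omega$, a *$\lambda$-carrot path from $x$ to $y$* is a continuous rectifiable path $\zeta:[0,T]\to\Omega\cup\{x\}$ parametrized by arc length with $\zeta(0)=x$, $\zeta(T)=y$ and $\delta(\zeta(t))\ge\lambda t$ for all $t\in[0,T]$. * $\Omega$ is a *weak local John domain with constants $\theta,\lambda\in(0,1]$, $N\ge2$* if $\partial\Omega$ is $d$-Ahlfors regular and for every $y\in\Omega$ there is a Borel set $F\subseteq B(y,N\delta(y))\cap\partial\Omega$ with $\sigma(F)\ge\theta\,\sigma(B(y,N\delta(y))\cap\partial\Omega)$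 such that for every $x\in F$ there is a $\lambda$-carrot path from $x$ to $y$. * $\gamma_a(x)=\{y\in\Omega:|y-x|<(1+a)\delta(y)\}$ for $x\in\partial\Omega$. We write $\mathrm{Tr}_{a,c}u(x)=U\in\mathbb R$ if $x\in\overline{\gamma_a(x)}$ and $\fint_{B(y,c\delta(y))}|u-U|\to0$ as $y\to x$ with $y\in\gamma_a(x)$; if there is no such $U$, the trace does not exist at $x$. * $\mathcal W_{c,\beta}f(y)=\big(\fint_{B(y,c\delta(y))}|f|^\beta\big)^{1/\beta}$ for $1\le\beta<\infty$, and the essential supremum of $|f|$ over $B(y,c\delta(y))$ for $\beta=\infty$. * $u\in\dot W^{1,\beta}_{loc}(W)$ means that $u$ is a locally integrable real-valued function on the open set $W$ whose weak gradient lies in $L^\beta(K)$ for every compact $K\subset W$. **Statement.** Let $\lambda\in(0,1]$, $0<\vartheta\le\theta\le1$, $N\ge2$, $A>0$, $a>(1-\lambda)/\lambda$, $0<c<1$, $s>0$, $1\le p\le\infty$, and put $C_1=N+1/\lambda+1$. There is a constant $C\in(0,\infty)$, depending only on $n,d,A,N,\lambda,\theta,\vartheta,a,c,p,s$, such that the following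 holds. Let $\Omega\subset\mathbb R^n$ be a weak local John domain with constants $\theta,\lambda,N$ whose boundary is $d$-Ahlfors regular with constant $A$. Let $\xi\in\partial\Omega$, $0<R<2\operatorname{diam}(\partial\Omega)$, $c<\widetilde c<1$, $1\le\beta\le\infty$, and let $u\in\dot W^{1,\beta}_{loc}(\Omega\cap B(\xi,2C_1R))$. (1) Let $\Psi\subseteq\Omega\cap B(\xi,R)$ be measurable. For each $y\in\Psi$ let $F(y)$ be a $\sigma$-measurable subset of $$\{x\in B(y,N\delta(y))\cap\partial\Omega:\text{there is a }\lambda\text{-carrot path from }x\text{ to }y\}$$ with $\sigma(F(y))\ge\vartheta\,\sigma(B(y,N\delta(y))\cap\partial\Omega)$, and suppose that $\mathrm{Tr}_{a,c}u$ exists $\sigma$-almost everywhere on $\bigcup_{y\in\Psi}F(y)$. Then $$\int_\Psi\Big(\fint_{B(y,c\delta(y))}\Big|u-\fint_{F(y)}\mathrm{Tr}_{a,c}u\,d\sigma\Big|^\beta\Big)^{p/\beta}\delta(y)^{d-n-ps}\,dy\le C\int_{B(\xi,C_1R)\cap\Omega}\mathcal W_{\widetilde c,\beta}(\nabla u)^p\,\delta^{d-n+p-ps},$$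 and if the right-hand side is finite, then $\mathrm{Tr}_{a,c}u$ is $\sigma$-integrable on $F(y)$ for every $y\in\Psi$. (If the right-hand side is infinite, there is nothing to prove.) (2) If $\mathrm{Tr}_{a,c}u(x)=0$ for $\sigma$-almost every $x\in B(\xi,C_1R)\cap\partial\Omega$ that satisfies $x\in\overline{\gamma_a(x)}$, then $$\int_{B(\xi,R)\cap\Omega}\mathcal W_{c,\beta}(u)^p\,\delta^{d-n-ps}\le C\int_{B(\xi,C_1R)\cap\Omega}\mathcal W_{\widetilde c,\beta}(\nabla u)^p\,\delta^{d-n+p-ps}.$$ When $\beta=\infty$ the inner averages are essential suprema. When $p=\infty$ the two sides of each inequality are read as the essential suprema, over the same regions, of $\delta^{-s}$ (on the left) and $\delta^{1-s}$ (on the right) times the corresponding Whitney average. -/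

import Mathlib

open MeasureTheory Set Filter Topology
open scoped ENNReal MeasureTheory

namespace BoundaryPoincare

noncomputable section

/-- Euclidean space `ℝⁿ`. -/
abbrev E (n : ℕ) : Type := EuclideanSpace ℝ (Fin n)

/-- `δ(x)`, the distance from `x` to the boundary of `Ω`. -/
def bdist {n : ℕ} (Ω : Set (E n)) (x : E n) : ℝ :=
  Metric.infDist x (frontier Ω)

/-- `Γ` is `d`-Ahlfors regular with constant `A`, with respect to the `d`-dimensional Hausdorff
measure. (Mathlib's `μH[d]` differs from other usual normalizations of the Hausdorff measure by a
factor that depends only on `d`.) -/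
def IsAhlforsRegular {n : ℕ} (d A : ℝ) (Γ : Set (E n)) : Prop :=
  Γ.Nonempty ∧ ∀ ξ ∈ Γ, ∀ r : ℝ, 0 < r → ENNReal.ofReal r ≤ Metric.ediam Γ →
    ENNReal.ofReal (r ^ d / A) ≤ μH[d] (Metric.ball ξ r ∩ Γ) ∧
      μH[d] (Metric.ball ξ r ∩ Γ) ≤ ENNReal.ofReal (A * r ^ d)

/-- There is a `lam`-carrot path in `Ω` from the boundary point `x` to `y`: a rectifiable path
`ζ : [0, T] → Ω ∪ {x}`, parametrized by arc length, with `ζ 0 = x`, `ζ T = y` and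
`δ(ζ t) ≥ lam * t`. -/
def HasCarrotPath {n : ℕ} (Ω : Set (E n)) (lam : ℝ) (x y : E n) : Prop :=
  ∃ (T : ℝ) (ζ : ℝ → E n), 0 ≤ T ∧ ContinuousOn ζ (Icc 0 T) ∧ HasUnitSpeedOn ζ (Icc 0 T) ∧
    (∀ t ∈ Icc 0 T, ζ t ∈ Ω ∪ {x}) ∧ ζ 0 = x ∧ ζ T = y ∧
    ∀ t ∈ Icc 0 T, lam * t ≤ bdist Ω (ζ t)

/-- The set of points of `B(y, N δ(y)) ∩ ∂Ω` that are joined to `y` by a `lam`-carrot path. -/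
def carrotSet {n : ℕ} (Ω : Set (E n)) (lam N : ℝ) (y : E n) : Set (E n) :=
  {x | x ∈ Metric.ball y (N * bdist Ω y) ∩ frontier Ω ∧ HasCarrotPath Ω lam x y}

/-- `y` is a `(θ, lam, N)`-weak local John point of `Ω`, where `∂Ω` is `d`-dimensional. -/
def IsWeakLocalJohnPoint {n : ℕ} (Ω : Set (E n)) (d θ lam N : ℝ) (y : E n) : Prop :=
  ∃ F : Set (E n), MeasurableSet F ∧ F ⊆ Metric.ball y (N * bdist Ω y) ∩ frontier Ω ∧
    ENNReal.ofReal θ * μH[d] (Metric.ball y (N * bdist Ω y) ∩ frontier Ω) ≤ μH[d] F ∧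
    ∀ x ∈ F, HasCarrotPath Ω lam x y

/-- `Ω` is a weak local John domain with constants `θ, lam, N` and with `d`-Ahlfors regular
boundary with constant `A`. -/
def IsWeakLocalJohnDomain {n : ℕ} (Ω : Set (E n)) (d A θ lam N : ℝ) : Prop :=
  IsOpen Ω ∧ IsAhlforsRegular d A (frontier Ω) ∧ ∀ y ∈ Ω, IsWeakLocalJohnPoint Ω d θ lam N y

/-- The nontangential cone `γ_a(ξ)`. -/
def cone {n : ℕ} (Ω : Set (E n)) (a : ℝ) (ξ : E n) : Set (E n) :=
  {x | x ∈ Ω ∧ dist x ξ < (1 + a) * bdist Ω x}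

/-- The boundary trace `Tr_{a,c} u(x)` exists and equals `U`. -/
def HasTrace {n : ℕ} (Ω : Set (E n)) (a c : ℝ) (u : E n → ℝ) (x : E n) (U : ℝ) : Prop :=
  x ∈ closure (cone Ω a x) ∧
    Tendsto (fun y => ⨍⁻ z in Metric.ball y (c * bdist Ω y), ‖u z - U‖ₑ ∂volume)
      (𝓝[cone Ω a x] x) (𝓝 0)

open Classical in
/-- The value of the boundary trace `Tr_{a,c} u(x)` (and `0` where the trace does not exist). -/
def trace {n : ℕ} (Ω : Set (E n)) (a c : ℝ) (u : E n → ℝ) (x : E n) : ℝ :=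
  if h : ∃ U, HasTrace Ω a c u x U then h.choose else 0

/-- The Whitney averaging operator: the `L^β` norm of `f` on `B(y, c δ(y))` with respect to
normalized Lebesgue measure (the essential supremum if `β = ∞`). -/
def whitneyAvg {n : ℕ} {V : Type} [NormedAddCommGroup V] (Ω : Set (E n)) (c : ℝ) (β : ℝ≥0∞)
    (f : E n → V) (y : E n) : ℝ≥0∞ :=
  eLpNorm f β ((volume (Metric.ball y (c * bdist Ω y)))⁻¹ •
    volume.restrict (Metric.ball y (c * bdist Ω y)))

/-- The functional `∫_S g(y)^p δ(y)^{d - n - p t} dy` if `p < ∞`, and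
`ess sup_{y ∈ S} g(y) δ(y)^{-t}` if `p = ∞`. -/
def weightedFunctional {n : ℕ} (Ω : Set (E n)) (d : ℝ) (p : ℝ≥0∞) (t : ℝ) (S : Set (E n))
    (g : E n → ℝ≥0∞) : ℝ≥0∞ :=
  if p = ⊤ then essSup (fun y => g y * ENNReal.ofReal (bdist Ω y ^ (-t))) (volume.restrict S)
  else ∫⁻ y in S, g y ^ p.toReal * ENNReal.ofReal (bdist Ω y ^ (d - n - p.toReal * t))

/-- `Du` is the weak gradient of `u` in the open set `W`. -/
def HasWeakGradient {n : ℕ} (W : Set (E n)) (u : E n → ℝ) (Du : E n → E n) : Prop :=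
  LocallyIntegrableOn u W ∧ LocallyIntegrableOn Du W ∧
    ∀ φ : E n → ℝ, ContDiff ℝ (⊤ : ℕ∞) φ → HasCompactSupport φ → tsupport φ ⊆ W →
      ∀ v : E n, ∫ x in W, u x * fderiv ℝ φ x v = - ∫ x in W, inner ℝ (Du x) v * φ x

/-- `u` belongs to the local homogeneous Sobolev space `Ẇ^{1,β}_loc(W)` and `Du` is its weak
gradient. -/
def MemSobolevLoc {n : ℕ} (W : Set (E n)) (β : ℝ≥0∞) (u : E n → ℝ) (Du : E n → E n) : Prop :=
  HasWeakGradient W u Du ∧ ∀ K : Set (E n), K ⊆ W → IsCompact K → MemLp Du β (volume.restrict K)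

end

end BoundaryPoincare

/-! Compare `u` near `y` with its boundary values through the mean `m(y)` of `u` over a small
Whitney ball `B(y, κδ(y))`, `κ = c/10`. By Minkowski, the left side at `y` is at most the
oscillation of `u` about `m(y)` plus the `σ`-average over `F(y)` of `|m(y) - Tr u|`. The first term
is at most a constant times `δ(y)` times the Whitney average of the gradient at `y`, by Poincaré's
inequality on a ball. That inequality is proved here for weak gradients by mollification, with a
slight loss in the radius (whence `c < c'`) and a constant independent of `β`.

For the second term, take `x ∈ F(y)` and follow the carrot path from `y` to `x`, stopping at arc
length `T ρ^j` from `x`. With `ρ = 1 - λκ` consecutive points are within `κδ` of each other, so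
consecutive means differ by at most `C δ` times a local average of `|∇u|`. The points stay in the
cone `γ_a(x)` because `a > (1-λ)/λ`, so the means converge to the trace, and `|m(y) - Tr u(x)|` is
bounded by the sum of the links (`exists_chain_estimate`).

What remains is a Hardy-type summation. For finite `p`, geometric weights and Jensen's inequality
move the power `p` inside the sum, at the price of half of the decay `ρ^{psj}`; this is where `s >
0` enters. Each link is averaged over its Whitney ball. Tonelli in `(x, w)` then uses that the
boundary points which see `w` at scale `τ` have measure at most `C τ^d`
(`lintegral_rpow_le_tsum_shadow`), and Tonelli in `(y, w)` uses that the `y` which see `w` at step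
`j` have `δ(y)` comparable to `δ(w)/ρ^j` and lie in a ball of comparable radius
(`setLIntegral_tsum_shadow_le`). Both bounds are uniform, and the surviving factor `ρ^{psj/2}` sums.
For `p = ∞` each link is bounded at one well-chosen point, and the series in `ρ^{sj}` converges
directly.

For vanishing traces the John condition itself supplies the sets `F(y)`, on which the average of the
trace is zero. -/

namespace BoundaryPoincare

/-! ### Jensen's inequality in extended nonnegative form. -/

section Jensen

variable {α : Type*} [MeasurableSpace α]

/-- Jensen's inequality for powers of extended nonnegative functions. -/
theorem lintegral_rpow_le_lintegral_rpow (μ : Measure α) [IsProbabilityMeasure μ]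
    {f : α → ℝ≥0∞} (hf : AEMeasurable f μ) {P : ℝ} (hP : 1 ≤ P) :
    (∫⁻ x, f x ∂μ) ^ P ≤ ∫⁻ x, f x ^ P ∂μ := by
  have hP0 : 0 < P := by linarith
  rcases hP.eq_or_lt with rfl | hP1
  · simp
  have hc : P.HolderConjugate (P / (P - 1)) := Real.HolderConjugate.conjExponent hP1
  have := ENNReal.lintegral_mul_le_Lp_mul_Lq μ hc hf (g := fun _ => 1) aemeasurable_const
  simp only [Pi.mul_apply, mul_one, ENNReal.one_rpow, lintegral_const, measure_univ] at this
  calc (∫⁻ x, f x ∂μ) ^ P ≤ ((∫⁻ x, f x ^ P ∂μ) ^ (1 / P)) ^ P := by gcongr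
    _ = _ := by rw [← ENNReal.rpow_mul, one_div_mul_cancel hP0.ne', ENNReal.rpow_one]

/-- Jensen's inequality for series with weights `w` of total mass one. -/
theorem tsum_mul_rpow_le {w f : ℕ → ℝ≥0∞} (hw : ∑' j, w j = 1) {P : ℝ} (hP : 1 ≤ P) :
    (∑' j, w j * f j) ^ P ≤ ∑' j, w j * f j ^ P := by
  let μ : Measure ℕ := Measure.sum fun j => w j • Measure.dirac j
  have hμ : ∀ g : ℕ → ℝ≥0∞, ∫⁻ j, g j ∂μ = ∑' j, w j * g j := by
    intro g
    simp [μ, lintegral_sum_measure]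
  have : IsProbabilityMeasure μ := ⟨by simpa [hw] using hμ 1⟩
  simpa only [hμ] using lintegral_rpow_le_lintegral_rpow μ (f := f)
    (measurable_of_countable f).aemeasurable hP

end Jensen

/-! ### Integrals along segments joining two points of a set. -/

section ChangeOfVariables

variable {n : ℕ}

theorem lintegral_comp_smul_add (h : E n → ℝ≥0∞) (hh : Measurable h) {t : ℝ} (ht : t ≠ 0)
    (a : E n) :
    ∫⁻ y, h (t • y + a) = ENNReal.ofReal (|t ^ n|⁻¹) * ∫⁻ y, h y := by
  have h1 : ∫⁻ y, h (t • y + a) = ∫⁻ y, h (y + a) ∂(Measure.map (t • ·) volume) :=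
    (lintegral_map (f := fun y => h (y + a)) (by fun_prop) (by fun_prop)).symm
  rw [h1, Measure.map_addHaar_smul _ ht, lintegral_smul_measure, lintegral_add_right_eq_self]
  simp [abs_inv]

/-- One of `t` and `1 - t` is at least `1/2`. Freeze the endpoint with the other coefficient: the
substitution in the remaining endpoint has Jacobian factor at most `2^n`, and the frozen variable
contributes `volume B`. -/
theorem lintegral_lintegral_segment_le (h : E n → ℝ≥0∞) (hh : Measurable h) (B : Set (E n))
    {t : ℝ} (w : E n) :
    ∫⁻ x in B, ∫⁻ y in B, h (x + t • (y - x) - w) ≤ 2 ^ n * volume B * ∫⁻ y, h y := by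
  have key : ∀ τ : ℝ, 1 / 2 ≤ τ → ∀ a : E n, ∫⁻ y in B, h (τ • y + a) ≤ 2 ^ n * ∫⁻ y, h y := by
    intro τ hτ a
    refine (setLIntegral_le_lintegral _ _).trans ?_
    rw [lintegral_comp_smul_add h hh (by linarith) a]
    gcongr
    have : |τ ^ n|⁻¹ ≤ 2 ^ n := by
      rw [abs_of_nonneg (by positivity), ← inv_pow]
      exact pow_le_pow_left₀ (by positivity) (by rw [inv_le_comm₀] <;> linarith) n
    calc ENNReal.ofReal (|τ ^ n|⁻¹) ≤ ENNReal.ofReal (2 ^ n) := ENNReal.ofReal_le_ofReal this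
      _ = 2 ^ n := by rw [ENNReal.ofReal_pow zero_le_two]; simp
  have key2 : ∀ g : E n → E n → ℝ≥0∞, (∀ x, ∫⁻ y in B, g x y ≤ 2 ^ n * ∫⁻ y, h y) →
      ∫⁻ x in B, ∫⁻ y in B, g x y ≤ 2 ^ n * volume B * ∫⁻ y, h y := by
    intro g hg
    refine (lintegral_mono fun x => hg x).trans ?_
    rw [lintegral_const, Measure.restrict_apply_univ, mul_right_comm]
  rcases le_total (1 / 2) t with ht | ht
  · refine key2 _ fun x => ?_
    convert key t ht (x - t • x - w) using 4
    rw [smul_sub]; abel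
  · rw [lintegral_lintegral_swap]
    · refine key2 _ fun y => ?_
      convert key (1 - t) (by linarith) (t • y - w) using 4
      rw [smul_sub, sub_smul, one_smul]; abel
    · apply Measurable.aemeasurable
      simp only [Function.uncurry_def]
      fun_prop

end ChangeOfVariables

/-! ### Mollification and weak gradients. -/

section Mollify

variable {n : ℕ}

theorem normed_bump_sub_eq_zero {K : Set (E n)} (φ : ContDiffBump (0 : E n)) {x : E n}
    (hx : Metric.closedBall x φ.rOut ⊆ K) {q : E n} (hq : q ∉ K) :
    φ.normed volume (x - q) = 0 := by
  by_contra hne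
  have : x - q ∈ Function.support (φ.normed volume) := hne
  rw [φ.support_normed_eq, Metric.mem_ball, dist_zero_right] at this
  refine hq (hx ?_)
  rw [Metric.mem_closedBall, dist_comm, dist_eq_norm]
  exact this.le

open ContinuousLinearMap Convolution in
/-- The derivative of the mollification of a function is the mollification of its weak gradient. -/
theorem HasWeakGradient.hasFDerivAt_mollify {W : Set (E n)} {u : E n → ℝ} {Du : E n → E n}
    (h : HasWeakGradient W u Du) {K : Set (E n)} (hK : IsCompact K)
    (hKW : K ⊆ W) (φ : ContDiffBump (0 : E n)) {x : E n} (hx : Metric.closedBall x φ.rOut ⊆ K) :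
    ∃ L : E n →L[ℝ] ℝ,
      HasFDerivAt (φ.normed volume ⋆[lsmul ℝ ℝ, volume] K.indicator u) L x ∧
      ∀ v, L v = ∫ q in W, inner ℝ (Du q) v * φ.normed volume (x - q) := by
  obtain ⟨hu, hDu, hw⟩ := h
  have hui : LocallyIntegrable (K.indicator u) volume :=
    ((integrable_indicator_iff hK.measurableSet).2
      (hu.integrableOn_compact_subset hKW hK)).locallyIntegrable
  have h1 := φ.hasCompactSupport_normed (μ := volume)
  have h2 : ContDiff ℝ 1 (φ.normed volume) := φ.contDiff_normed (n := 1)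
  have hder := h1.hasFDerivAt_convolution_right (L := (lsmul ℝ ℝ).flip) hui h2 x
  rw [convolution_flip] at hder
  refine ⟨_, hder, fun v => ?_⟩
  rw [convolution_precompR_apply _ hui (h1.fderiv ℝ) (h2.continuous_fderiv one_ne_zero),
    convolution_def]
  have hzero : ∀ q, q ∉ K → φ.normed volume (x - q) = 0 := fun q hq =>
    normed_bump_sub_eq_zero φ hx hq
  have hts : tsupport (fun q => φ.normed volume (x - q)) ⊆ K :=
    closure_minimal (fun q hq => by_contra fun hne => hq (hzero q hne)) hK.isClosed
  have hd : ∀ q, fderiv ℝ (fun q => φ.normed volume (x - q)) q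
      = - fderiv ℝ (φ.normed volume) (x - q) := by
    intro q
    have := ((h2.differentiable one_ne_zero (x - q)).hasFDerivAt).comp q
      ((hasFDerivAt_const x q).sub (hasFDerivAt_id q))
    refine this.fderiv.trans ?_
    ext v
    simp
  have key := hw (fun q => φ.normed volume (x - q))
    ((φ.contDiff_normed (n := ⊤)).comp (contDiff_const.sub contDiff_id))
    (HasCompactSupport.intro hK hzero) (hts.trans hKW) v
  rw [← neg_eq_iff_eq_neg, ← integral_neg] at key
  rw [← key]
  rw [← setIntegral_eq_integral_of_forall_compl_eq_zero (s := W)]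
  · congr 1
    ext q
    rw [hd]
    by_cases hq : q ∈ K
    · simp [hq, mul_comm]
    · have : fderiv ℝ (fun q => φ.normed volume (x - q)) q = 0 := by
        by_contra hne
        exact hq (hts (support_fderiv_subset ℝ hne))
      rw [hd, neg_eq_zero] at this
      simp [this]
  · intro q hq
    simp [Set.indicator_of_notMem (fun h => hq (hKW h))]

open ContinuousLinearMap Convolution in
-- The fundamental theorem of calculus along the segment from `x` to `y`, whose derivative is a
-- mollified weak gradient. Convexity of `S` keeps every bump centred on the segment supported in
-- `K`, so a majorant of `|Du|` on `K` suffices.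
theorem HasWeakGradient.enorm_mollify_sub_le {W : Set (E n)} {u : E n → ℝ} {Du : E n → E n}
    (h : HasWeakGradient W u Du) {K : Set (E n)} (hK : IsCompact K)
    (hKW : K ⊆ W) (φ : ContDiffBump (0 : E n)) {G : E n → ℝ≥0∞}
    (hDG : ∀ᵐ q ∂volume, q ∈ K → ‖Du q‖ₑ ≤ G q) {S : Set (E n)} (hS : Convex ℝ S)
    (hSK : ∀ x ∈ S, Metric.closedBall x φ.rOut ⊆ K) {x y : E n} (hx : x ∈ S) (hy : y ∈ S) :
    ‖(φ.normed volume ⋆[lsmul ℝ ℝ, volume] K.indicator u) y -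
      (φ.normed volume ⋆[lsmul ℝ ℝ, volume] K.indicator u) x‖ₑ ≤
      ‖y - x‖ₑ * ∫⁻ t in Icc (0 : ℝ) 1,
        ∫⁻ w, ENNReal.ofReal (φ.normed volume w) * G (x + t • (y - x) - w) := by
  set U := φ.normed volume ⋆[lsmul ℝ ℝ, volume] K.indicator u with hU
  have hui : LocallyIntegrable (K.indicator u) volume :=
    ((integrable_indicator_iff hK.measurableSet).2
      (h.1.integrableOn_compact_subset hKW hK)).locallyIntegrable
  have hUs : ContDiff ℝ 1 U :=
    φ.hasCompactSupport_normed.contDiff_convolution_left (n := 1) _ φ.contDiff_normed hui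
  have hline : ContDiff ℝ 1 (fun t : ℝ => x + t • (y - x)) := by fun_prop
  have h1 := enorm_sub_le_lintegral_deriv_of_contDiffOn_Icc
    (hUs.comp hline).contDiffOn (zero_le_one (α := ℝ))
  simp only [Function.comp_apply, one_smul, zero_smul, add_zero, add_sub_cancel] at h1
  refine h1.trans ?_
  rw [← lintegral_const_mul' _ _ enorm_ne_top]
  refine setLIntegral_mono' measurableSet_Icc fun t ht => ?_
  have hp : x + t • (y - x) ∈ S := hS.add_smul_sub_mem hx hy ht
  set p := x + t • (y - x) with hpdef
  obtain ⟨L, hL, hLv⟩ := h.hasFDerivAt_mollify hK hKW φ (hSK p hp)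
  have hder : deriv (U ∘ fun t : ℝ => x + t • (y - x)) t = L (y - x) := by
    have h2 : HasDerivAt (fun t : ℝ => x + t • (y - x)) (y - x) t := by
      simpa using ((hasDerivAt_id t).smul_const (y - x)).const_add x
    exact (HasFDerivAt.comp_hasDerivAt t hL h2).deriv
  rw [hder, hLv]
  calc ‖∫ q in W, inner ℝ (Du q) (y - x) * φ.normed volume (p - q)‖ₑ
      ≤ ∫⁻ q in W, ‖inner ℝ (Du q) (y - x) * φ.normed volume (p - q)‖ₑ :=
        enorm_integral_le_lintegral_enorm _
    _ ≤ ∫⁻ q, ‖inner ℝ (Du q) (y - x) * φ.normed volume (p - q)‖ₑ :=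
        setLIntegral_le_lintegral _ _
    _ ≤ ∫⁻ q, ‖y - x‖ₑ * (ENNReal.ofReal (φ.normed volume (p - q)) * G q) := by
        refine lintegral_mono_ae ?_
        filter_upwards [hDG] with q hq
        by_cases hqK : q ∈ K
        · rw [enorm_mul, Real.enorm_of_nonneg (φ.nonneg_normed _)]
          calc ‖inner ℝ (Du q) (y - x)‖ₑ * ENNReal.ofReal (φ.normed volume (p - q))
              ≤ (‖Du q‖ₑ * ‖y - x‖ₑ) * ENNReal.ofReal (φ.normed volume (p - q)) := by
                gcongr
                simp only [← ofReal_norm]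
                rw [← ENNReal.ofReal_mul (norm_nonneg _)]
                exact ENNReal.ofReal_le_ofReal (norm_inner_le_norm _ _)
            _ ≤ (G q * ‖y - x‖ₑ) * ENNReal.ofReal (φ.normed volume (p - q)) := by
                gcongr
                exact hq hqK
            _ = _ := by ring
        · simp [normed_bump_sub_eq_zero φ (hSK p hp) hqK]
    _ = ‖y - x‖ₑ * ∫⁻ q, ENNReal.ofReal (φ.normed volume (p - q)) * G q :=
        lintegral_const_mul' _ _ enorm_ne_top
    _ = _ := by
        congr 1
        rw [← lintegral_sub_left_eq_self _ p]
        simp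

end Mollify

/-! ### Poincaré's inequality on balls. -/

section Poincare

variable {n : ℕ}

theorem lintegral_ofReal_normed_bump (φ : ContDiffBump (0 : E n)) :
    ∫⁻ w, ENNReal.ofReal (φ.normed volume w) = 1 := by
  rw [← ofReal_integral_eq_lintegral_ofReal φ.integrable_normed
    (Eventually.of_forall φ.nonneg_normed), φ.integral_normed, ENNReal.ofReal_one]

open ContinuousLinearMap Convolution in
-- Both `dt` on `[0,1]` and the bump density are probability measures, so Jensen puts the power `β`
-- inside. Tonelli then freezes `t` and the translation `w`, leaving the segment integral. The bound
-- does not depend on the bump, which allows the passage to the limit.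
theorem HasWeakGradient.lintegral_mollify_sub_rpow_le {W : Set (E n)} {u : E n → ℝ}
    {Du : E n → E n} (h : HasWeakGradient W u Du) {z : E n} {r r' : ℝ}
    (hKW : Metric.closedBall z r' ⊆ W) (φ : ContDiffBump (0 : E n)) (hφ : r + φ.rOut ≤ r')
    {G : E n → ℝ≥0∞} (hG : Measurable G)
    (hDG : ∀ᵐ q ∂volume, q ∈ Metric.closedBall z r' → ‖Du q‖ₑ ≤ G q) {β : ℝ} (hβ : 1 ≤ β) :
    ∫⁻ x in Metric.ball z r, ∫⁻ y in Metric.ball z r,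
      ‖(φ.normed volume ⋆[lsmul ℝ ℝ, volume] (Metric.closedBall z r').indicator u) y -
      (φ.normed volume ⋆[lsmul ℝ ℝ, volume] (Metric.closedBall z r').indicator u) x‖ₑ ^ β ≤
      ENNReal.ofReal (2 * r) ^ β * (2 ^ n * volume (Metric.ball z r) * ∫⁻ q, G q ^ β) := by
  have hβ0 : 0 ≤ β := by linarith
  set B := Metric.ball z r with hB
  set ν : Measure (E n) := volume.withDensity fun w => ENNReal.ofReal (φ.normed volume w)
  have hφm : Measurable fun w => ENNReal.ofReal (φ.normed volume w) :=
    φ.continuous_normed.measurable.ennreal_ofReal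
  have hν : IsProbabilityMeasure ν := ⟨by
    rw [withDensity_apply _ MeasurableSet.univ, Measure.restrict_univ,
      lintegral_ofReal_normed_bump]⟩
  have hI : IsProbabilityMeasure (volume.restrict (Icc (0 : ℝ) 1)) := ⟨by simp⟩
  have hpt : ∀ x ∈ B, ∀ y ∈ B,
      ‖(φ.normed volume ⋆[lsmul ℝ ℝ, volume] (Metric.closedBall z r').indicator u) y -
      (φ.normed volume ⋆[lsmul ℝ ℝ, volume] (Metric.closedBall z r').indicator u) x‖ₑ ^ β ≤
      ENNReal.ofReal (2 * r) ^ β * ∫⁻ t in Icc (0 : ℝ) 1, ∫⁻ w, G (x + t • (y - x) - w) ^ β ∂ν := by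
    intro x hx y hy
    have h1 := h.enorm_mollify_sub_le (isCompact_closedBall z r') hKW φ hDG
      (convex_ball z r) (fun p hp => Metric.closedBall_subset_closedBall' (by
        have := Metric.mem_ball.1 hp; linarith)) hx hy
    have h2 : ‖y - x‖ₑ ≤ ENNReal.ofReal (2 * r) := by
      rw [← ofReal_norm, ← dist_eq_norm]
      refine ENNReal.ofReal_le_ofReal ?_
      have := dist_triangle_right y x z
      have h3 := Metric.mem_ball.1 hx
      have h4 := Metric.mem_ball.1 hy
      linarith
    refine (ENNReal.rpow_le_rpow (h1.trans (mul_le_mul_left h2 _)) hβ0).trans ?_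
    rw [ENNReal.mul_rpow_of_nonneg _ _ hβ0]
    gcongr
    have hmeas : Measurable fun p : ℝ × E n => G (x + p.1 • (y - x) - p.2) := by fun_prop
    calc (∫⁻ t in Icc (0 : ℝ) 1,
          ∫⁻ w, ENNReal.ofReal (φ.normed volume w) * G (x + t • (y - x) - w)) ^ β
        = (∫⁻ t in Icc (0 : ℝ) 1, ∫⁻ w, G (x + t • (y - x) - w) ∂ν) ^ β := by
          congr 1
          refine lintegral_congr fun t => ?_
          rw [lintegral_withDensity_eq_lintegral_mul _ hφm (by fun_prop)]
          rfl
      _ ≤ ∫⁻ t in Icc (0 : ℝ) 1, (∫⁻ w, G (x + t • (y - x) - w) ∂ν) ^ β :=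
          lintegral_rpow_le_lintegral_rpow _ hmeas.lintegral_prod_right'.aemeasurable hβ
      _ ≤ _ := by
          refine lintegral_mono fun t => ?_
          exact lintegral_rpow_le_lintegral_rpow _ (by fun_prop) hβ
  have hm4 : Measurable fun p : ((E n × E n) × ℝ) × E n =>
      G (p.1.1.1 + p.1.2 • (p.1.1.2 - p.1.1.1) - p.2) ^ β := by fun_prop
  have hm3 : Measurable fun p : (E n × E n) × ℝ =>
      ∫⁻ w, G (p.1.1 + p.2 • (p.1.2 - p.1.1) - w) ^ β ∂ν := hm4.lintegral_prod_right'
  have hm2 : Measurable fun p : E n × E n => ∫⁻ t in Icc (0 : ℝ) 1,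
      ∫⁻ w, G (p.1 + t • (p.2 - p.1) - w) ^ β ∂ν := hm3.lintegral_prod_right'
  calc _ ≤ ∫⁻ x in B, ∫⁻ y in B, ENNReal.ofReal (2 * r) ^ β *
        ∫⁻ t in Icc (0 : ℝ) 1, ∫⁻ w, G (x + t • (y - x) - w) ^ β ∂ν := by
        refine setLIntegral_mono' measurableSet_ball fun x hx => ?_
        exact setLIntegral_mono' measurableSet_ball fun y hy => hpt x hx y hy
    _ = ENNReal.ofReal (2 * r) ^ β * ∫⁻ p, (∫⁻ t in Icc (0 : ℝ) 1,
          ∫⁻ w, G (p.1 + t • (p.2 - p.1) - w) ^ β ∂ν)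
          ∂((volume.restrict B).prod (volume.restrict B)) := by
        rw [lintegral_prod _ hm2.aemeasurable, ← lintegral_const_mul _ hm2.lintegral_prod_right']
        refine lintegral_congr fun x => ?_
        exact lintegral_const_mul _ (hm2.comp measurable_prodMk_left)
    _ = ENNReal.ofReal (2 * r) ^ β * ∫⁻ t in Icc (0 : ℝ) 1, ∫⁻ w,
          ∫⁻ p, G (p.1 + t • (p.2 - p.1) - w) ^ β
          ∂((volume.restrict B).prod (volume.restrict B)) ∂ν := by
        congr 1
        rw [lintegral_lintegral_swap hm3.aemeasurable]
        refine lintegral_congr fun t => ?_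
        rw [lintegral_lintegral_swap]
        exact (by fun_prop : Measurable fun q : (E n × E n) × E n =>
          G (q.1.1 + t • (q.1.2 - q.1.1) - q.2) ^ β).aemeasurable
    _ ≤ ENNReal.ofReal (2 * r) ^ β * ∫⁻ t in Icc (0 : ℝ) 1, ∫⁻ w,
          (2 ^ n * volume B * ∫⁻ q, G q ^ β) ∂ν := by
        gcongr with t w
        rw [lintegral_prod _ (by fun_prop)]
        exact lintegral_lintegral_segment_le _ (hG.pow_const β) B w
    _ = _ := by simp

/-- The radii of a shrinking sequence of mollifiers. -/
theorem exists_bump_sequence (n : ℕ) {ε : ℝ} (hε : 0 < ε) : ∃ φ : ℕ → ContDiffBump (0 : E n),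
    Tendsto (fun i => (φ i).rOut) atTop (𝓝 0) ∧ (∀ i, (φ i).rOut ≤ 2 * (φ i).rIn) ∧
      ∀ i, (φ i).rOut ≤ ε := by
  refine ⟨fun i => ⟨ε / (i + 1) / 2, ε / (i + 1), by positivity, ?_⟩, ?_, ?_, ?_⟩
  · exact half_lt_self (by positivity)
  · exact tendsto_const_div_atTop_nhds_zero_nat ε |>.comp (tendsto_add_atTop_nat 1) |>.congr
      (by intro i; simp)
  · intro i
    exact (mul_div_cancel₀ (ε / ((i : ℝ) + 1)) two_ne_zero).ge.trans' (by ring_nf; rfl)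
  · intro i
    exact div_le_self hε.le (by simp)

/-- Fatou's lemma, once in each variable. -/
theorem lintegral_lintegral_sub_rpow_le_of_tendsto {U : ℕ → E n → ℝ} (hUc : ∀ i, Continuous (U i))
    {u : E n → ℝ} {B : Set (E n)}
    (hlim : ∀ᵐ x ∂(volume.restrict B), Tendsto (fun i => U i x) atTop (𝓝 (u x)))
    {β : ℝ} {M : ℝ≥0∞} (hM : ∀ i, ∫⁻ x in B, ∫⁻ y in B, ‖U i y - U i x‖ₑ ^ β ≤ M) :
    ∫⁻ x in B, ∫⁻ y in B, ‖u y - u x‖ₑ ^ β ≤ M := by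
  have hUm : ∀ i, Measurable fun p : E n × E n => ‖U i p.2 - U i p.1‖ₑ ^ β := by
    intro i
    have := (hUc i).measurable
    fun_prop
  calc ∫⁻ x in B, ∫⁻ y in B, ‖u y - u x‖ₑ ^ β
      ≤ ∫⁻ x in B, liminf (fun i => ∫⁻ y in B, ‖U i y - U i x‖ₑ ^ β) atTop := by
        refine lintegral_mono_ae ?_
        filter_upwards [hlim] with x hx
        refine le_trans (lintegral_mono_ae ?_) (lintegral_liminf_le
          (f := fun i y => ‖U i y - U i x‖ₑ ^ β) fun i => (hUm i).comp measurable_prodMk_left)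
        filter_upwards [hlim] with y hy
        refine le_of_eq (Tendsto.liminf_eq ?_).symm
        exact ((continuous_enorm.tendsto _).comp (hy.sub hx)).ennrpow_const β
    _ ≤ liminf (fun i => ∫⁻ x in B, ∫⁻ y in B, ‖U i y - U i x‖ₑ ^ β) atTop :=
        lintegral_liminf_le fun i => (hUm i).lintegral_prod_right'
    _ ≤ liminf (fun _ : ℕ => M) atTop :=
        liminf_le_liminf (Eventually.of_forall hM)
    _ = _ := liminf_const _

open ContinuousLinearMap Convolution in
/-- Poincaré's inequality on a ball, in the form of a double integral. -/
theorem HasWeakGradient.lintegral_lintegral_sub_rpow_le {W : Set (E n)} {u : E n → ℝ}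
    {Du : E n → E n} (h : HasWeakGradient W u Du) {z : E n} {r r' : ℝ} (hr : r < r')
    (hKW : Metric.closedBall z r' ⊆ W) {β : ℝ} (hβ : 1 ≤ β) :
    ∫⁻ x in Metric.ball z r, ∫⁻ y in Metric.ball z r, ‖u y - u x‖ₑ ^ β ≤
      ENNReal.ofReal (2 * r) ^ β * (2 ^ n * volume (Metric.ball z r) *
        ∫⁻ q in Metric.ball z r', ‖Du q‖ₑ ^ β) := by
  have hβ0 : 0 ≤ β := by linarith
  -- The gap `ρ - r` is room for the mollifiers, and the gap `r' - ρ` puts the compact ball of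
  -- radius `ρ` inside the open ball of radius `r'`.
  obtain ⟨ρ, hρ, hρ'⟩ := exists_between hr
  have hKW' : Metric.closedBall z ρ ⊆ W :=
    (Metric.closedBall_subset_closedBall hρ'.le).trans hKW
  set K := Metric.closedBall z ρ with hK
  have hDK : AEMeasurable (fun q => ‖Du q‖ₑ) (volume.restrict K) :=
    (h.2.1.integrableOn_compact_subset hKW' (isCompact_closedBall _ _)).aestronglyMeasurable.enorm
  have hui : LocallyIntegrable (K.indicator u) volume :=
    ((integrable_indicator_iff measurableSet_closedBall).2
      (h.1.integrableOn_compact_subset hKW' (isCompact_closedBall _ _))).locallyIntegrable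
  set G := K.indicator (hDK.mk _) with hGdef
  have hG : Measurable G := hDK.measurable_mk.indicator measurableSet_closedBall
  have hDG : ∀ᵐ q ∂volume, q ∈ K → ‖Du q‖ₑ = G q := by
    filter_upwards [(ae_restrict_iff' measurableSet_closedBall).1 hDK.ae_eq_mk] with q hq hqK
    rw [hGdef, Set.indicator_of_mem hqK, hq hqK]
  have hGint : ∫⁻ q, G q ^ β ≤ ∫⁻ q in Metric.ball z r', ‖Du q‖ₑ ^ β := by
    have : ∀ q, G q ^ β = K.indicator (fun q => G q ^ β) q := by
      intro q
      by_cases hq : q ∈ K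
      · simp [hq]
      · simp [hGdef, hq, show 0 < β by linarith]
    calc ∫⁻ q, G q ^ β = ∫⁻ q in K, G q ^ β := by
          rw [← lintegral_indicator measurableSet_closedBall]
          exact lintegral_congr this
      _ = ∫⁻ q in K, ‖Du q‖ₑ ^ β := by
          refine setLIntegral_congr_fun_ae measurableSet_closedBall ?_
          filter_upwards [hDG] with q hq hqK
          rw [hq hqK]
      _ ≤ _ := lintegral_mono_set (Metric.closedBall_subset_ball hρ')
  obtain ⟨φ, hφ0, hφ1, hφ2⟩ := exists_bump_sequence n (sub_pos.2 hρ)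
  have hlim := ContDiffBump.ae_convolution_tendsto_right_of_locallyIntegrable hφ0
    (Eventually.of_forall hφ1) hui
  have hBK : Metric.ball z r ⊆ K :=
    Metric.ball_subset_closedBall.trans (Metric.closedBall_subset_closedBall hρ.le)
  refine lintegral_lintegral_sub_rpow_le_of_tendsto
    (U := fun i => (φ i).normed volume ⋆[lsmul ℝ ℝ, volume] K.indicator u) (fun i => ?_) ?_
    fun i => ?_
  · exact ((φ i).hasCompactSupport_normed.contDiff_convolution_left (n := 0) _
      (φ i).contDiff_normed hui).continuous
  · filter_upwards [ae_restrict_of_ae hlim, ae_restrict_mem measurableSet_ball] with x hx hxB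
    rwa [Set.indicator_of_mem (hBK hxB)] at hx
  · refine (h.lintegral_mollify_sub_rpow_le hKW' (φ i) (by linarith [hφ2 i]) hG
      (hDG.mono fun q hq hqK => (hq hqK).le) hβ).trans ?_
    gcongr

open ContinuousLinearMap Convolution in
/-- Poincaré's inequality on a ball for an essentially bounded gradient. -/
theorem HasWeakGradient.ae_ae_enorm_sub_le {W : Set (E n)} {u : E n → ℝ}
    {Du : E n → E n} (h : HasWeakGradient W u Du) {z : E n} {r r' : ℝ} (hr : r < r')
    (hKW : Metric.closedBall z r' ⊆ W) {M : ℝ≥0∞}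
    (hM : ∀ᵐ q ∂volume, q ∈ Metric.ball z r' → ‖Du q‖ₑ ≤ M) :
    ∀ᵐ x ∂(volume.restrict (Metric.ball z r)), ∀ᵐ y ∂(volume.restrict (Metric.ball z r)),
      ‖u y - u x‖ₑ ≤ ENNReal.ofReal (2 * r) * M := by
  obtain ⟨ρ, hρ, hρ'⟩ := exists_between hr
  have hKW' : Metric.closedBall z ρ ⊆ W :=
    (Metric.closedBall_subset_closedBall hρ'.le).trans hKW
  set K := Metric.closedBall z ρ with hK
  have hui : LocallyIntegrable (K.indicator u) volume :=
    ((integrable_indicator_iff measurableSet_closedBall).2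
      (h.1.integrableOn_compact_subset hKW' (isCompact_closedBall _ _))).locallyIntegrable
  obtain ⟨φ, hφ0, hφ1, hφ2⟩ := exists_bump_sequence n (sub_pos.2 hρ)
  have hlim := ContDiffBump.ae_convolution_tendsto_right_of_locallyIntegrable hφ0
    (Eventually.of_forall hφ1) hui
  have hBK : Metric.ball z r ⊆ K :=
    Metric.ball_subset_closedBall.trans (Metric.closedBall_subset_closedBall hρ.le)
  filter_upwards [ae_restrict_of_ae hlim, ae_restrict_mem measurableSet_ball] with x hx hxB
  filter_upwards [ae_restrict_of_ae hlim, ae_restrict_mem measurableSet_ball] with y hy hyB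
  rw [Set.indicator_of_mem (hBK hxB)] at hx
  rw [Set.indicator_of_mem (hBK hyB)] at hy
  refine le_of_tendsto ((continuous_enorm.tendsto _).comp (hy.sub hx))
    (Eventually.of_forall fun i => ?_)
  refine (h.enorm_mollify_sub_le (isCompact_closedBall z ρ) hKW' (φ i) (G := fun _ => M)
    (hM.mono fun q hq hqK => hq (Metric.closedBall_subset_ball hρ' hqK)) (convex_ball z r)
    (fun p hp => Metric.closedBall_subset_closedBall' (by
        have := Metric.mem_ball.1 hp; linarith [hφ2 i])) hxB hyB).trans ?_
  have h2 : ‖y - x‖ₑ ≤ ENNReal.ofReal (2 * r) := by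
    rw [← ofReal_norm, ← dist_eq_norm]
    refine ENNReal.ofReal_le_ofReal ?_
    have := dist_triangle_right y x z
    have h3 := Metric.mem_ball.1 hxB
    have h4 := Metric.mem_ball.1 hyB
    linarith
  refine (mul_le_mul_left h2 _).trans (le_of_eq ?_)
  have : ∫⁻ w, ENNReal.ofReal ((φ i).normed volume w) * M = M := by
    rw [lintegral_mul_const _ (φ i).continuous_normed.measurable.ennreal_ofReal,
      lintegral_ofReal_normed_bump, one_mul]
  simp [this]

end Poincare

/-! ### Oscillation and comparison of averages over balls. -/

section Averages

variable {n : ℕ}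

/-- Normalized Lebesgue measure on a ball. -/
noncomputable def avgMeasure (z : E n) (r : ℝ) : Measure (E n) :=
  (volume (Metric.ball z r))⁻¹ • volume.restrict (Metric.ball z r)

theorem volume_ball_ne_zero (z : E n) {r : ℝ} (hr : 0 < r) : volume (Metric.ball z r) ≠ 0 :=
  (Metric.measure_ball_pos _ _ hr).ne'

theorem volume_ball_ne_top (z : E n) (r : ℝ) : volume (Metric.ball z r) ≠ ⊤ :=
  measure_ball_lt_top.ne

theorem volume_ball_div (z w : E n) {r r' : ℝ} (hr : 0 < r) (hr' : 0 < r') :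
    volume (Metric.ball z r) / volume (Metric.ball w r') = ENNReal.ofReal (r / r') ^ n := by
  rw [Measure.addHaar_ball_of_pos _ _ hr, Measure.addHaar_ball_of_pos _ _ hr', finrank_euclideanSpace_fin,
    ENNReal.mul_div_mul_right _ _ (volume_ball_ne_zero 0 one_pos) (volume_ball_ne_top _ _),
    ← ENNReal.ofReal_div_of_pos (by positivity), ← div_pow, ENNReal.ofReal_pow (by positivity)]

theorem isProbabilityMeasure_avgMeasure (z : E n) {r : ℝ} (hr : 0 < r) :
    IsProbabilityMeasure (avgMeasure z r) := ⟨by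
  rw [avgMeasure, Measure.smul_apply, Measure.restrict_apply_univ, smul_eq_mul,
    ENNReal.inv_mul_cancel (volume_ball_ne_zero z hr) (volume_ball_ne_top z r)]⟩

theorem ae_avgMeasure_iff (z : E n) (r : ℝ) {p : E n → Prop} :
    (∀ᵐ x ∂(avgMeasure z r), p x) ↔ ∀ᵐ x ∂(volume.restrict (Metric.ball z r)), p x := by
  rw [avgMeasure, Measure.ae_ennreal_smul_measure_iff]
  exact ENNReal.inv_ne_zero.2 (volume_ball_ne_top z r)

theorem lintegral_avgMeasure (z : E n) (r : ℝ) (f : E n → ℝ≥0∞) :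
    ∫⁻ x, f x ∂(avgMeasure z r) =
      (volume (Metric.ball z r))⁻¹ * ∫⁻ x in Metric.ball z r, f x := by
  rw [avgMeasure, lintegral_smul_measure, smul_eq_mul]

theorem avgMeasure_le {z w : E n} {r R : ℝ} (hr : 0 < r)
    (h : Metric.ball z r ⊆ Metric.ball w R) :
    avgMeasure z r ≤ (volume (Metric.ball w R) / volume (Metric.ball z r)) • avgMeasure w R := by
  have h0 := volume_ball_ne_zero z hr
  have h1 : volume (Metric.ball w R) ≠ 0 := fun h' => h0 (measure_mono_null h h')
  rw [avgMeasure, avgMeasure, smul_smul, ENNReal.div_eq_inv_mul, mul_assoc,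
    ENNReal.mul_inv_cancel h1 (volume_ball_ne_top w R), mul_one]
  gcongr

theorem one_le_volume_div {z w : E n} {r R : ℝ} (hr : 0 < r)
    (h : Metric.ball z r ⊆ Metric.ball w R) :
    1 ≤ volume (Metric.ball w R) / volume (Metric.ball z r) := by
  rw [ENNReal.le_div_iff_mul_le (Or.inl (volume_ball_ne_zero z hr))
    (Or.inl (volume_ball_ne_top z r)), one_mul]
  exact measure_mono h

/-- This frees the Poincaré constant from the exponent: a factor gained inside an `L^b` integral
comes out as `K ^ (1 / b)`. -/
theorem rpow_inv_le_self {K : ℝ≥0∞} (hK : 1 ≤ K) {b : ℝ} (hb : 1 ≤ b) : K ^ (1 / b) ≤ K := by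
  calc K ^ (1 / b) ≤ K ^ (1 : ℝ) :=
        ENNReal.rpow_le_rpow_of_exponent_le hK (by rw [div_le_one] <;> linarith)
    _ = K := ENNReal.rpow_one K

theorem integral_avgMeasure_eq (z : E n) (r : ℝ) (f : E n → ℝ) :
    ⨍ x in Metric.ball z r, f x = ∫ x, f x ∂(avgMeasure z r) := by
  rw [average_eq', avgMeasure, Measure.restrict_apply_univ]

theorem laverage_eq_lintegral_avgMeasure (z : E n) (r : ℝ) (f : E n → ℝ≥0∞) :
    ⨍⁻ x in Metric.ball z r, f x ∂volume = ∫⁻ x, f x ∂(avgMeasure z r) := by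
  rw [laverage_eq', avgMeasure, Measure.restrict_apply_univ]

theorem enorm_sub_integral_le {α : Type*} [MeasurableSpace α] (μ : Measure α)
    [IsProbabilityMeasure μ] {f : α → ℝ} (hf : Integrable f μ) (a : ℝ) :
    ‖a - ∫ x, f x ∂μ‖ₑ ≤ ∫⁻ x, ‖f x - a‖ₑ ∂μ := by
  have : a - ∫ x, f x ∂μ = ∫ x, (a - f x) ∂μ := by
    rw [integral_sub (integrable_const a) hf]; simp
  rw [this]
  refine (enorm_integral_le_lintegral_enorm _).trans (le_of_eq ?_)
  exact lintegral_congr fun x => by rw [← enorm_neg, neg_sub]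

theorem integrable_avgMeasure {u : E n → ℝ} {z : E n} {r : ℝ} (hr : 0 < r)
    (hu : IntegrableOn u (Metric.ball z r)) : Integrable u (avgMeasure z r) :=
  hu.smul_measure (ENNReal.inv_ne_top.2 (volume_ball_ne_zero z hr))

/-- Poincaré's inequality on a ball, for the average over a smaller ball, with a constant that does
not depend on the exponent. -/
theorem HasWeakGradient.eLpNorm_sub_average_le {W : Set (E n)} {u : E n → ℝ}
    {Du : E n → E n} (h : HasWeakGradient W u Du) {z z₁ : E n} {r r' r₁ : ℝ} (hr : r < r')
    (hKW : Metric.closedBall z r' ⊆ W) (hr₁ : 0 < r₁)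
    (hB : Metric.ball z₁ r₁ ⊆ Metric.ball z r) {β : ℝ≥0∞} (hβ : 1 ≤ β) :
    eLpNorm (fun x => u x - ⨍ y in Metric.ball z₁ r₁, u y) β (avgMeasure z r) ≤
      ENNReal.ofReal (2 * r) *
        (2 ^ n * (volume (Metric.ball z r') / volume (Metric.ball z₁ r₁))) *
        eLpNorm Du β (avgMeasure z r') := by
  have hBr' : Metric.ball z r ⊆ Metric.ball z r' := Metric.ball_subset_ball hr.le
  have hr0 : 0 < r := by
    by_contra hr0
    have := hB (Metric.mem_ball_self hr₁)
    rw [Metric.ball_eq_empty.2 (not_lt.1 hr0)] at this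
    exact this
  have hV₁ := volume_ball_ne_zero z₁ hr₁
  have hV := volume_ball_ne_zero z hr0
  have hV' := volume_ball_ne_zero z (hr0.trans hr)
  have := isProbabilityMeasure_avgMeasure z₁ hr₁
  have := isProbabilityMeasure_avgMeasure z hr0
  have huK : IntegrableOn u (Metric.closedBall z r') :=
    h.1.integrableOn_compact_subset hKW (isCompact_closedBall _ _)
  have hu₁ : Integrable u (avgMeasure z₁ r₁) := integrable_avgMeasure hr₁
    (huK.mono_set ((hB.trans hBr').trans Metric.ball_subset_closedBall))
  have huae : AEStronglyMeasurable u (avgMeasure z₁ r₁) := hu₁.aestronglyMeasurable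
  set K : ℝ≥0∞ := 2 ^ n * (volume (Metric.ball z r') / volume (Metric.ball z₁ r₁)) with hKdef
  have hK : 1 ≤ K := one_le_mul (one_le_pow₀ one_le_two) (one_le_volume_div hr₁ (hB.trans hBr'))
  have hpt : ∀ x, ‖u x - ⨍ y in Metric.ball z₁ r₁, u y‖ₑ ≤
      ∫⁻ y, ‖u y - u x‖ₑ ∂(avgMeasure z₁ r₁) := fun x => by
    rw [integral_avgMeasure_eq]
    exact enorm_sub_integral_le _ hu₁ _
  rcases eq_or_ne β ⊤ with rfl | hβ'
  · rw [eLpNorm_exponent_top, eLpNorm_exponent_top]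
    have hM : ∀ᵐ q ∂volume, q ∈ Metric.ball z r' →
        ‖Du q‖ₑ ≤ eLpNormEssSup Du (avgMeasure z r') := by
      rw [← ae_restrict_iff' measurableSet_ball, ← ae_avgMeasure_iff]
      exact enorm_ae_le_eLpNormEssSup _ _
    refine eLpNormEssSup_le_of_ae_enorm_bound ?_
    rw [ae_avgMeasure_iff]
    filter_upwards [h.ae_ae_enorm_sub_le hr hKW hM] with x hx
    refine (hpt x).trans ?_
    calc ∫⁻ y, ‖u y - u x‖ₑ ∂(avgMeasure z₁ r₁)
        ≤ ∫⁻ y, ENNReal.ofReal (2 * r) * eLpNormEssSup Du (avgMeasure z r')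
            ∂(avgMeasure z₁ r₁) := by
          refine lintegral_mono_ae ?_
          rw [ae_avgMeasure_iff]
          exact ae_restrict_of_ae_restrict_of_subset hB hx
      _ = ENNReal.ofReal (2 * r) * eLpNormEssSup Du (avgMeasure z r') := by simp
      _ ≤ _ := by
          rw [mul_right_comm]
          exact le_mul_of_one_le_right' hK
  · have hβ0 : β ≠ 0 := (one_pos.trans_le hβ).ne'
    have hb : 1 ≤ β.toReal := by
      rw [← ENNReal.toReal_one]; exact ENNReal.toReal_mono hβ' hβ
    set b := β.toReal
    have hb0 : 0 ≤ b := by linarith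
    rw [eLpNorm_eq_lintegral_rpow_enorm_toReal hβ0 hβ',
      eLpNorm_eq_lintegral_rpow_enorm_toReal hβ0 hβ']
    have main : ∫⁻ x, ‖u x - ⨍ y in Metric.ball z₁ r₁, u y‖ₑ ^ b ∂(avgMeasure z r) ≤
        ENNReal.ofReal (2 * r) ^ b * K * ∫⁻ x, ‖Du x‖ₑ ^ b ∂(avgMeasure z r') := by
      calc ∫⁻ x, ‖u x - ⨍ y in Metric.ball z₁ r₁, u y‖ₑ ^ b ∂(avgMeasure z r)
          ≤ ∫⁻ x, ∫⁻ y, ‖u y - u x‖ₑ ^ b ∂(avgMeasure z₁ r₁) ∂(avgMeasure z r) := by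
            refine lintegral_mono fun x => ?_
            refine (ENNReal.rpow_le_rpow (hpt x) hb0).trans ?_
            exact lintegral_rpow_le_lintegral_rpow _
              (huae.sub aestronglyMeasurable_const).enorm hb
        -- The inner average is enlarged to the whole ball while keeping the normalization of the
        -- small one; this produces the volume ratio in the constant.
        _ ≤ ∫⁻ x, (volume (Metric.ball z₁ r₁))⁻¹ *
              (∫⁻ y in Metric.ball z r, ‖u y - u x‖ₑ ^ b) ∂(avgMeasure z r) := by
            refine lintegral_mono fun x => ?_
            rw [lintegral_avgMeasure]
            gcongr
        _ = (volume (Metric.ball z₁ r₁))⁻¹ * ((volume (Metric.ball z r))⁻¹ *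
              ∫⁻ x in Metric.ball z r, ∫⁻ y in Metric.ball z r, ‖u y - u x‖ₑ ^ b) := by
            rw [lintegral_const_mul' _ _ (ENNReal.inv_ne_top.2 hV₁), lintegral_avgMeasure]
        _ ≤ (volume (Metric.ball z₁ r₁))⁻¹ * ((volume (Metric.ball z r))⁻¹ *
              (ENNReal.ofReal (2 * r) ^ b * (2 ^ n * volume (Metric.ball z r) *
              ∫⁻ q in Metric.ball z r', ‖Du q‖ₑ ^ b))) := by
            gcongr
            exact h.lintegral_lintegral_sub_rpow_le hr hKW hb
        _ = ((volume (Metric.ball z r))⁻¹ * volume (Metric.ball z r)) *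
              (ENNReal.ofReal (2 * r) ^ b * (2 ^ n * (volume (Metric.ball z₁ r₁))⁻¹) *
              ∫⁻ q in Metric.ball z r', ‖Du q‖ₑ ^ b) := by ring
        _ = ENNReal.ofReal (2 * r) ^ b * (2 ^ n * (volume (Metric.ball z₁ r₁))⁻¹) *
              ((volume (Metric.ball z r') * (volume (Metric.ball z r'))⁻¹) *
              ∫⁻ q in Metric.ball z r', ‖Du q‖ₑ ^ b) := by
            rw [ENNReal.inv_mul_cancel hV (volume_ball_ne_top _ _),
              ENNReal.mul_inv_cancel hV' (volume_ball_ne_top _ _), one_mul, one_mul]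
        _ = _ := by
            rw [lintegral_avgMeasure, hKdef, div_eq_mul_inv]
            ring
    calc _ ≤ (ENNReal.ofReal (2 * r) ^ b * K *
          ∫⁻ x, ‖Du x‖ₑ ^ b ∂(avgMeasure z r')) ^ (1 / b) := by gcongr
      _ = ENNReal.ofReal (2 * r) * K ^ (1 / b) *
          (∫⁻ x, ‖Du x‖ₑ ^ b ∂(avgMeasure z r')) ^ (1 / b) := by
          rw [ENNReal.mul_rpow_of_nonneg _ _ (by positivity),
            ENNReal.mul_rpow_of_nonneg _ _ (by positivity), ← ENNReal.rpow_mul,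
            mul_one_div_cancel (by linarith), ENNReal.rpow_one]
      _ ≤ _ := by
          gcongr
          exact rpow_inv_le_self hK hb

/-- The averages of a function over two balls inside a common ball are close to one another. -/
theorem HasWeakGradient.enorm_average_sub_average_le {W : Set (E n)} {u : E n → ℝ}
    {Du : E n → E n} (h : HasWeakGradient W u Du) {z z₁ z₂ : E n} {r r' r₁ r₂ : ℝ} (hr : r < r')
    (hKW : Metric.closedBall z r' ⊆ W) (hr₁ : 0 < r₁) (hr₂ : 0 < r₂)
    (hB₁ : Metric.ball z₁ r₁ ⊆ Metric.ball z r) (hB₂ : Metric.ball z₂ r₂ ⊆ Metric.ball z r) :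
    ‖(⨍ y in Metric.ball z₁ r₁, u y) - ⨍ y in Metric.ball z₂ r₂, u y‖ₑ ≤
      (volume (Metric.ball z r) / volume (Metric.ball z₂ r₂)) * (ENNReal.ofReal (2 * r) *
        (2 ^ n * (volume (Metric.ball z r') / volume (Metric.ball z₁ r₁))) *
        ∫⁻ x, ‖Du x‖ₑ ∂(avgMeasure z r')) := by
  have := isProbabilityMeasure_avgMeasure z₂ hr₂
  have hu₂ : Integrable u (avgMeasure z₂ r₂) := integrable_avgMeasure hr₂
    ((h.1.integrableOn_compact_subset hKW (isCompact_closedBall _ _)).mono_set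
      ((hB₂.trans (Metric.ball_subset_ball hr.le)).trans Metric.ball_subset_closedBall))
  have h1 := h.eLpNorm_sub_average_le hr hKW hr₁ hB₁ le_rfl
  rw [eLpNorm_one_eq_lintegral_enorm, eLpNorm_one_eq_lintegral_enorm] at h1
  rw [integral_avgMeasure_eq z₂]
  refine (enorm_sub_integral_le _ hu₂ _).trans ?_
  refine (lintegral_mono' (avgMeasure_le hr₂ hB₂) le_rfl).trans ?_
  rw [lintegral_smul_measure, smul_eq_mul]
  gcongr

end Averages

/-! ### Distance to the boundary and Ahlfors regularity. -/

section Geometry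

variable {n : ℕ} {Ω : Set (E n)}

theorem bdist_nonneg (Ω : Set (E n)) (x : E n) : 0 ≤ bdist Ω x := Metric.infDist_nonneg

theorem bdist_le_add_dist (Ω : Set (E n)) (x y : E n) : bdist Ω x ≤ bdist Ω y + dist x y :=
  Metric.infDist_le_infDist_add_dist

theorem bdist_le_dist {x ξ : E n} (hξ : ξ ∈ frontier Ω) : bdist Ω x ≤ dist x ξ :=
  Metric.infDist_le_dist_of_mem hξ

theorem continuous_bdist (Ω : Set (E n)) : Continuous (bdist Ω) :=
  Metric.continuous_infDist_pt _

theorem bdist_pos (hΩ : IsOpen Ω) (hne : (frontier Ω).Nonempty) {y : E n} (hy : y ∈ Ω) :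
    0 < bdist Ω y := by
  refine (isClosed_frontier.notMem_iff_infDist_pos hne).1 fun h => ?_
  have : y ∈ Ω ∩ frontier Ω := ⟨hy, h⟩
  rw [hΩ.inter_frontier_eq] at this
  exact this

theorem bdist_eq_zero {x : E n} (hx : x ∈ frontier Ω) : bdist Ω x = 0 :=
  Metric.infDist_zero_of_mem hx

/-- The ball is connected, meets `Ω`, and contains no boundary point. -/
theorem ball_bdist_subset (hΩ : IsOpen Ω) {y : E n} (hy : y ∈ Ω) :
    Metric.ball y (bdist Ω y) ⊆ Ω := by
  rcases le_or_gt (bdist Ω y) 0 with h0 | h0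
  · simp [Metric.ball_eq_empty.2 h0]
  refine (convex_ball y (bdist Ω y)).isPreconnected.subset_of_closure_inter_subset hΩ
    ⟨y, Metric.mem_ball_self h0, hy⟩ fun w hw => by_contra fun hwΩ => ?_
  have hwf : w ∈ frontier Ω := by rw [hΩ.frontier_eq]; exact ⟨hw.1, hwΩ⟩
  have h1 := bdist_le_dist (x := y) hwf
  have h2 := Metric.mem_ball'.1 hw.2
  linarith

/-- Apply regularity at a nearest boundary point with radius `δ/2`. That ball lies within `3δ/2 ≤
Nδ` of `y`, and halving the radius is what makes `δ ≤ 2 diam` enough. -/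
theorem IsAhlforsRegular.le_measure_ball {d A N : ℝ} (hreg : IsAhlforsRegular d A (frontier Ω))
    (hN : 2 ≤ N) {y : E n} (hδ : 0 < bdist Ω y)
    (hdiam : ENNReal.ofReal (bdist Ω y) ≤ 2 * Metric.ediam (frontier Ω)) :
    ENNReal.ofReal ((bdist Ω y / 2) ^ d / A) ≤
      μH[d] (Metric.ball y (N * bdist Ω y) ∩ frontier Ω) := by
  obtain ⟨x, hx, hxy⟩ := isClosed_frontier.exists_infDist_eq_dist hreg.1 y
  have hxy' : bdist Ω y = dist y x := hxy
  refine (hreg.2 x hx (bdist Ω y / 2) (by positivity) ?_).1.trans (measure_mono ?_)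
  · rw [ENNReal.ofReal_div_of_pos two_pos]
    refine ENNReal.div_le_of_le_mul ?_
    rw [mul_comm]
    simpa using hdiam
  · refine inter_subset_inter_left _ (Metric.ball_subset_ball' ?_)
    rw [dist_comm, ← hxy']
    nlinarith

/-- Ahlfors regularity gives an upper bound for the measure of balls of any centre and radius. -/
theorem exists_measure_ball_le (n : ℕ) {d A : ℝ} (hd : 0 < d) (hA : 0 < A) :
    ∃ K : ℝ, 0 < K ∧ ∀ Γ : Set (E n), IsAhlforsRegular d A Γ → 0 < Metric.ediam Γ →
      ∀ (z : E n) (r : ℝ), 0 < r → μH[d] (Metric.ball z r ∩ Γ) ≤ ENNReal.ofReal (K * r ^ d) := by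
  obtain ⟨t, -, htf, ht⟩ := (isCompact_closedBall (0 : E n) 1).finite_cover_balls
    (e := 1 / 2) (by norm_num)
  lift t to Finset (E n) using htf
  refine ⟨(t.card + 1) * (A * 2 ^ d), by positivity, fun Γ hreg hpos z r hr => ?_⟩
  -- If the ball meets `Γ`, it lies in a ball of twice the radius centred on `Γ`.
  have hball : ∀ (z : E n) (ρ : ℝ), 0 < ρ → ENNReal.ofReal (2 * ρ) ≤ Metric.ediam Γ →
      μH[d] (Metric.ball z ρ ∩ Γ) ≤ ENNReal.ofReal (A * (2 * ρ) ^ d) := by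
    intro z ρ hρ hle
    rcases (Metric.ball z ρ ∩ Γ).eq_empty_or_nonempty with h | ⟨x, hxz, hx⟩
    · simp [h]
    · refine (measure_mono ?_).trans (hreg.2 x hx (2 * ρ) (by positivity) hle).2
      refine inter_subset_inter_left _ (Metric.ball_subset_ball' ?_)
      rw [Metric.mem_ball, dist_comm] at hxz
      linarith
  have hAr : 0 ≤ A * (2 * r) ^ d := by positivity
  have hAr' : (t.card + 1) * (A * 2 ^ d) * r ^ d = (t.card + 1) * (A * (2 * r) ^ d) := by
    rw [Real.mul_rpow two_pos.le hr.le]; ring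
  rw [hAr']
  rcases le_or_gt (ENNReal.ofReal (2 * r)) (Metric.ediam Γ) with h | h
  · refine (hball z r hr h).trans (ENNReal.ofReal_le_ofReal ?_)
    have : (0 : ℝ) ≤ t.card := Nat.cast_nonneg _
    nlinarith
  -- Large radii: `Γ` has finite diameter `D ≤ 2r`. A rescaled finite cover of the unit ball covers
  -- `Γ` by balls of radius `D/2`, and doubling that radius gives exactly the largest admissible
  -- one.
  · obtain ⟨x, hx⟩ := hreg.1
    set D := (Metric.ediam Γ).toReal with hD
    have hfin : Metric.ediam Γ ≠ ⊤ := h.ne_top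
    have hDΓ : ENNReal.ofReal D = Metric.ediam Γ := ENNReal.ofReal_toReal hfin
    have hD0 : 0 < D := ENNReal.toReal_pos hpos.ne' hfin
    have hDr : D ≤ 2 * r := by
      rw [← hDΓ] at h
      exact ((ENNReal.ofReal_lt_ofReal_iff (by positivity)).1 h).le
    have hcover : Metric.ball z r ∩ Γ ⊆ ⋃ c ∈ t, Metric.ball (x + D • c) (D / 2) ∩ Γ := by
      rintro y ⟨-, hy⟩
      have hyx : dist y x ≤ D := by
        have := Metric.edist_le_ediam_of_mem hy hx
        rw [edist_dist, ← hDΓ] at this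
        exact (ENNReal.ofReal_le_ofReal_iff hD0.le).1 this
      have hmem : D⁻¹ • (y - x) ∈ Metric.closedBall (0 : E n) 1 := by
        rw [mem_closedBall_zero_iff, norm_smul, Real.norm_of_nonneg (by positivity),
          ← dist_eq_norm, inv_mul_le_iff₀ hD0]
        linarith
      obtain ⟨c, hc, hyc⟩ := mem_iUnion₂.1 (ht hmem)
      refine mem_iUnion₂.2 ⟨c, hc, ?_, hy⟩
      rw [Metric.mem_ball, dist_eq_norm] at hyc ⊢
      have : y - (x + D • c) = D • (D⁻¹ • (y - x) - c) := by
        rw [smul_sub, smul_inv_smul₀ hD0.ne']; abel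
      rw [this, norm_smul, Real.norm_of_nonneg hD0.le]
      nlinarith
    calc μH[d] (Metric.ball z r ∩ Γ)
        ≤ ∑ c ∈ t, μH[d] (Metric.ball (x + D • c) (D / 2) ∩ Γ) :=
          (measure_mono hcover).trans (measure_biUnion_finset_le _ _)
      _ ≤ ∑ c ∈ t, ENNReal.ofReal (A * (2 * r) ^ d) := by
          refine Finset.sum_le_sum fun c _ => ?_
          refine (hball _ (D / 2) (by positivity) ?_).trans (ENNReal.ofReal_le_ofReal ?_)
          · rw [mul_div_cancel₀ _ two_ne_zero, hDΓ]
          · rw [mul_div_cancel₀ _ two_ne_zero]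
            gcongr
      _ = ENNReal.ofReal (t.card * (A * (2 * r) ^ d)) := by
          rw [Finset.sum_const, nsmul_eq_mul, ENNReal.ofReal_mul (Nat.cast_nonneg _)]
          simp
      _ ≤ _ := ENNReal.ofReal_le_ofReal (by nlinarith)

end Geometry

/-! ### Whitney means along carrot paths. -/

section Chain

variable {n : ℕ} {Ω : Set (E n)}

/-- The average of `u` over the Whitney ball `B(z, κ δ(z))`. -/
noncomputable def whitneyMean (Ω : Set (E n)) (κ : ℝ) (u : E n → ℝ) (z : E n) : ℝ :=
  ⨍ x in Metric.ball z (κ * bdist Ω z), u x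

/-- The average of `|Du|` over the Whitney ball `B(w, c δ(w))`. -/
noncomputable def gradAvg (Ω : Set (E n)) (c : ℝ) (Du : E n → E n) (w : E n) : ℝ≥0∞ :=
  ∫⁻ x, ‖Du x‖ₑ ∂(avgMeasure w (c * bdist Ω w))

theorem HasUnitSpeedOn.dist_le {T : ℝ} {ζ : ℝ → E n} (h : HasUnitSpeedOn ζ (Icc 0 T)) {s t : ℝ}
    (hs : s ∈ Icc 0 T) (ht : t ∈ Icc 0 T) (hst : s ≤ t) : dist (ζ s) (ζ t) ≤ t - s := by
  have h1 := h hs ht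
  have h2 : edist (ζ s) (ζ t) ≤ eVariationOn ζ (Icc 0 T ∩ Icc s t) :=
    eVariationOn.edist_le ζ ⟨hs, left_mem_Icc.2 hst⟩ ⟨ht, right_mem_Icc.2 hst⟩
  rw [h1, edist_dist, NNReal.coe_one, one_mul] at h2
  exact (ENNReal.ofReal_le_ofReal_iff (by linarith)).1 h2

/-- Points along a carrot path, at geometrically decreasing distance from the boundary. -/
theorem HasCarrotPath.exists_chain (hΩ : IsOpen Ω) {lam : ℝ} (hlam : 0 < lam)
    {x y : E n} (hx : x ∈ frontier Ω) (hy : y ∈ Ω) (h : HasCarrotPath Ω lam x y)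
    {ρ : ℝ} (hρ : 0 < ρ) (hρ1 : ρ < 1) :
    ∃ (T : ℝ) (z : ℕ → E n), lam * T ≤ bdist Ω y ∧ bdist Ω y ≤ T ∧ z 0 = y ∧ ∀ j, z j ∈ Ω ∧
      dist (z j) x ≤ T * ρ ^ j ∧ lam * (T * ρ ^ j) ≤ bdist Ω (z j) ∧
      dist (z j) y ≤ T - T * ρ ^ j ∧ dist (z j) (z (j + 1)) ≤ T * ρ ^ j * (1 - ρ) := by
  obtain ⟨T, ζ, hT, -, hspeed, hmem, h0, hTy, hcarrot⟩ := h
  have hδy := bdist_pos hΩ ⟨x, hx⟩ hy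
  have hTmem : T ∈ Icc 0 T := right_mem_Icc.2 hT
  have h0mem : (0 : ℝ) ∈ Icc 0 T := left_mem_Icc.2 hT
  have hdist0 : ∀ t ∈ Icc 0 T, dist (ζ t) x ≤ t := fun t ht => by
    have := HasUnitSpeedOn.dist_le hspeed h0mem ht ht.1
    rwa [h0, sub_zero, dist_comm] at this
  have hyT : bdist Ω y ≤ T := (bdist_le_dist hx).trans (by simpa [hTy] using hdist0 T hTmem)
  have hTpos : 0 < T := hδy.trans_le hyT
  have htmem : ∀ j : ℕ, T * ρ ^ j ∈ Icc 0 T := fun j =>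
    ⟨by positivity, mul_le_of_le_one_right hT (pow_le_one₀ hρ.le hρ1.le)⟩
  refine ⟨T, fun j => ζ (T * ρ ^ j), by simpa [hTy] using hcarrot T hTmem, hyT, by simpa using hTy,
    fun j => ⟨?_, hdist0 _ (htmem j), hcarrot _ (htmem j), ?_, ?_⟩⟩
  · rcases hmem _ (htmem j) with hj | hj
    · exact hj
    -- The path could be at `x` only where `δ` vanishes, but the carrot condition makes `δ` positive
    -- at arc length `T ρ^j > 0`.
    · have h1 := hcarrot _ (htmem j)
      rw [mem_singleton_iff.1 hj, bdist_eq_zero hx] at h1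
      exact absurd h1 (not_le.2 (by positivity))
  · have := HasUnitSpeedOn.dist_le hspeed (htmem j) hTmem (htmem j).2
    rwa [hTy] at this
  · have := HasUnitSpeedOn.dist_le hspeed (htmem (j + 1)) (htmem j) (by
      gcongr T * ?_
      exact pow_le_pow_of_le_one hρ.le hρ1.le (Nat.le_succ j))
    rw [dist_comm]
    refine this.trans (le_of_eq ?_)
    ring

/-- Shrinking the averaging ball from `cδ` to `κδ` costs only the volume ratio `(c/κ)^n`, so the
trace is also the nontangential limit of the small means. -/
theorem HasTrace.tendsto_whitneyMean {a c κ : ℝ} {u : E n → ℝ} {x : E n} {U : ℝ}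
    (h : HasTrace Ω a c u x U) (hΩ : IsOpen Ω) (hne : (frontier Ω).Nonempty) (hκ : 0 < κ)
    (hκc : κ ≤ c)
    (hu : ∀ᶠ z in 𝓝[cone Ω a x] x, IntegrableOn u (Metric.ball z (κ * bdist Ω z))) :
    Tendsto (whitneyMean Ω κ u) (𝓝[cone Ω a x] x) (𝓝 U) := by
  have hc : 0 < c := hκ.trans_le hκc
  have hlim := ENNReal.Tendsto.const_mul (a := ENNReal.ofReal (c / κ) ^ n) h.2
    (Or.inr (by finiteness))
  rw [mul_zero] at hlim
  rw [tendsto_iff_edist_tendsto_0]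
  refine tendsto_of_tendsto_of_tendsto_of_le_of_le' tendsto_const_nhds hlim
    (Eventually.of_forall fun _ => zero_le) ?_
  filter_upwards [hu, self_mem_nhdsWithin] with z hz hzc
  have hδ := bdist_pos hΩ hne hzc.1
  have := isProbabilityMeasure_avgMeasure z (mul_pos hκ hδ)
  have hsub : Metric.ball z (κ * bdist Ω z) ⊆ Metric.ball z (c * bdist Ω z) :=
    Metric.ball_subset_ball (by gcongr)
  rw [edist_comm, edist_eq_enorm_sub, whitneyMean, integral_avgMeasure_eq,
    laverage_eq_lintegral_avgMeasure]
  refine (enorm_sub_integral_le _ (integrable_avgMeasure (mul_pos hκ hδ) hz) _).trans ?_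
  refine (lintegral_mono' (avgMeasure_le (mul_pos hκ hδ) hsub) le_rfl).trans (le_of_eq ?_)
  rw [lintegral_smul_measure, smul_eq_mul, volume_ball_div _ _ (mul_pos hc hδ) (mul_pos hκ hδ),
    mul_div_mul_right _ _ hδ.ne']

theorem bdist_bounds_of_dist_le {z w : E n} {κ : ℝ} (hκ : κ ≤ 1 / 2)
    (h : dist z w ≤ κ * bdist Ω z) :
    bdist Ω z / 2 ≤ bdist Ω w ∧ bdist Ω w ≤ 2 * bdist Ω z := by
  have h1 := bdist_le_add_dist Ω z w
  have h2 := bdist_le_add_dist Ω w z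
  rw [dist_comm] at h2
  have h3 := bdist_nonneg Ω z
  constructor <;> nlinarith

/-- The means of `u` over nearby Whitney balls differ by at most an average of the gradient. -/
theorem HasWeakGradient.enorm_whitneyMean_sub_le {W : Set (E n)} {u : E n → ℝ}
    {Du : E n → E n} (h : HasWeakGradient W u Du) {c κ : ℝ} (hc : 0 < c) (hc1 : c < 1)
    (hκ : κ = c / 10) {z z' w : E n} (hδ : 0 < bdist Ω z)
    (hzz' : dist z z' ≤ κ * bdist Ω z) (hw : w ∈ Metric.ball z (κ * bdist Ω z))
    (hW : Metric.closedBall z (4 * κ * bdist Ω z) ⊆ W) :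
    ‖whitneyMean Ω κ u z - whitneyMean Ω κ u z'‖ₑ ≤
      240 ^ n * ENNReal.ofReal (bdist Ω z) * gradAvg Ω c Du w := by
  have hκ0 : 0 < κ := by rw [hκ]; positivity
  have hκ2 : κ ≤ 1 / 2 := by rw [hκ]; linarith
  have hw' : dist z w ≤ κ * bdist Ω z := (Metric.mem_ball'.1 hw).le
  obtain ⟨hz'1, hz'2⟩ := bdist_bounds_of_dist_le hκ2 hzz'
  obtain ⟨hw1, hw2⟩ := bdist_bounds_of_dist_le hκ2 hw'
  set δ := bdist Ω z with hδdef
  have hδ' : 0 < bdist Ω z' := by linarith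
  have hδw : 0 < bdist Ω w := by linarith
  have hκδ : 0 < κ * δ := mul_pos hκ0 hδ
  have hκδ' : κ * bdist Ω z' ≤ 2 * (κ * δ) := by nlinarith
  have hsub1 : Metric.ball z (κ * δ) ⊆ Metric.ball z (3 * κ * δ) :=
    Metric.ball_subset_ball (by linarith)
  have hsub2 : Metric.ball z' (κ * bdist Ω z') ⊆ Metric.ball z (3 * κ * δ) := by
    refine Metric.ball_subset_ball' ?_
    rw [dist_comm]; linarith
  -- This fixes `κ = c/10`: `B(z, 4κδ)` lies within `5κδ = cδ/2` of `w`, and `δ(w) ≥ δ/2`.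
  have hcw : 5 * (κ * δ) ≤ c * bdist Ω w := by
    have : 5 * (κ * δ) = c * (δ / 2) := by rw [hκ]; ring
    rw [this]; gcongr
  have hsub3 : Metric.ball z (4 * κ * δ) ⊆ Metric.ball w (c * bdist Ω w) :=
    Metric.ball_subset_ball' (by linarith)
  have main := h.enorm_average_sub_average_le (r := 3 * κ * δ) (r' := 4 * κ * δ) (by nlinarith) hW
    hκδ (mul_pos hκ0 hδ') hsub1 hsub2
  have havg : ∫⁻ x, ‖Du x‖ₑ ∂(avgMeasure z (4 * κ * δ)) ≤ 5 ^ n * gradAvg Ω c Du w := by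
    refine (lintegral_mono' (avgMeasure_le (by positivity) hsub3) le_rfl).trans ?_
    rw [lintegral_smul_measure, smul_eq_mul, volume_ball_div _ _ (by positivity) (by positivity)]
    unfold gradAvg
    gcongr
    refine ENNReal.ofReal_le_of_le_toReal ?_
    rw [div_le_iff₀ (by positivity), ENNReal.toReal_ofNat, hκ]
    nlinarith
  refine main.trans ?_
  rw [volume_ball_div _ _ (by positivity) (by positivity),
    volume_ball_div _ _ (by positivity) (by positivity)]
  have e1 : ENNReal.ofReal (3 * κ * δ / (κ * bdist Ω z')) ≤ 6 := by
    refine ENNReal.ofReal_le_of_le_toReal ?_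
    rw [div_le_iff₀ (by positivity), ENNReal.toReal_ofNat]
    nlinarith
  have e2 : ENNReal.ofReal (4 * κ * δ / (κ * δ)) ≤ 4 := by
    refine ENNReal.ofReal_le_of_le_toReal ?_
    rw [div_le_iff₀ (by positivity), ENNReal.toReal_ofNat]
    nlinarith
  have e3 : ENNReal.ofReal (2 * (3 * κ * δ)) ≤ ENNReal.ofReal δ := by
    refine ENNReal.ofReal_le_ofReal ?_
    rw [hκ]; nlinarith
  calc _ ≤ 6 ^ n * (ENNReal.ofReal δ * (2 ^ n * 4 ^ n) * (5 ^ n * gradAvg Ω c Du w)) := by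
        gcongr
    -- The factors are the passage from `B(z', κδ(z'))` to `B(z, 3κδ)`, the Poincaré factor, the
    -- ratio of `4κδ` to `κδ`, and the passage to `B(w, cδ(w))`.
    _ = (6 * 2 * 4 * 5) ^ n * ENNReal.ofReal δ * gradAvg Ω c Du w := by
        rw [mul_pow, mul_pow, mul_pow]; ring
    _ = _ := by norm_num

/-- The interior term. Bounding `c` and `c'` by one in the Poincaré constant makes it independent of
`c'`, as well as of `β`. -/
theorem HasWeakGradient.eLpNorm_sub_whitneyMean_le {W : Set (E n)} {u : E n → ℝ}
    {Du : E n → E n} (h : HasWeakGradient W u Du) {c c' κ : ℝ} (hc : 0 < c) (hcc' : c < c')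
    (hc'1 : c' < 1) (hκ : κ = c / 10) {y : E n} (hδ : 0 < bdist Ω y)
    (hW : Metric.closedBall y (c' * bdist Ω y) ⊆ W) {β : ℝ≥0∞} (hβ : 1 ≤ β) :
    whitneyAvg Ω c β (fun z => u z - whitneyMean Ω κ u y) y ≤
      ENNReal.ofReal (2 * (20 / c) ^ n) * ENNReal.ofReal (bdist Ω y) *
        whitneyAvg Ω c' β Du y := by
  have hκ0 : 0 < κ := by rw [hκ]; positivity
  have main := h.eLpNorm_sub_average_le (r := c * bdist Ω y) (r' := c' * bdist Ω y)
    (r₁ := κ * bdist Ω y) (z₁ := y) (by gcongr) hW (by positivity)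
    (Metric.ball_subset_ball (by gcongr; rw [hκ]; linarith)) hβ
  refine main.trans ?_
  change _ ≤ _ * eLpNorm Du β (avgMeasure y (c' * bdist Ω y))
  refine mul_le_mul' ?_ le_rfl
  rw [volume_ball_div _ _ (by nlinarith) (by positivity), mul_div_mul_right _ _ hδ.ne']
  have h1 : (2 : ℝ≥0∞) = ENNReal.ofReal 2 := by simp
  rw [h1, ← mul_pow, ← ENNReal.ofReal_mul zero_le_two,
    ← ENNReal.ofReal_pow (by have := hc.trans hcc'; positivity),
    ← ENNReal.ofReal_mul (by positivity), ← ENNReal.ofReal_mul (by positivity)]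
  refine ENNReal.ofReal_le_ofReal ?_
  have h2 : 2 * (c' / κ) ≤ 20 / c := by
    rw [hκ, div_div_eq_mul_div, ← mul_div_assoc]
    gcongr
    linarith
  have h3 : 0 ≤ 2 * (c' / κ) := by have := hc.trans hcc'; positivity
  calc 2 * (c * bdist Ω y) * (2 * (c' / κ)) ^ n ≤ 2 * (1 * bdist Ω y) * (20 / c) ^ n := by
        gcongr
        linarith
    _ = _ := by ring

/-- Enlarge the ball from `cδ` to `c'δ`, with `(c'/c)^n ≤ (1/c)^n`, and pass from exponent one to
`β` for a probability measure. -/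
theorem gradAvg_le_whitneyAvg {Du : E n → E n} {c c' : ℝ} (hc : 0 < c) (hcc' : c < c')
    (hc'1 : c' < 1) {w : E n} (hδ : 0 < bdist Ω w) {β : ℝ≥0∞} (hβ : 1 ≤ β)
    (hDu : AEStronglyMeasurable Du (volume.restrict (Metric.ball w (c' * bdist Ω w)))) :
    gradAvg Ω c Du w ≤ ENNReal.ofReal ((1 / c) ^ n) * whitneyAvg Ω c' β Du w := by
  have hc'0 : 0 < c' := hc.trans hcc'
  have := isProbabilityMeasure_avgMeasure w (mul_pos hc'0 hδ)
  unfold gradAvg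
  refine (lintegral_mono' (avgMeasure_le (z := w) (w := w) (R := c' * bdist Ω w) (by positivity)
    (Metric.ball_subset_ball (by gcongr))) le_rfl).trans ?_
  rw [lintegral_smul_measure, smul_eq_mul, volume_ball_div _ _ (by positivity) (by positivity),
    mul_div_mul_right _ _ hδ.ne', ← eLpNorm_one_eq_lintegral_enorm]
  change _ ≤ _ * eLpNorm Du β (avgMeasure w (c' * bdist Ω w))
  rw [ENNReal.ofReal_pow (by positivity)]
  gcongr
  exact eLpNorm_le_eLpNorm_of_exponent_le hβ (hDu.smul_measure _)

end Chain

/-! ### The chain from an interior point to the boundary. -/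

section ChainEstimate

variable {n : ℕ} {Ω : Set (E n)}

/-- As `δ(z) ≤ |z - ξ| < r`, Whitney balls of points in `B(ξ, r)` stay in `B(ξ, 2r)`; hence the
factor two in the domain of `u`. -/
theorem closedBall_subset_inter (hΩ : IsOpen Ω) {ξ z : E n} (hξ : ξ ∈ frontier Ω) {r t : ℝ}
    (ht : t < 1) (hz : z ∈ Ω) (hzr : dist z ξ < r) :
    Metric.closedBall z (t * bdist Ω z) ⊆ Ω ∩ Metric.ball ξ (2 * r) := by
  have hδ := bdist_pos hΩ ⟨ξ, hξ⟩ hz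
  have hδr := bdist_le_dist (x := z) hξ
  refine subset_inter (subset_trans ?_ (ball_bdist_subset hΩ hz)) fun w hw => ?_
  · exact Metric.closedBall_subset_ball (by nlinarith)
  · have := dist_triangle w z ξ
    have := Metric.mem_closedBall.1 hw
    rw [Metric.mem_ball]
    nlinarith

theorem HasTrace.tendsto_whitneyMean_of_dist_lt (hΩ : IsOpen Ω) {ξ x : E n}
    (hξ : ξ ∈ frontier Ω) {r a c κ : ℝ} {u : E n → ℝ} {Du : E n → E n}
    (h : HasWeakGradient (Ω ∩ Metric.ball ξ (2 * r)) u Du) (hκ : 0 < κ) (hκc : κ ≤ c)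
    (hc1 : c < 1) (hxr : dist x ξ < r) {U : ℝ} (hU : HasTrace Ω a c u x U) :
    Tendsto (whitneyMean Ω κ u) (𝓝[cone Ω a x] x) (𝓝 U) := by
  refine hU.tendsto_whitneyMean hΩ ⟨ξ, hξ⟩ hκ hκc ?_
  have : ∀ᶠ w in 𝓝[cone Ω a x] x, w ∈ Metric.ball ξ r :=
    nhdsWithin_le_nhds (Metric.isOpen_ball.mem_nhds hxr)
  filter_upwards [this, self_mem_nhdsWithin] with w hw hwc
  exact (h.1.integrableOn_compact_subset (closedBall_subset_inter hΩ hξ (hκc.trans_lt hc1)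
    hwc.1 hw) (isCompact_closedBall _ _)).mono_set Metric.ball_subset_closedBall

theorem dist_lt_of_mem_carrotSet {lam N R : ℝ} (hlam : 0 < lam) (hN : 0 ≤ N) {ξ x y : E n}
    (hξ : ξ ∈ frontier Ω) (hyR : dist y ξ < R) (hx : x ∈ carrotSet Ω lam N y) :
    dist x ξ < (N + 1 / lam + 1) * R := by
  have hR : 0 < R := dist_nonneg.trans_lt hyR
  have h1 := dist_triangle x y ξ
  have h2 : 0 < 1 / lam * R := by positivity
  have h3 : dist x y < N * bdist Ω y := hx.1.1
  have h4 := bdist_le_dist (x := y) hξ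
  nlinarith

/-- The aperture condition says `1/λ < 1 + a`, while the carrot bounds give `|z_j - x| ≤ δ(z_j)/λ`.
So the whole chain lies in the cone. -/
theorem tendsto_nhdsWithin_cone {lam a ρ T : ℝ} (hlam : 0 < lam) (ha : (1 - lam) / lam < a)
    (hρ : 0 ≤ ρ) (hρ1 : ρ < 1) {x : E n} {z : ℕ → E n} (hδ : ∀ j, 0 < bdist Ω (z j))
    (hz : ∀ j, z j ∈ Ω ∧ dist (z j) x ≤ T * ρ ^ j ∧ lam * (T * ρ ^ j) ≤ bdist Ω (z j)) :
    Tendsto z atTop (𝓝[cone Ω a x] x) := by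
  refine tendsto_nhdsWithin_iff.2 ⟨?_, Eventually.of_forall fun j => ⟨(hz j).1, ?_⟩⟩
  · rw [tendsto_iff_dist_tendsto_zero]
    refine squeeze_zero (fun _ => dist_nonneg) (fun j => (hz j).2.1) ?_
    simpa using (tendsto_pow_atTop_nhds_zero_of_lt_one hρ hρ1).const_mul T
  · have h1 : 1 / lam < 1 + a := by
      have : (1 - lam) / lam = 1 / lam - 1 := by field_simp
      linarith
    calc dist (z j) x ≤ T * ρ ^ j := (hz j).2.1
      _ ≤ 1 / lam * bdist Ω (z j) := by
        rw [one_div, ← div_eq_inv_mul, le_div_iff₀ hlam]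
        linarith [(hz j).2.2]
      _ < _ := by gcongr; exact hδ j

theorem HasCarrotPath.mem_closure_cone (hΩ : IsOpen Ω) {lam a : ℝ} (hlam : 0 < lam)
    (ha : (1 - lam) / lam < a) {x y : E n} (hx : x ∈ frontier Ω) (hy : y ∈ Ω)
    (h : HasCarrotPath Ω lam x y) : x ∈ closure (cone Ω a x) := by
  obtain ⟨T, z, -, -, -, hz⟩ := h.exists_chain hΩ hlam hx hy (ρ := 1 / 2) (by norm_num)
    (by norm_num)
  have := tendsto_nhdsWithin_cone hlam ha (by norm_num) (by norm_num : (1 / 2 : ℝ) < 1)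
    (fun j => bdist_pos hΩ ⟨x, hx⟩ (hz j).1) (fun j => ⟨(hz j).1, (hz j).2.1, (hz j).2.2.1⟩)
  exact mem_closure_iff_nhdsWithin_neBot.2 this.neBot

/-- The points of `D` near `x` at distance comparable to `τ` from the boundary. -/
def whitneyRegion (Ω D : Set (E n)) (lam τ : ℝ) (x : E n) : Set (E n) :=
  {w | w ∈ D ∧ lam / 2 * τ ≤ bdist Ω w ∧ bdist Ω w ≤ 2 / lam * τ ∧ dist w x ≤ 2 / lam * τ}

/-- Telescope the Whitney means along the chain; their limit is `U`. Since `δ(y) ≤ T ≤ δ(y)/λ`, the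
scale `T ρ^j` may be replaced by `ρ^j δ(y)`, which does not depend on `x`. Each link is controlled
at every point `w` of a Whitney ball, so `w` may later be averaged (finite `p`) or chosen (`p = ∞`).
-/
theorem exists_chain_estimate (hΩ : IsOpen Ω) {lam N a c κ ρ R : ℝ} (hlam : 0 < lam)
    (hlam1 : lam ≤ 1) (hN : 2 ≤ N) (ha : (1 - lam) / lam < a) (hc : 0 < c) (hc1 : c < 1)
    (hκ : κ = c / 10) (hρ : ρ = 1 - lam * κ) {ξ x y : E n} (hξ : ξ ∈ frontier Ω)
    {u : E n → ℝ} {Du : E n → E n}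
    (h : HasWeakGradient (Ω ∩ Metric.ball ξ (2 * ((N + 1 / lam + 1) * R))) u Du)
    (hy : y ∈ Ω) (hyR : dist y ξ < R) (hx : x ∈ carrotSet Ω lam N y) {U : ℝ}
    (hU : HasTrace Ω a c u x U) :
    ∃ e : ℕ → ℝ≥0∞, ‖whitneyMean Ω κ u y - U‖ₑ ≤ ∑' j, e j ∧ ∀ j, ∃ z : E n,
      lam * (ρ ^ j * bdist Ω y) ≤ bdist Ω z ∧ bdist Ω z ≤ ρ ^ j * bdist Ω y / lam ∧
      Metric.ball z (κ * bdist Ω z) ⊆ whitneyRegion Ω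
        (Metric.ball ξ ((N + 1 / lam + 1) * R) ∩ Ω) lam (ρ ^ j * bdist Ω y) x ∧
      ∀ w ∈ Metric.ball z (κ * bdist Ω z),
        e j ≤ 240 ^ n * ENNReal.ofReal (bdist Ω z) * gradAvg Ω c Du w := by
  have hκ0 : 0 < κ := by rw [hκ]; positivity
  have hκ1 : κ ≤ 1 / 10 := by rw [hκ]; linarith
  have hlamκ : lam * κ ≤ 1 / 10 := by nlinarith
  have hρ0 : 0 < ρ := by rw [hρ]; linarith
  have hρ1 : ρ < 1 := by rw [hρ]; have := mul_pos hlam hκ0; linarith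
  have hxf : x ∈ frontier Ω := hx.1.2
  have hR : 0 < R := dist_nonneg.trans_lt hyR
  have hδy := bdist_pos hΩ ⟨ξ, hξ⟩ hy
  have hδyR : bdist Ω y < R := (bdist_le_dist hξ).trans_lt hyR
  have hxy : dist x y < N * bdist Ω y := hx.1.1
  obtain ⟨T, z, hT, hyT, hz0, hz⟩ := hx.2.exists_chain hΩ hlam hxf hy hρ0 hρ1
  have hTpos : 0 < T := hδy.trans_le hyT
  have hTlam : T ≤ bdist Ω y / lam := by rw [le_div_iff₀ hlam]; linarith
  have hTR : T < 1 / lam * R := by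
    refine hTlam.trans_lt ?_
    rw [div_eq_inv_mul, one_div]; gcongr
  have hδz : ∀ j, 0 < bdist Ω (z j) := fun j => bdist_pos hΩ ⟨ξ, hξ⟩ (hz j).1
  have hδzt : ∀ j, bdist Ω (z j) ≤ T * ρ ^ j := fun j => (bdist_le_dist hxf).trans (hz j).2.1
  have hκδz : ∀ j, κ * bdist Ω (z j) ≤ T * ρ ^ j := fun j =>
    (mul_le_of_le_one_left (hδz j).le (by linarith)).trans (hδzt j)
  -- The bounds `|z_j - y| ≤ T - Tρ^j` and `κδ(z_j) ≤ Tρ^j` add up to `T < R/λ`, so the chain stays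
  -- within the radius `C₁R`.
  have hregion : ∀ j, ∀ w ∈ Metric.ball (z j) (κ * bdist Ω (z j)),
      dist w ξ < (N + 1 / lam + 1) * R := by
    intro j w hw
    have h1 := Metric.mem_ball.1 hw
    have h2 := dist_triangle4 w (z j) y ξ
    have h3 := (hz j).2.2.2.1
    have h4 := hκδz j
    nlinarith
  have hzR : ∀ j, dist (z j) ξ < (N + 1 / lam + 1) * R := fun j =>
    hregion j _ (Metric.mem_ball_self (mul_pos hκ0 (hδz j)))
  -- The choice of `ρ` makes the step `Tρ^j(1 - ρ) = κ · λTρ^j`, and `λTρ^j ≤ δ(z_j)`.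
  have hstep : ∀ j, dist (z j) (z (j + 1)) ≤ κ * bdist Ω (z j) := by
    intro j
    refine (hz j).2.2.2.2.trans ?_
    have h1 := (hz j).2.2.1
    rw [hρ, sub_sub_cancel]
    rw [hρ] at h1
    nlinarith
  have hlimz : Tendsto z atTop (𝓝[cone Ω a x] x) :=
    tendsto_nhdsWithin_cone hlam ha hρ0.le hρ1 hδz (fun j => ⟨(hz j).1, (hz j).2.1, (hz j).2.2.1⟩)
  have hlim := (hU.tendsto_whitneyMean_of_dist_lt hΩ hξ h hκ0 (by rw [hκ]; linarith) hc1
    (dist_lt_of_mem_carrotSet hlam (by linarith) hξ hyR hx)).comp hlimz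
  refine ⟨fun j => ‖whitneyMean Ω κ u (z j) - whitneyMean Ω κ u (z (j + 1))‖ₑ, ?_, fun j =>
    ⟨z j, ?_, ?_, fun w hw => ⟨⟨hregion j w hw, ?_⟩, ?_⟩, fun w hw => ?_⟩⟩
  · have := edist_le_tsum_of_edist_le_of_tendsto₀ (f := fun j => whitneyMean Ω κ u (z j)) _
      (fun j => le_rfl) hlim
    simpa only [edist_eq_enorm_sub, hz0] using this
  · refine le_trans ?_ (hz j).2.2.1
    rw [mul_comm (ρ ^ j)]
    gcongr
  · refine (hδzt j).trans ?_
    rw [mul_div_assoc, mul_comm]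
    gcongr
  · refine ball_bdist_subset hΩ (hz j).1 (Metric.ball_subset_ball ?_ hw)
    have := hδz j
    nlinarith
  · have hτ : T * ρ ^ j ≤ 1 / lam * (ρ ^ j * bdist Ω y) := by
      calc T * ρ ^ j ≤ bdist Ω y / lam * ρ ^ j := by gcongr
        _ = _ := by ring
    have hwd : dist w x ≤ 2 / lam * (ρ ^ j * bdist Ω y) := by
      have h1 := Metric.mem_ball.1 hw
      have h2 := dist_triangle w (z j) x
      have h3 := hκδz j
      calc dist w x ≤ 2 * (T * ρ ^ j) := by linarith [(hz j).2.1]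
        _ ≤ 2 * (1 / lam * (ρ ^ j * bdist Ω y)) := by gcongr
        _ = _ := by ring
    refine ⟨?_, (bdist_le_dist hxf).trans hwd, hwd⟩
    have h1 := (bdist_bounds_of_dist_le (by linarith) (Metric.mem_ball'.1 hw).le).1
    refine le_trans ?_ h1
    have h2 := (hz j).2.2.1
    have h3 : lam * (bdist Ω y * ρ ^ j) ≤ lam * (T * ρ ^ j) := by gcongr
    linarith
  · exact h.enorm_whitneyMean_sub_le hc hc1 hκ (hδz j) (hstep j) hw
      (closedBall_subset_inter hΩ hξ (by linarith) (hz j).1 (hzR j))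

/-- Tonelli needs a measurable integrand. Replacing `|Du|` by a measurable representative changes no
ball average, so the agreement holds at every point of `D` and not just almost everywhere. -/
theorem exists_measurable_gradAvg {W D : Set (E n)} {Du : E n → E n}
    {c : ℝ} (hc : 0 < c)
    (hDu : AEStronglyMeasurable Du (volume.restrict W)) (hD : ∀ w ∈ D, 0 < bdist Ω w)
    (hDW : ∀ w ∈ D, Metric.ball w (c * bdist Ω w) ⊆ W) :
    ∃ H : E n → ℝ≥0∞, Measurable H ∧ ∀ w ∈ D, H w = gradAvg Ω c Du w := by
  have hm : AEMeasurable (fun q => ‖Du q‖ₑ) (volume.restrict W) := hDu.enorm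
  set g := hm.mk _ with hg
  have hgm : Measurable g := hm.measurable_mk
  have hset : MeasurableSet {p : E n × E n | dist p.2 p.1 < c * bdist Ω p.1} := by
    refine (isOpen_lt (by fun_prop) ?_).measurableSet
    exact continuous_const.mul ((continuous_bdist Ω).comp continuous_fst)
  refine ⟨fun w => (ENNReal.ofReal ((c * bdist Ω w) ^ n) * volume (Metric.ball (0 : E n) 1))⁻¹ *
    ∫⁻ q, {p : E n × E n | dist p.2 p.1 < c * bdist Ω p.1}.indicator (fun p => g p.2) (w, q),
    ?_, fun w hw => ?_⟩
  · refine Measurable.mul ?_ ?_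
    · have := (continuous_bdist Ω).measurable
      fun_prop
    · exact ((hgm.comp measurable_snd).indicator hset).lintegral_prod_right'
  · have hr : 0 < c * bdist Ω w := mul_pos hc (hD w hw)
    rw [gradAvg, lintegral_avgMeasure, Measure.addHaar_ball_of_pos _ _ hr,
      finrank_euclideanSpace_fin]
    have h1 : ∀ q, {p : E n × E n | dist p.2 p.1 < c * bdist Ω p.1}.indicator
        (fun p => g p.2) (w, q) = (Metric.ball w (c * bdist Ω w)).indicator g q := fun q => rfl
    simp only [h1]
    rw [lintegral_indicator measurableSet_ball]
    have h2 : (fun q => ‖Du q‖ₑ) =ᵐ[volume.restrict (Metric.ball w (c * bdist Ω w))] g :=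
      ae_restrict_of_ae_restrict_of_subset (hDW w hw) hm.ae_eq_mk
    exact congrArg _ (lintegral_congr_ae h2.symm)

end ChainEstimate

/-! ### Powers of chain sums. -/

section HardySum

variable {n : ℕ} {Ω : Set (E n)}

theorem rpow_le_of_comparable {k τ x : ℝ} (hk : 0 < k) (hτ : 0 < τ) (h1 : k * τ ≤ x)
    (h2 : x ≤ k⁻¹ * τ) (α : ℝ) : x ^ α ≤ k ^ (-|α|) * τ ^ α := by
  have hx : 0 < x := (mul_pos hk hτ).trans_le h1
  rcases le_total 0 α with hα | hα
  · rw [abs_of_nonneg hα, Real.rpow_neg hk.le, ← Real.inv_rpow hk.le,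
      ← Real.mul_rpow (by positivity) hτ.le]
    exact Real.rpow_le_rpow hx.le h2 hα
  · rw [abs_of_nonpos hα, neg_neg, ← Real.mul_rpow hk.le hτ.le]
    exact Real.rpow_le_rpow_of_nonpos (by positivity) h1 hα

/-- Jensen's inequality for series with geometric weights. -/
theorem tsum_rpow_le_tsum_geometric {q : ℝ} (hq : 0 < q) (hq1 : q < 1) {P : ℝ} (hP : 1 ≤ P)
    (e : ℕ → ℝ≥0∞) :
    (∑' j, e j) ^ P ≤ ∑' j, ENNReal.ofReal (((1 - q) * q ^ j) ^ (-P)) * e j ^ P := by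
  have hw0 : ∀ j : ℕ, 0 < (1 - q) * q ^ j := fun j => mul_pos (by linarith) (by positivity)
  set w : ℕ → ℝ≥0∞ := fun j => ENNReal.ofReal ((1 - q) * q ^ j) with hw
  have hwsum : ∑' j, w j = 1 := by
    rw [hw, ← ENNReal.ofReal_tsum_of_nonneg (fun j => (hw0 j).le)
      ((summable_geometric_of_lt_one hq.le hq1).mul_left _), tsum_mul_left,
      tsum_geometric_of_lt_one hq.le hq1, mul_inv_cancel₀ (by linarith), ENNReal.ofReal_one]
  have hwj : ∀ j, w j ≠ 0 := fun j => by simpa [hw] using hw0 j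
  have he : ∀ j, e j = w j * ((w j)⁻¹ * e j) := fun j => by
    rw [← mul_assoc, ENNReal.mul_inv_cancel (hwj j) ENNReal.ofReal_ne_top, one_mul]
  calc (∑' j, e j) ^ P = (∑' j, w j * ((w j)⁻¹ * e j)) ^ P := by simp only [← he]
    _ ≤ ∑' j, w j * ((w j)⁻¹ * e j) ^ P := tsum_mul_rpow_le hwsum hP
    _ ≤ _ := by
      refine ENNReal.tsum_le_tsum fun j => ?_
      rw [ENNReal.mul_rpow_of_nonneg _ _ (by linarith), ← mul_assoc]
      refine mul_le_mul' ?_ le_rfl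
      have h1 : w j ≤ 1 := hwsum ▸ ENNReal.le_tsum j
      calc w j * (w j)⁻¹ ^ P ≤ 1 * (w j)⁻¹ ^ P := by gcongr
        _ = _ := by
          rw [one_mul, hw, ENNReal.inv_rpow, ← ENNReal.rpow_neg, ENNReal.ofReal_rpow_of_pos (hw0 j)]

/-- The `P`-th power of one link of the chain is bounded by an integral over a Whitney region. -/
theorem exists_rpow_le_setLIntegral (n : ℕ) {lam κ : ℝ} (hlam : 0 < lam) (hκ : 0 < κ)
    (d s : ℝ) {P : ℝ} (hP : 1 ≤ P) :
    ∃ K : ℝ, 0 < K ∧ ∀ (Ω D : Set (E n)) (H : E n → ℝ≥0∞) (e : ℝ≥0∞) (τ : ℝ) (x z : E n),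
      Measurable H → 0 < τ → lam * τ ≤ bdist Ω z → bdist Ω z ≤ τ / lam →
      Metric.ball z (κ * bdist Ω z) ⊆ whitneyRegion Ω D lam τ x →
      (∀ w ∈ Metric.ball z (κ * bdist Ω z),
        e ≤ 240 ^ n * ENNReal.ofReal (bdist Ω z) * H w) →
      e ^ P ≤ ENNReal.ofReal (K * τ ^ (P * s - d)) * ∫⁻ w in whitneyRegion Ω D lam τ x,
        H w ^ P * ENNReal.ofReal (bdist Ω w ^ (d - n - P * (s - 1))) := by
  set α := d - n - P * (s - 1) with hα
  set V := (volume (Metric.ball (0 : E n) 1)).toReal with hV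
  have hV0 : 0 < V := ENNReal.toReal_pos (volume_ball_ne_zero _ one_pos) (volume_ball_ne_top _ _)
  have hVo : ENNReal.ofReal V = volume (Metric.ball (0 : E n) 1) :=
    ENNReal.ofReal_toReal (volume_ball_ne_top _ _)
  have hP0 : 0 ≤ P := by linarith
  refine ⟨(240 ^ n / lam) ^ P * (lam / 2) ^ (-|α|) / ((κ * lam) ^ n * V), by positivity,
    fun Ω D H e τ x z hH hτ hz1 hz2 hball he => ?_⟩
  have hδz : 0 < bdist Ω z := (mul_pos hlam hτ).trans_le hz1
  set b : ℝ := (240 ^ n * (τ / lam)) ^ P * ((lam / 2) ^ (-|α|) * τ ^ (-α)) with hb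
  set m : E n → ℝ≥0∞ := fun w => H w ^ P * ENNReal.ofReal (bdist Ω w ^ α) with hm
  have hpt : ∀ w ∈ Metric.ball z (κ * bdist Ω z), e ^ P ≤ ENNReal.ofReal b * m w := by
    intro w hw
    obtain ⟨-, h1, h2, -⟩ := hball hw
    have hδw : 0 < bdist Ω w := lt_of_lt_of_le (by positivity) h1
    -- On the region `δ(w)` is comparable to `τ`, so the weight can be inserted whatever the sign of
    -- `α`.
    have h3 : τ ^ α ≤ (lam / 2) ^ (-|α|) * bdist Ω w ^ α := by
      refine rpow_le_of_comparable (by positivity) hδw ?_ ?_ α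
      · calc lam / 2 * bdist Ω w ≤ lam / 2 * (2 / lam * τ) := by gcongr
          _ = τ := by field_simp
      · rw [← div_eq_inv_mul, le_div_iff₀ (by positivity)]
        linarith
    have h4 : 1 ≤ ((lam / 2) ^ (-|α|) * τ ^ (-α)) * bdist Ω w ^ α := by
      rw [Real.rpow_neg hτ.le, mul_right_comm, ← div_eq_mul_inv, one_le_div (by positivity)]
      exact h3
    calc e ^ P ≤ (240 ^ n * ENNReal.ofReal (bdist Ω z) * H w) ^ P := by gcongr; exact he w hw
      _ = ENNReal.ofReal ((240 ^ n * bdist Ω z) ^ P) * H w ^ P := by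
        rw [ENNReal.mul_rpow_of_nonneg _ _ hP0, ← ENNReal.ofReal_rpow_of_nonneg (by positivity) hP0,
          ENNReal.ofReal_mul (by positivity), ENNReal.ofReal_pow (by norm_num)]
        norm_num
      _ ≤ ENNReal.ofReal ((240 ^ n * (τ / lam)) ^ P) * H w ^ P * 1 := by
        rw [mul_one]
        gcongr
      _ ≤ ENNReal.ofReal ((240 ^ n * (τ / lam)) ^ P) * H w ^ P *
            ENNReal.ofReal (((lam / 2) ^ (-|α|) * τ ^ (-α)) * bdist Ω w ^ α) := by
        gcongr
        rw [← ENNReal.ofReal_one]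
        exact ENNReal.ofReal_le_ofReal h4
      _ = _ := by
        rw [hb, hm, ENNReal.ofReal_mul (q := bdist Ω w ^ α) (by positivity),
          ENNReal.ofReal_mul (p := (240 ^ n * (τ / lam)) ^ P) (by positivity)]
        ring
  have hmm : Measurable m := by
    have := (continuous_bdist Ω).measurable
    fun_prop
  -- Integrate the pointwise bound over the Whitney ball, whose volume is at least `(κλτ)^n V`.
  have hint : e ^ P * ENNReal.ofReal ((κ * (lam * τ)) ^ n * V) ≤
      ENNReal.ofReal b * ∫⁻ w in whitneyRegion Ω D lam τ x, m w := by
    calc e ^ P * ENNReal.ofReal ((κ * (lam * τ)) ^ n * V)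
        ≤ e ^ P * volume (Metric.ball z (κ * bdist Ω z)) := by
          rw [Measure.addHaar_ball_of_pos _ _ (by positivity), finrank_euclideanSpace_fin,
            ENNReal.ofReal_mul (by positivity), hVo]
          gcongr
      _ = ∫⁻ w in Metric.ball z (κ * bdist Ω z), e ^ P := by
          rw [lintegral_const, Measure.restrict_apply_univ]
      _ ≤ ∫⁻ w in Metric.ball z (κ * bdist Ω z), ENNReal.ofReal b * m w :=
          setLIntegral_mono' measurableSet_ball hpt
      _ = ENNReal.ofReal b * ∫⁻ w in Metric.ball z (κ * bdist Ω z), m w :=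
          lintegral_const_mul _ hmm
      _ ≤ _ := by gcongr
  have ha : 0 < (κ * (lam * τ)) ^ n * V := by positivity
  calc e ^ P = (e ^ P * ENNReal.ofReal ((κ * (lam * τ)) ^ n * V)) /
        ENNReal.ofReal ((κ * (lam * τ)) ^ n * V) := by
        rw [ENNReal.mul_div_cancel_right (by simpa using ha) ENNReal.ofReal_ne_top]
    _ ≤ (ENNReal.ofReal b * ∫⁻ w in whitneyRegion Ω D lam τ x, m w) /
        ENNReal.ofReal ((κ * (lam * τ)) ^ n * V) := by gcongr
    _ = ENNReal.ofReal (b / ((κ * (lam * τ)) ^ n * V)) *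
        ∫⁻ w in whitneyRegion Ω D lam τ x, m w := by
        rw [ENNReal.ofReal_div_of_pos ha, div_eq_mul_inv, div_eq_mul_inv, mul_right_comm]
    _ = _ := by
        congr 2
        -- The powers come from the length of the link, the weight and the volume: `P - α - n = Ps -
        -- d`.
        have h1 : τ ^ (P * s - d) = τ ^ P * τ ^ (-α) / τ ^ n := by
          rw [← Real.rpow_add hτ, ← Real.rpow_natCast, ← Real.rpow_sub hτ, hα]
          congr 1; ring
        have h2 : (240 ^ n * (τ / lam)) ^ P = (240 ^ n / lam) ^ P * τ ^ P := by
          rw [← Real.mul_rpow (by positivity) hτ.le]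
          congr 1; ring
        rw [hb, h1, h2, ← mul_assoc κ, mul_pow]
        field_simp

end HardySum

/-! ### Integration of the chain sums over boundary and interior points. -/

section HardyIntegral

variable {n : ℕ} {Ω : Set (E n)}

/-- The points of `D` in the ball `B(y, L δ(y))` at distance comparable to `r δ(y)` from the
boundary. -/
def shadowRegion (Ω D : Set (E n)) (lam L r : ℝ) (y : E n) : Set (E n) :=
  {w | w ∈ D ∧ lam / 2 * (r * bdist Ω y) ≤ bdist Ω w ∧ bdist Ω w ≤ 2 / lam * (r * bdist Ω y) ∧
    dist w y ≤ L * bdist Ω y}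

theorem measurableSet_whitneyRegion_prod {D : Set (E n)} (hD : MeasurableSet D) (lam τ : ℝ) :
    MeasurableSet {p : E n × E n | p.2 ∈ whitneyRegion Ω D lam τ p.1} := by
  have hδ := (continuous_bdist Ω).measurable
  simp only [whitneyRegion, Set.ofPred_and]
  refine (measurable_snd hD).inter ((measurableSet_le ?_ ?_).inter
    ((measurableSet_le ?_ ?_).inter (measurableSet_le ?_ ?_))) <;> fun_prop

theorem measurableSet_shadowRegion_prod {D : Set (E n)} (hD : MeasurableSet D) (lam L r : ℝ) :
    MeasurableSet {p : E n × E n | p.2 ∈ shadowRegion Ω D lam L r p.1} := by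
  have hδ := (continuous_bdist Ω).measurable
  simp only [shadowRegion, Set.ofPred_and]
  refine (measurable_snd hD).inter ((measurableSet_le ?_ ?_).inter
    ((measurableSet_le ?_ ?_).inter (measurableSet_le ?_ ?_))) <;> fun_prop

theorem measurable_setLIntegral_section {S : Set (E n × E n)} (hS : MeasurableSet S)
    {m : E n → ℝ≥0∞} (hm : Measurable m) :
    Measurable fun x => ∫⁻ w in {w | (x, w) ∈ S}, m w := by
  have h : ∀ x, ∫⁻ w in {w | (x, w) ∈ S}, m w = ∫⁻ w, S.indicator (fun p => m p.2) (x, w) :=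
    fun x => (lintegral_indicator (measurable_prodMk_left hS) m).symm
  simp only [h]
  exact ((hm.comp measurable_snd).indicator hS).lintegral_prod_right'

/-- Tonelli for a relation `S` between two points: it reduces each sum to the measure of the set of
points that see a given `w`. -/
theorem lintegral_setLIntegral_eq {S : Set (E n × E n)} (hS : MeasurableSet S)
    (μ : Measure (E n)) [SFinite μ] {f m : E n → ℝ≥0∞} (hf : Measurable f) (hm : Measurable m) :
    ∫⁻ x, (f x * ∫⁻ w in {w | (x, w) ∈ S}, m w) ∂μ =
      ∫⁻ w, m w * ∫⁻ x in {x | (x, w) ∈ S}, f x ∂μ := by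
  have hmeas : Measurable fun p : E n × E n => S.indicator (fun p => f p.1 * m p.2) p :=
    Measurable.indicator (by fun_prop) hS
  have h1 : ∀ x, (f x * ∫⁻ w in {w | (x, w) ∈ S}, m w) =
      ∫⁻ w, S.indicator (fun p => f p.1 * m p.2) (x, w) := fun x => by
    rw [← lintegral_const_mul _ hm]
    exact (lintegral_indicator (measurable_prodMk_left hS) _).symm
  have h2 : ∀ w, (m w * ∫⁻ x in {x | (x, w) ∈ S}, f x ∂μ) =
      ∫⁻ x, S.indicator (fun p => f p.1 * m p.2) (x, w) ∂μ := fun w => by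
    have hSw : MeasurableSet {x | (x, w) ∈ S} := measurable_prodMk_right hS
    rw [← lintegral_const_mul _ hf, ← lintegral_indicator hSw]
    simp only [mul_comm (m w)]
    rfl
  simp only [h1, h2]
  exact lintegral_lintegral_swap hmeas.aemeasurable

/-- Integration over a set of boundary points of the `P`-th powers of the sums over chains. -/
theorem lintegral_rpow_le_tsum_shadow {d lam N s P ρ K K₀ : ℝ} (hlam : 0 < lam)
    (hρ : 0 < ρ) (hρ1 : ρ < 1) (hs : 0 < s) (hP : 1 ≤ P) (hK : 0 < K) (hK₀ : 0 < K₀)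
    (hσ : ∀ (z : E n) (r : ℝ), 0 < r →
      μH[d] (Metric.ball z r ∩ frontier Ω) ≤ ENNReal.ofReal (K₀ * r ^ d))
    {D : Set (E n)} (hD : MeasurableSet D) {m : E n → ℝ≥0∞} (hm : Measurable m) {y : E n}
    (hN : 0 < N) (hδ : 0 < bdist Ω y) {F : Set (E n)}
    (hF : F ⊆ Metric.ball y (N * bdist Ω y) ∩ frontier Ω) {f : E n → ℝ≥0∞}
    (hf : ∀ᵐ x ∂(μH[d].restrict F), ∃ e : ℕ → ℝ≥0∞, f x ≤ ∑' j, e j ∧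
      ∀ j, e j ^ P ≤ ENNReal.ofReal (K * (ρ ^ j * bdist Ω y) ^ (P * s - d)) *
        ∫⁻ w in whitneyRegion Ω D lam (ρ ^ j * bdist Ω y) x, m w) :
    ∫⁻ x in F, f x ^ P ∂μH[d] ≤
      ENNReal.ofReal ((1 - ρ ^ (s / 2)) ^ (-P) * K * K₀ * (4 / lam) ^ d * bdist Ω y ^ (P * s)) *
        ∑' j : ℕ, ENNReal.ofReal ((ρ ^ (P * s / 2)) ^ j) *
          ∫⁻ w in shadowRegion Ω D lam (2 / lam + N) (ρ ^ j) y, m w := by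
  set δ := bdist Ω y with hδdef
  -- Jensen weights `q^j` cost `ρ^{-Psj/2}`, half of the decay `ρ^{Psj}`; the other half is kept for
  -- summation.
  set q := ρ ^ (s / 2) with hq
  have hq0 : 0 < q := by positivity
  have hq1 : q < 1 := Real.rpow_lt_one hρ.le hρ1 (by positivity)
  have h1q : 0 < 1 - q := by linarith
  -- Restriction to a boundary ball gives a finite measure, so Tonelli applies; it also makes
  -- measurability of `F` unnecessary.
  set μ : Measure (E n) := μH[d].restrict (Metric.ball y (N * δ) ∩ frontier Ω) with hμ
  have hfin : IsFiniteMeasure μ := ⟨by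
    rw [hμ, Measure.restrict_apply_univ]
    exact (hσ y (N * δ) (by positivity)).trans_lt ENNReal.ofReal_lt_top⟩
  set c : ℕ → ℝ≥0∞ := fun j =>
    ENNReal.ofReal (((1 - q) * q ^ j) ^ (-P) * (K * (ρ ^ j * δ) ^ (P * s - d))) with hc
  have hSm : ∀ j : ℕ, MeasurableSet {p : E n × E n | p.2 ∈ whitneyRegion Ω D lam (ρ ^ j * δ) p.1} :=
    fun j => measurableSet_whitneyRegion_prod hD lam _
  have hTm : ∀ j : ℕ, MeasurableSet (shadowRegion Ω D lam (2 / lam + N) (ρ ^ j) y) := fun j =>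
    measurable_prodMk_left (measurableSet_shadowRegion_prod hD lam (2 / lam + N) (ρ ^ j))
  have hterm : ∀ j : ℕ, ∫⁻ x, (c j * ∫⁻ w in whitneyRegion Ω D lam (ρ ^ j * δ) x, m w) ∂μ ≤
      c j * ENNReal.ofReal (K₀ * (4 / lam * (ρ ^ j * δ)) ^ d) *
        ∫⁻ w in shadowRegion Ω D lam (2 / lam + N) (ρ ^ j) y, m w := by
    intro j
    have hτ : 0 < ρ ^ j * δ := by positivity
    have hρj : ρ ^ j ≤ 1 := pow_le_one₀ hρ.le hρ1.le
    refine (lintegral_setLIntegral_eq (hSm j) μ measurable_const hm).trans_le ?_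
    rw [← lintegral_indicator (hTm j), ← lintegral_const_mul _ (hm.indicator (hTm j))]
    refine lintegral_mono fun w => ?_
    have hSw : MeasurableSet
        {x | (x, w) ∈ {p : E n × E n | p.2 ∈ whitneyRegion Ω D lam (ρ ^ j * δ) p.1}} :=
      measurable_prodMk_right (hSm j)
    rw [lintegral_const, Measure.restrict_apply_univ, hμ, Measure.restrict_apply hSw]
    rcases ({x | (x, w) ∈ {p : E n × E n | p.2 ∈ whitneyRegion Ω D lam (ρ ^ j * δ) p.1}} ∩
      (Metric.ball y (N * δ) ∩ frontier Ω)).eq_empty_or_nonempty with hem | ⟨x, hxw, hxy, -⟩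
    · rw [hem, measure_empty]
      simp
    · have hxw' : w ∈ whitneyRegion Ω D lam (ρ ^ j * δ) x := hxw
      have hwS : w ∈ shadowRegion Ω D lam (2 / lam + N) (ρ ^ j) y := by
        refine ⟨hxw'.1, hxw'.2.1, hxw'.2.2.1, ?_⟩
        have h1 := dist_triangle w x y
        have h2 := Metric.mem_ball.1 hxy
        have h3 := hxw'.2.2.2
        have h4 : 2 / lam * (ρ ^ j * δ) ≤ 2 / lam * (1 * δ) := by gcongr
        rw [← hδdef]
        linarith
      rw [Set.indicator_of_mem hwS, mul_comm]
      gcongr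
      -- The boundary points that see `w` lie in a ball of radius `4τ/λ`. Its measure is at most a
      -- constant times `τ^d`, which cancels the `-d` in `τ^{Ps-d}`.
      refine (measure_mono ?_).trans (hσ w (4 / lam * (ρ ^ j * δ)) (by positivity))
      refine inter_subset_inter (fun x' hx' => ?_) inter_subset_right
      have hx'' : w ∈ whitneyRegion Ω D lam (ρ ^ j * δ) x' := hx'
      rw [Metric.mem_ball']
      refine hx''.2.2.2.trans_lt ?_
      gcongr
      norm_num
  calc ∫⁻ x in F, f x ^ P ∂μH[d]
      ≤ ∫⁻ x in F, (∑' j, c j * ∫⁻ w in whitneyRegion Ω D lam (ρ ^ j * δ) x, m w) ∂μH[d] := by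
        refine lintegral_mono_ae ?_
        filter_upwards [hf] with x ⟨e, he, hej⟩
        refine (ENNReal.rpow_le_rpow he (by linarith)).trans
          ((tsum_rpow_le_tsum_geometric hq0 hq1 hP e).trans (ENNReal.tsum_le_tsum fun j => ?_))
        change _ ≤ ENNReal.ofReal (((1 - q) * q ^ j) ^ (-P) *
          (K * (ρ ^ j * δ) ^ (P * s - d))) * _
        rw [ENNReal.ofReal_mul (by positivity), mul_assoc]
        gcongr
        exact hej j
    _ ≤ ∫⁻ x, (∑' j, c j * ∫⁻ w in whitneyRegion Ω D lam (ρ ^ j * δ) x, m w) ∂μ :=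
        lintegral_mono' (Measure.restrict_mono_set _ hF) le_rfl
    _ = ∑' j, ∫⁻ x, (c j * ∫⁻ w in whitneyRegion Ω D lam (ρ ^ j * δ) x, m w) ∂μ :=
        lintegral_tsum fun j =>
          ((measurable_setLIntegral_section (hSm j) hm).const_mul _).aemeasurable
    _ ≤ ∑' j, c j * ENNReal.ofReal (K₀ * (4 / lam * (ρ ^ j * δ)) ^ d) *
        ∫⁻ w in shadowRegion Ω D lam (2 / lam + N) (ρ ^ j) y, m w := ENNReal.tsum_le_tsum hterm
    _ = _ := by
        rw [← ENNReal.tsum_mul_left]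
        refine tsum_congr fun j => ?_
        rw [← mul_assoc (ENNReal.ofReal _) (ENNReal.ofReal _)]
        congr 1
        rw [hc, ← ENNReal.ofReal_mul (by positivity), ← ENNReal.ofReal_mul (by positivity)]
        congr 1
        have ht : 0 < ρ ^ j := by positivity
        have e1 : q ^ j = (ρ ^ j) ^ (s / 2) := by rw [hq, Real.rpow_pow_comm hρ.le]
        have e2 : (ρ ^ (P * s / 2)) ^ j = (ρ ^ j) ^ (P * s / 2) := by
          rw [Real.rpow_pow_comm hρ.le]
        rw [e1, e2, Real.mul_rpow h1q.le (by positivity), ← Real.rpow_mul ht.le,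
          Real.mul_rpow (by positivity) (by positivity) (x := 4 / lam) (y := ρ ^ j * δ)]
        have e3 : (ρ ^ j * δ) ^ (P * s - d) * (ρ ^ j * δ) ^ d =
            (ρ ^ j) ^ (P * s) * δ ^ (P * s) := by
          rw [← Real.rpow_add (by positivity), sub_add_cancel, Real.mul_rpow ht.le hδ.le]
        have e4 : (ρ ^ j) ^ (s / 2 * -P) * (ρ ^ j) ^ (P * s) = (ρ ^ j) ^ (P * s / 2) := by
          rw [← Real.rpow_add ht]; congr 1; ring
        rw [← e4]
        linear_combination (1 - q) ^ (-P) * (ρ ^ j) ^ (s / 2 * -P) * K * K₀ * (4 / lam) ^ d * e3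

/-- Integration of sums over shadow regions. -/
theorem setLIntegral_tsum_shadow_le {lam L ρ θ K : ℝ} (hlam : 0 < lam) (hL : 0 < L)
    (hρ : 0 < ρ) (hθ : 0 < θ) (hθ1 : θ < 1) (hK : 0 < K)
    {D : Set (E n)} (hD : MeasurableSet D) (hDδ : ∀ w ∈ D, 0 < bdist Ω w) {m : E n → ℝ≥0∞}
    (hm : Measurable m) {Ψ : Set (E n)} (hΨ : NullMeasurableSet Ψ volume) {g : E n → ℝ≥0∞}
    (hg : ∀ y ∈ Ψ, g y ≤ ENNReal.ofReal (K * (bdist Ω y ^ n)⁻¹) *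
      ∑' j : ℕ, ENNReal.ofReal (θ ^ j) * ∫⁻ w in shadowRegion Ω D lam L (ρ ^ j) y, m w) :
    ∫⁻ y in Ψ, g y ≤ ENNReal.ofReal (K * (8 * L / lam ^ 2) ^ n *
      (volume (Metric.ball (0 : E n) 1)).toReal * (1 - θ)⁻¹) * ∫⁻ w in D, m w := by
  set V := (volume (Metric.ball (0 : E n) 1)).toReal with hV
  have hVo : ENNReal.ofReal V = volume (Metric.ball (0 : E n) 1) :=
    ENNReal.ofReal_toReal (volume_ball_ne_top _ _)
  set f : E n → ℝ≥0∞ := fun y => ENNReal.ofReal (K * (bdist Ω y ^ n)⁻¹) with hf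
  have hfm : Measurable f := by
    have := (continuous_bdist Ω).measurable
    fun_prop
  have hSm : ∀ j : ℕ, MeasurableSet {p : E n × E n | p.2 ∈ shadowRegion Ω D lam L (ρ ^ j) p.1} :=
    fun j => measurableSet_shadowRegion_prod hD lam L _
  have hterm : ∀ j : ℕ, ∫⁻ y, f y * ∫⁻ w in shadowRegion Ω D lam L (ρ ^ j) y, m w ≤
      ENNReal.ofReal (K * (8 * L / lam ^ 2) ^ n * V) * ∫⁻ w in D, m w := by
    intro j
    refine (lintegral_setLIntegral_eq (hSm j) volume hfm hm).trans_le ?_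
    rw [← lintegral_indicator hD, ← lintegral_const_mul _ (hm.indicator hD)]
    refine lintegral_mono fun w => ?_
    by_cases hw : w ∈ D
    · rw [Set.indicator_of_mem hw, mul_comm]
      refine mul_le_mul' ?_ le_rfl
      -- For fixed `w` and `j`, every `y` that sees `w` has `δ(y)` comparable to `t` and lies in a
      -- ball about `w` of radius comparable to `t`. The weight `δ(y)^{-n}` cancels the volume,
      -- uniformly in `j`.
      set t := bdist Ω w / ρ ^ j with ht
      have hδw := hDδ w hw
      have ht0 : 0 < t := by positivity
      have hw' : bdist Ω w = t * ρ ^ j := by rw [ht]; field_simp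
      have hbound : ∀ y, w ∈ shadowRegion Ω D lam L (ρ ^ j) y →
          lam / 2 * t ≤ bdist Ω y ∧ bdist Ω y ≤ 2 / lam * t ∧ dist y w ≤ L * (2 / lam * t) := by
        rintro y ⟨-, h1, h2, h3⟩
        have h5 : bdist Ω y ≤ 2 / lam * t := by
          rw [ht, ← mul_div_assoc, le_div_iff₀ (by positivity)]
          calc bdist Ω y * ρ ^ j = 2 / lam * (lam / 2 * (ρ ^ j * bdist Ω y)) := by field_simp
            _ ≤ 2 / lam * bdist Ω w := by gcongr
        refine ⟨?_, h5, ?_⟩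
        · rw [ht, ← mul_div_assoc, div_le_iff₀ (by positivity)]
          calc lam / 2 * bdist Ω w ≤ lam / 2 * (2 / lam * (ρ ^ j * bdist Ω y)) := by gcongr
            _ = _ := by field_simp
        · rw [dist_comm]
          exact h3.trans (by gcongr)
      calc ∫⁻ y in {y | (y, w) ∈ {p : E n × E n | p.2 ∈ shadowRegion Ω D lam L (ρ ^ j) p.1}}, f y
          ≤ ∫⁻ y in {y | (y, w) ∈ {p : E n × E n | p.2 ∈ shadowRegion Ω D lam L (ρ ^ j) p.1}},
              ENNReal.ofReal (K * ((lam / 2 * t) ^ n)⁻¹) := by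
            refine setLIntegral_mono' (measurable_prodMk_right (hSm j)) fun y hy => ?_
            have := (hbound y hy).1
            refine ENNReal.ofReal_le_ofReal ?_
            gcongr
        _ ≤ ENNReal.ofReal (K * ((lam / 2 * t) ^ n)⁻¹) *
              volume (Metric.ball w (4 * L / lam * t)) := by
            rw [lintegral_const, Measure.restrict_apply_univ]
            gcongr
            intro y hy
            refine (hbound y hy).2.2.trans_lt ?_
            calc L * (2 / lam * t) = 2 * L / lam * t := by ring
              _ < 4 * L / lam * t := by gcongr; norm_num
        _ = _ := by
            rw [Measure.addHaar_ball_of_pos _ _ (by positivity), finrank_euclideanSpace_fin, ← hVo,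
              ← ENNReal.ofReal_mul (by positivity), ← ENNReal.ofReal_mul (by positivity)]
            congr 1
            have : (8 * L / lam ^ 2) ^ n = ((lam / 2 * t) ^ n)⁻¹ * (4 * L / lam * t) ^ n := by
              rw [← inv_pow, ← mul_pow]
              congr 1
              field_simp
              norm_num
            rw [this]
            ring
    · rw [Set.indicator_of_notMem hw, mul_zero]
      have : {y | (y, w) ∈ {p : E n × E n | p.2 ∈ shadowRegion Ω D lam L (ρ ^ j) p.1}} = ∅ :=
        eq_empty_of_forall_notMem fun y hy => hw hy.1
      rw [this]
      simp
  have hmeasj : ∀ j : ℕ, Measurable fun y =>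
      f y * ∫⁻ w in shadowRegion Ω D lam L (ρ ^ j) y, m w := fun j =>
    hfm.mul (measurable_setLIntegral_section (hSm j) hm)
  calc ∫⁻ y in Ψ, g y ≤ ∫⁻ y in Ψ, f y *
        ∑' j : ℕ, ENNReal.ofReal (θ ^ j) * ∫⁻ w in shadowRegion Ω D lam L (ρ ^ j) y, m w := by
        refine lintegral_mono_ae ?_
        filter_upwards [ae_restrict_mem₀ hΨ] with y hy using hg y hy
    _ ≤ ∫⁻ y, f y *
        ∑' j : ℕ, ENNReal.ofReal (θ ^ j) * ∫⁻ w in shadowRegion Ω D lam L (ρ ^ j) y, m w :=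
        setLIntegral_le_lintegral _ _
    _ = ∫⁻ y, ∑' j : ℕ, ENNReal.ofReal (θ ^ j) *
          (f y * ∫⁻ w in shadowRegion Ω D lam L (ρ ^ j) y, m w) := by
        refine lintegral_congr fun y => ?_
        rw [← ENNReal.tsum_mul_left]
        refine tsum_congr fun j => ?_
        ring
    _ = ∑' j : ℕ, ENNReal.ofReal (θ ^ j) *
          ∫⁻ y, f y * ∫⁻ w in shadowRegion Ω D lam L (ρ ^ j) y, m w := by
        rw [lintegral_tsum fun j => ((hmeasj j).const_mul _).aemeasurable]
        refine tsum_congr fun j => ?_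
        rw [lintegral_const_mul _ (hmeasj j)]
    _ ≤ ∑' j : ℕ, ENNReal.ofReal (θ ^ j) *
          (ENNReal.ofReal (K * (8 * L / lam ^ 2) ^ n * V) * ∫⁻ w in D, m w) := by
        gcongr with j
        exact hterm j
    _ = _ := by
        rw [ENNReal.tsum_mul_right, ← ENNReal.ofReal_tsum_of_nonneg (fun j => by positivity)
          (summable_geometric_of_lt_one hθ.le hθ1), tsum_geometric_of_lt_one hθ.le hθ1,
          ← mul_assoc, ← ENNReal.ofReal_mul (inv_nonneg.2 (by linarith))]
        congr 2
        ring

end HardyIntegral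

/-! ### Measurability of the trace. -/

section Trace

variable {n : ℕ} {Ω : Set (E n)}

/-- Nontangential limits are measurable functions of the boundary point. -/
theorem exists_measurable_eq_nontangential_limit (hΩ : IsOpen Ω) (a : ℝ) (v : E n → ℝ) :
    ∃ g : E n → ℝ, Measurable g ∧ ∀ x U, x ∈ closure (cone Ω a x) →
      Tendsto v (𝓝[cone Ω a x] x) (𝓝 U) → g x = U := by
  classical
  have hδ := continuous_bdist Ω
  set z := TopologicalSpace.denseSeq (E n) with hz
  -- An upper limit along the points of a countable dense set that lie in the cone. For fixed `i`,
  -- `x` enters only through distances to `z i`, so `v` need not be measurable. Since the cone is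
  -- open, dense points of it occur near `x`.
  set G : E n → EReal := fun x => ⨅ k : ℕ, ⨆ i : ℕ,
    if z i ∈ cone Ω a x ∧ dist (z i) x < 1 / ((k : ℝ) + 1) then ((v (z i) : ℝ) : EReal) else ⊥
    with hG
  have hGm : Measurable G := by
    refine Measurable.iInf fun k => Measurable.iSup fun i => Measurable.ite ?_
      measurable_const measurable_const
    have h1 : MeasurableSet {x : E n | dist (z i) x < (1 + a) * bdist Ω (z i)} :=
      measurableSet_lt (by fun_prop) measurable_const
    have h2 : MeasurableSet {x : E n | dist (z i) x < 1 / ((k : ℝ) + 1)} :=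
      measurableSet_lt (by fun_prop) measurable_const
    by_cases hzi : z i ∈ Ω
    · convert h1.inter h2 using 1
      ext x
      simp [cone, hzi]
    · convert MeasurableSet.empty using 1
      ext x
      simp [cone, hzi]
  refine ⟨fun x => (G x).toReal, hGm.ereal_toReal, fun x U hx hU => ?_⟩
  have hcone : IsOpen (cone Ω a x) := by
    have : cone Ω a x = Ω ∩ {y | dist y x < (1 + a) * bdist Ω y} := rfl
    rw [this]
    exact hΩ.inter (isOpen_lt (by fun_prop) (by fun_prop))
  have hU' : Tendsto (fun y => ((v y : ℝ) : EReal)) (𝓝[cone Ω a x] x) (𝓝 (U : EReal)) :=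
    (continuous_coe_real_ereal.tendsto U).comp hU
  suffices h : G x = (U : EReal) by simp only [h, EReal.toReal_coe]
  refine le_antisymm (le_of_forall_gt_imp_ge_of_dense fun b hb => ?_)
    (le_of_forall_lt_imp_le_of_dense fun b hb => ?_)
  · have hev := hU'.eventually (gt_mem_nhds hb)
    obtain ⟨ε, hε, hball⟩ := Metric.mem_nhdsWithin_iff.1 hev
    obtain ⟨k, hk⟩ := exists_nat_one_div_lt hε
    refine (iInf_le _ k).trans (iSup_le fun i => ?_)
    split_ifs with hi
    · have h3 : v (z i) < b := hball ⟨hi.2.trans hk, hi.1⟩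
      exact h3.le
    · exact bot_le
  · have hev := hU'.eventually (lt_mem_nhds hb)
    refine le_iInf fun k => ?_
    have hev2 : ∀ᶠ y in 𝓝[cone Ω a x] x, dist y x < 1 / ((k : ℝ) + 1) :=
      nhdsWithin_le_nhds (Metric.ball_mem_nhds x (by positivity))
    obtain ⟨V, hVs, hV, hxV⟩ :=
      eventually_nhds_iff.1 (eventually_nhdsWithin_iff.1 (hev.and hev2))
    obtain ⟨w, hw⟩ := mem_closure_iff.1 hx V hV hxV
    obtain ⟨i, hi⟩ := (TopologicalSpace.denseRange_denseSeq (E n)).exists_mem_open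
      (hV.inter hcone) ⟨w, hw⟩
    obtain ⟨h1, h2⟩ := hVs _ hi.1 hi.2
    refine le_trans ?_ (le_iSup _ i)
    rw [if_pos ⟨hi.2, h2⟩]
    exact h1.le

theorem hasTrace_trace {a c : ℝ} {u : E n → ℝ} {x : E n} (h : ∃ U, HasTrace Ω a c u x U) :
    HasTrace Ω a c u x (trace Ω a c u x) := by
  rw [trace, dif_pos h]
  exact h.choose_spec

end Trace

/-! ### From interior means to averages of the trace. -/

section TraceEstimate

variable {n : ℕ} {Ω : Set (E n)}

/-- A ball of radius `R` centred at a point of an Ahlfors regular boundary. -/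
structure IsBoundaryBall (Ω : Set (E n)) (d A : ℝ) (ξ : E n) (R : ℝ) : Prop where
  isOpen : IsOpen Ω
  regular : IsAhlforsRegular d A (frontier Ω)
  mem : ξ ∈ frontier Ω
  pos : 0 < R
  lt_ediam : ENNReal.ofReal R < 2 * Metric.ediam (frontier Ω)

/-- A large set `F` of boundary points that are joined to `y` by carrot paths, and at almost all of
which the trace of `u` exists. -/
structure IsTraceSet (Ω : Set (E n)) (d lam N ϑ a c : ℝ) (u : E n → ℝ) (y : E n)
    (F : Set (E n)) : Prop where
  nullMeasurableSet : NullMeasurableSet F μH[d]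
  subset : F ⊆ carrotSet Ω lam N y
  le_measure : ENNReal.ofReal ϑ *
    μH[d] (Metric.ball y (N * bdist Ω y) ∩ frontier Ω) ≤ μH[d] F
  ae_hasTrace : ∀ᵐ x ∂μH[d], x ∈ F → ∃ U, HasTrace Ω a c u x U

/-- The normalized Hausdorff measure on `F`. -/
noncomputable def surfaceAvg (d : ℝ) (F : Set (E n)) : Measure (E n) :=
  (μH[d] F)⁻¹ • μH[d].restrict F

variable {d A lam N ϑ a c κ ρ s R : ℝ} {ξ y : E n} {u : E n → ℝ} {Du : E n → E n} {F : Set (E n)}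

theorem IsBoundaryBall.ediam_pos (hB : IsBoundaryBall Ω d A ξ R) :
    0 < Metric.ediam (frontier Ω) := by
  refine pos_of_ne_zero fun h => ?_
  have := hB.lt_ediam
  simp [h] at this

theorem IsBoundaryBall.bdist_pos (hB : IsBoundaryBall Ω d A ξ R) (hy : y ∈ Ω) : 0 < bdist Ω y :=
  BoundaryPoincare.bdist_pos hB.isOpen ⟨ξ, hB.mem⟩ hy

theorem IsTraceSet.ofReal_le_measure (hF : IsTraceSet Ω d lam N ϑ a c u y F)
    (hB : IsBoundaryBall Ω d A ξ R) (hN : 2 ≤ N) (hϑ : 0 < ϑ) (hy : y ∈ Ω) (hyR : dist y ξ < R) :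
    ENNReal.ofReal (ϑ * ((bdist Ω y / 2) ^ d / A)) ≤ μH[d] F := by
  refine le_trans ?_ hF.le_measure
  rw [ENNReal.ofReal_mul hϑ.le]
  gcongr
  refine hB.regular.le_measure_ball hN (hB.bdist_pos hy) ?_
  exact (ENNReal.ofReal_le_ofReal ((bdist_le_dist hB.mem).trans hyR.le)).trans hB.lt_ediam.le

theorem IsTraceSet.measure_ne_zero (hF : IsTraceSet Ω d lam N ϑ a c u y F)
    (hB : IsBoundaryBall Ω d A ξ R) (hN : 2 ≤ N) (hϑ : 0 < ϑ) (hA : 0 < A) (hy : y ∈ Ω)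
    (hyR : dist y ξ < R) : μH[d] F ≠ 0 := by
  refine (lt_of_lt_of_le ?_ (hF.ofReal_le_measure hB hN hϑ hy hyR)).ne'
  have := hB.bdist_pos hy
  exact ENNReal.ofReal_pos.2 (by positivity)

theorem IsTraceSet.measure_ne_top (hF : IsTraceSet Ω d lam N ϑ a c u y F)
    (hB : IsBoundaryBall Ω d A ξ R) (hN : 2 ≤ N) (hd : 0 < d) (hA : 0 < A) (hy : y ∈ Ω) :
    μH[d] F ≠ ⊤ := by
  obtain ⟨K, -, hK⟩ := exists_measure_ball_le n hd hA
  have hδ := hB.bdist_pos hy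
  refine ((measure_mono fun x hx => (hF.subset hx).1).trans_lt ((hK _ hB.regular hB.ediam_pos y
    (N * bdist Ω y) (by positivity)).trans_lt ENNReal.ofReal_lt_top)).ne

theorem IsTraceSet.isProbabilityMeasure (hF : IsTraceSet Ω d lam N ϑ a c u y F)
    (hB : IsBoundaryBall Ω d A ξ R) (hN : 2 ≤ N) (hϑ : 0 < ϑ) (hd : 0 < d) (hA : 0 < A)
    (hy : y ∈ Ω) (hyR : dist y ξ < R) : IsProbabilityMeasure (surfaceAvg d F) := ⟨by
  rw [surfaceAvg, Measure.smul_apply, Measure.restrict_apply_univ, smul_eq_mul,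
    ENNReal.inv_mul_cancel (hF.measure_ne_zero hB hN hϑ hA hy hyR)
      (hF.measure_ne_top hB hN hd hA hy)]⟩

theorem IsTraceSet.ae_restrict_hasTrace (hF : IsTraceSet Ω d lam N ϑ a c u y F) :
    ∀ᵐ x ∂(μH[d].restrict F), x ∈ F ∧ HasTrace Ω a c u x (trace Ω a c u x) := by
  filter_upwards [ae_restrict_mem₀ hF.nullMeasurableSet, ae_restrict_of_ae hF.ae_hasTrace]
    with x hx htr using ⟨hx, hasTrace_trace (htr hx)⟩

/-- Almost everywhere on `F` the trace is a nontangential limit of Whitney means, and such limits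
are measurable. -/
theorem IsTraceSet.aemeasurable_trace (hF : IsTraceSet Ω d lam N ϑ a c u y F)
    (hB : IsBoundaryBall Ω d A ξ R) (hlam : 0 < lam) (hN : 2 ≤ N) (hc : 0 < c) (hc1 : c < 1)
    (h : HasWeakGradient (Ω ∩ Metric.ball ξ (2 * ((N + 1 / lam + 1) * R))) u Du)
    (hyR : dist y ξ < R) : AEMeasurable (trace Ω a c u) (μH[d].restrict F) := by
  obtain ⟨g, hg, hgU⟩ :=
    exists_measurable_eq_nontangential_limit hB.isOpen a (whitneyMean Ω c u)
  refine ⟨g, hg, ?_⟩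
  filter_upwards [hF.ae_restrict_hasTrace] with x ⟨hx, htr⟩
  exact (hgU x _ htr.1 (htr.tendsto_whitneyMean_of_dist_lt hB.isOpen hB.mem h hc le_rfl hc1
    (dist_lt_of_mem_carrotSet hlam (by linarith) hB.mem hyR (hF.subset hx)))).symm

/-- `F` has finite measure, so a finite mean distance to one constant gives integrability. -/
theorem IsTraceSet.integrableOn_trace (hF : IsTraceSet Ω d lam N ϑ a c u y F)
    (hB : IsBoundaryBall Ω d A ξ R) (hlam : 0 < lam) (hN : 2 ≤ N) (hd : 0 < d) (hA : 0 < A)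
    (hc : 0 < c) (hc1 : c < 1)
    (h : HasWeakGradient (Ω ∩ Metric.ball ξ (2 * ((N + 1 / lam + 1) * R))) u Du)
    (hy : y ∈ Ω) (hyR : dist y ξ < R) {b : ℝ}
    (hfin : ∫⁻ x, ‖b - trace Ω a c u x‖ₑ ∂(surfaceAvg d F) < ⊤) :
    IntegrableOn (trace Ω a c u) F μH[d] := by
  have hm := (hF.aemeasurable_trace hB hlam hN hc hc1 h hyR).aestronglyMeasurable
  have htop := hF.measure_ne_top hB hN hd hA hy
  have hfm : IsFiniteMeasure (μH[d].restrict F) := ⟨by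
    rw [Measure.restrict_apply_univ]; exact htop.lt_top⟩
  have h1 : Integrable (fun x => b - trace Ω a c u x) (μH[d].restrict F) := by
    refine ⟨aestronglyMeasurable_const.sub hm, ?_⟩
    rw [surfaceAvg, lintegral_smul_measure, smul_eq_mul] at hfin
    rw [hasFiniteIntegral_iff_enorm]
    exact ENNReal.lt_top_of_mul_ne_top_right hfin.ne (ENNReal.inv_ne_zero.2 htop)
  have h2 := (integrable_const b).sub h1
  refine h2.congr (Eventually.of_forall fun x => ?_)
  simp

theorem IsTraceSet.enorm_sub_average_trace_le (hF : IsTraceSet Ω d lam N ϑ a c u y F)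
    (hB : IsBoundaryBall Ω d A ξ R) (hN : 2 ≤ N) (hϑ : 0 < ϑ) (hd : 0 < d) (hA : 0 < A)
    (hy : y ∈ Ω) (hyR : dist y ξ < R) (hint : IntegrableOn (trace Ω a c u) F μH[d]) (b : ℝ) :
    ‖b - ⨍ x in F, trace Ω a c u x ∂μH[d]‖ₑ ≤
      ∫⁻ x, ‖b - trace Ω a c u x‖ₑ ∂(surfaceAvg d F) := by
  have := hF.isProbabilityMeasure hB hN hϑ hd hA hy hyR
  have havg : ⨍ x in F, trace Ω a c u x ∂μH[d] = ∫ x, trace Ω a c u x ∂(surfaceAvg d F) := by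
    rw [average_eq', Measure.restrict_apply_univ, surfaceAvg]
  rw [havg]
  have hint' : Integrable (trace Ω a c u) (surfaceAvg d F) := hint.smul_measure
    (ENNReal.inv_ne_top.2 (hF.measure_ne_zero hB hN hϑ hA hy hyR))
  refine (enorm_sub_integral_le _ hint' b).trans (le_of_eq ?_)
  exact lintegral_congr fun x => by rw [← enorm_neg, neg_sub]

theorem IsTraceSet.ae_exists_chain (hF : IsTraceSet Ω d lam N ϑ a c u y F)
    (hB : IsBoundaryBall Ω d A ξ R) (hlam : 0 < lam)
    (hlam1 : lam ≤ 1) (hN : 2 ≤ N) (ha : (1 - lam) / lam < a) (hc : 0 < c) (hc1 : c < 1)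
    (hκ : κ = c / 10) (hρ : ρ = 1 - lam * κ)
    (h : HasWeakGradient (Ω ∩ Metric.ball ξ (2 * ((N + 1 / lam + 1) * R))) u Du)
    (hy : y ∈ Ω) (hyR : dist y ξ < R) {H : E n → ℝ≥0∞}
    (hH : ∀ w ∈ Metric.ball ξ ((N + 1 / lam + 1) * R) ∩ Ω, H w = gradAvg Ω c Du w) :
    ∀ᵐ x ∂(μH[d].restrict F), ∃ e : ℕ → ℝ≥0∞,
      ‖whitneyMean Ω κ u y - trace Ω a c u x‖ₑ ≤ ∑' j, e j ∧ ∀ j, ∃ z : E n,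
      lam * (ρ ^ j * bdist Ω y) ≤ bdist Ω z ∧ bdist Ω z ≤ ρ ^ j * bdist Ω y / lam ∧
      Metric.ball z (κ * bdist Ω z) ⊆ whitneyRegion Ω
        (Metric.ball ξ ((N + 1 / lam + 1) * R) ∩ Ω) lam (ρ ^ j * bdist Ω y) x ∧
      ∀ w ∈ Metric.ball z (κ * bdist Ω z),
        e j ≤ 240 ^ n * ENNReal.ofReal (bdist Ω z) * H w := by
  filter_upwards [hF.ae_restrict_hasTrace] with x ⟨hx, htr⟩
  obtain ⟨e, he, hz⟩ := exists_chain_estimate hB.isOpen hlam hlam1 hN ha hc hc1 hκ hρ hB.mem h hy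
    hyR (hF.subset hx) htr
  refine ⟨e, he, fun j => ?_⟩
  obtain ⟨z, h1, h2, h3, h4⟩ := hz j
  exact ⟨z, h1, h2, h3, fun w hw => by rw [hH w (h3 hw).1]; exact h4 w hw⟩

/-- The estimate of the distance from the interior mean of `u` to its boundary values, for finite
exponents. -/
theorem exists_trace_estimate_rpow (n : ℕ) {P : ℝ} (hd : 0 < d) (hA : 0 < A) (hlam : 0 < lam)
    (hlam1 : lam ≤ 1) (hN : 2 ≤ N) (hϑ : 0 < ϑ) (ha : (1 - lam) / lam < a) (hc : 0 < c)
    (hc1 : c < 1) (hs : 0 < s) (hκ : κ = c / 10) (hρ : ρ = 1 - lam * κ) (hP : 1 ≤ P) :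
    ∃ K : ℝ, 0 < K ∧ ∀ (Ω : Set (E n)) (ξ : E n) (R : ℝ), IsBoundaryBall Ω d A ξ R →
      ∀ (u : E n → ℝ) (Du : E n → E n),
      HasWeakGradient (Ω ∩ Metric.ball ξ (2 * ((N + 1 / lam + 1) * R))) u Du →
      ∀ H : E n → ℝ≥0∞, Measurable H →
      (∀ w ∈ Metric.ball ξ ((N + 1 / lam + 1) * R) ∩ Ω, H w = gradAvg Ω c Du w) →
      ∀ y ∈ Ω, dist y ξ < R → ∀ F, IsTraceSet Ω d lam N ϑ a c u y F →
      (∫⁻ x, ‖whitneyMean Ω κ u y - trace Ω a c u x‖ₑ ∂(surfaceAvg d F)) ^ P *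
        ENNReal.ofReal (bdist Ω y ^ (d - n - P * s)) ≤
      ENNReal.ofReal (K * (bdist Ω y ^ n)⁻¹) *
        ∑' j : ℕ, ENNReal.ofReal ((ρ ^ (P * s / 2)) ^ j) *
          ∫⁻ w in shadowRegion Ω (Metric.ball ξ ((N + 1 / lam + 1) * R) ∩ Ω) lam (2 / lam + N)
            (ρ ^ j) y, H w ^ P * ENNReal.ofReal (bdist Ω w ^ (d - n - P * (s - 1))) := by
  have hκ0 : 0 < κ := by rw [hκ]; positivity
  have hlamκ : 0 < lam * κ := mul_pos hlam hκ0
  have hlamκ1 : lam * κ < 1 := by nlinarith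
  have hρ0 : 0 < ρ := by rw [hρ]; linarith
  have hρ1 : ρ < 1 := by rw [hρ]; linarith
  obtain ⟨K, hK, hKe⟩ := exists_rpow_le_setLIntegral n hlam hκ0 d s hP
  obtain ⟨K₀, hK₀, hσ⟩ := exists_measure_ball_le n hd hA
  have hq1 : 0 < 1 - ρ ^ (s / 2) := by
    linarith [Real.rpow_lt_one hρ0.le hρ1 (by positivity : 0 < s / 2)]
  set K₁ := (1 - ρ ^ (s / 2)) ^ (-P) * K * K₀ * (4 / lam) ^ d with hK₁
  have hK₁0 : 0 < K₁ := by positivity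
  refine ⟨A * 2 ^ d / ϑ * K₁, by positivity, fun Ω ξ R hB u Du h H hHm hH y hy hyR F hF => ?_⟩
  have hδ := hB.bdist_pos hy
  have hprob := hF.isProbabilityMeasure hB hN hϑ hd hA hy hyR
  have hδm := (continuous_bdist Ω).measurable
  set D := Metric.ball ξ ((N + 1 / lam + 1) * R) ∩ Ω with hD
  have hDm : MeasurableSet D := measurableSet_ball.inter hB.isOpen.measurableSet
  set m : E n → ℝ≥0∞ := fun w =>
    H w ^ P * ENNReal.ofReal (bdist Ω w ^ (d - n - P * (s - 1))) with hm
  have hmm : Measurable m := by fun_prop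
  have h1 := lintegral_rpow_le_tsum_shadow hlam hρ0 hρ1 hs hP hK hK₀
    (hσ _ hB.regular hB.ediam_pos) hDm hmm (by linarith : 0 < N) hδ
    (fun x hx => (hF.subset hx).1)
    (f := fun x => ‖whitneyMean Ω κ u y - trace Ω a c u x‖ₑ) (by
      filter_upwards [hF.ae_exists_chain hB hlam hlam1 hN ha hc hc1 hκ hρ h hy hyR hH]
        with x ⟨e, he, hz⟩
      refine ⟨e, he, fun j => ?_⟩
      obtain ⟨z, h1, h2, h3, h4⟩ := hz j
      exact hKe Ω D H (e j) _ x z hHm (by positivity) h1 h2 h3 h4)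
  have hmeas : AEMeasurable (fun x => ‖whitneyMean Ω κ u y - trace Ω a c u x‖ₑ)
      (surfaceAvg d F) :=
    ((aemeasurable_const.sub (hF.aemeasurable_trace hB hlam hN hc hc1 h hyR)).enorm).smul_measure _
  have h2 := lintegral_rpow_le_lintegral_rpow _ hmeas hP
  have h3 : (μH[d] F)⁻¹ ≤ ENNReal.ofReal ((ϑ * ((bdist Ω y / 2) ^ d / A))⁻¹) := by
    rw [ENNReal.ofReal_inv_of_pos (by positivity)]
    exact ENNReal.inv_le_inv.2 (hF.ofReal_le_measure hB hN hϑ hy hyR)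
  set Q := ∑' j : ℕ, ENNReal.ofReal ((ρ ^ (P * s / 2)) ^ j) *
          ∫⁻ w in shadowRegion Ω D lam (2 / lam + N) (ρ ^ j) y, m w with hQ
  calc _ ≤ ((μH[d] F)⁻¹ * ∫⁻ x in F, ‖whitneyMean Ω κ u y - trace Ω a c u x‖ₑ ^ P ∂μH[d]) *
        ENNReal.ofReal (bdist Ω y ^ (d - n - P * s)) := by
        gcongr
        refine h2.trans (le_of_eq ?_)
        rw [surfaceAvg, lintegral_smul_measure, smul_eq_mul]
    _ ≤ (ENNReal.ofReal ((ϑ * ((bdist Ω y / 2) ^ d / A))⁻¹) *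
          (ENNReal.ofReal (K₁ * bdist Ω y ^ (P * s)) * Q)) *
        ENNReal.ofReal (bdist Ω y ^ (d - n - P * s)) := by gcongr
    _ = (ENNReal.ofReal ((ϑ * ((bdist Ω y / 2) ^ d / A))⁻¹) *
          ENNReal.ofReal (K₁ * bdist Ω y ^ (P * s)) *
        ENNReal.ofReal (bdist Ω y ^ (d - n - P * s))) * Q := by ring
    _ = _ := by
        congr 1
        rw [← ENNReal.ofReal_mul (by positivity), ← ENNReal.ofReal_mul (by positivity)]
        congr 1
        -- The remaining `δ^d` cancels against `1/σ(F) ≤ C δ^{-d}`.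
        have e1 : bdist Ω y ^ (P * s) * bdist Ω y ^ (d - n - P * s) =
            bdist Ω y ^ d * (bdist Ω y ^ n)⁻¹ := by
          rw [← Real.rpow_add hδ, ← Real.rpow_natCast, ← Real.rpow_neg hδ.le, ← Real.rpow_add hδ]
          congr 1; ring
        rw [Real.div_rpow hδ.le two_pos.le, mul_assoc, mul_assoc, e1]
        field_simp

/-- The estimate of the distance from the interior mean of `u` to its boundary values, for the
exponent `∞`. -/
theorem exists_trace_estimate_top (n : ℕ) (hd : 0 < d) (hA : 0 < A) (hlam : 0 < lam)
    (hlam1 : lam ≤ 1) (hN : 2 ≤ N) (hϑ : 0 < ϑ) (ha : (1 - lam) / lam < a) (hc : 0 < c)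
    (hc1 : c < 1) (hs : 0 < s) (hκ : κ = c / 10) (hρ : ρ = 1 - lam * κ) :
    ∃ K : ℝ, 0 < K ∧ ∀ (Ω : Set (E n)) (ξ : E n) (R : ℝ), IsBoundaryBall Ω d A ξ R →
      ∀ (u : E n → ℝ) (Du : E n → E n),
      HasWeakGradient (Ω ∩ Metric.ball ξ (2 * ((N + 1 / lam + 1) * R))) u Du →
      ∀ M : ℝ≥0∞, (∀ᵐ w ∂volume, w ∈ Metric.ball ξ ((N + 1 / lam + 1) * R) ∩ Ω →
        gradAvg Ω c Du w * ENNReal.ofReal (bdist Ω w ^ (-(s - 1))) ≤ M) →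
      ∀ y ∈ Ω, dist y ξ < R → ∀ F, IsTraceSet Ω d lam N ϑ a c u y F →
      ∫⁻ x, ‖whitneyMean Ω κ u y - trace Ω a c u x‖ₑ ∂(surfaceAvg d F) ≤
        ENNReal.ofReal (K * bdist Ω y ^ s) * M := by
  have hκ0 : 0 < κ := by rw [hκ]; positivity
  have hlamκ : 0 < lam * κ := mul_pos hlam hκ0
  have hlamκ1 : lam * κ < 1 := by nlinarith
  have hρ0 : 0 < ρ := by rw [hρ]; linarith
  have hρ1 : ρ < 1 := by rw [hρ]; linarith
  have hρs1 : ρ ^ s < 1 := Real.rpow_lt_one hρ0.le hρ1 hs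
  have hρs0 : 0 < ρ ^ s := by positivity
  have h1ρ : 0 < 1 - ρ ^ s := by linarith
  set K := 240 ^ n / lam * (lam / 2) ^ (-|s - 1|) with hK
  have hK0 : 0 < K := by positivity
  refine ⟨K * (1 - ρ ^ s)⁻¹, by positivity, fun Ω ξ R hB u Du h M hM y hy hyR F hF => ?_⟩
  have hδ := hB.bdist_pos hy
  have hprob := hF.isProbabilityMeasure hB hN hϑ hd hA hy hyR
  have hae : ∀ᵐ x ∂(surfaceAvg d F), ‖whitneyMean Ω κ u y - trace Ω a c u x‖ₑ ≤
      ENNReal.ofReal (K * (1 - ρ ^ s)⁻¹ * bdist Ω y ^ s) * M := by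
    refine Measure.ae_smul_measure ?_ _
    filter_upwards [hF.ae_exists_chain hB hlam hlam1 hN ha hc hc1 hκ hρ h hy hyR
      (H := gradAvg Ω c Du) (fun _ _ => rfl)] with x ⟨e, he, hz⟩
    have hej : ∀ j, e j ≤ ENNReal.ofReal (K * bdist Ω y ^ s) *
        (ENNReal.ofReal ((ρ ^ s) ^ j) * M) := by
      intro j
      obtain ⟨z, h1, h2, h3, h4⟩ := hz j
      set τ := ρ ^ j * bdist Ω y with hτ
      have hτ0 : 0 < τ := by positivity
      have hδz : 0 < bdist Ω z := (mul_pos hlam hτ0).trans_le h1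
      -- The essential bound fails only on a null set, which cannot contain a whole Whitney ball.
      obtain ⟨w, hw, hwM⟩ : ∃ w ∈ Metric.ball z (κ * bdist Ω z),
          gradAvg Ω c Du w * ENNReal.ofReal (bdist Ω w ^ (-(s - 1))) ≤ M := by
        by_contra! hcon
        refine volume_ball_ne_zero z (mul_pos hκ0 hδz) (measure_mono_null ?_ hM)
        exact fun w hw hwM => absurd (hwM (h3 hw).1) (not_le.2 (hcon w hw))
      obtain ⟨-, hw1, hw2, -⟩ := h3 hw
      have hδw : 0 < bdist Ω w := lt_of_lt_of_le (by positivity) hw1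
      have h5 : bdist Ω w ^ (s - 1) ≤ (lam / 2) ^ (-|s - 1|) * τ ^ (s - 1) :=
        rpow_le_of_comparable (by positivity) hτ0 hw1 (by rwa [inv_div]) _
      have h6 : gradAvg Ω c Du w ≤
          M * ENNReal.ofReal ((lam / 2) ^ (-|s - 1|) * τ ^ (s - 1)) := by
        calc gradAvg Ω c Du w = gradAvg Ω c Du w * ENNReal.ofReal (bdist Ω w ^ (-(s - 1))) *
              ENNReal.ofReal (bdist Ω w ^ (s - 1)) := by
              rw [mul_assoc, ← ENNReal.ofReal_mul (by positivity), ← Real.rpow_add hδw]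
              simp
          _ ≤ _ := by gcongr
      calc e j ≤ 240 ^ n * ENNReal.ofReal (bdist Ω z) * gradAvg Ω c Du w := h4 w hw
        _ ≤ ENNReal.ofReal (240 ^ n) * ENNReal.ofReal (τ / lam) *
            (M * ENNReal.ofReal ((lam / 2) ^ (-|s - 1|) * τ ^ (s - 1))) := by
            gcongr
            rw [ENNReal.ofReal_pow (by norm_num)]
            norm_num
        _ = ENNReal.ofReal (240 ^ n * (τ / lam) * ((lam / 2) ^ (-|s - 1|) * τ ^ (s - 1))) * M := by
            rw [ENNReal.ofReal_mul (p := 240 ^ n * (τ / lam)) (by positivity),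
              ENNReal.ofReal_mul (p := 240 ^ n) (by positivity)]
            ring
        _ = _ := by
            rw [← mul_assoc (ENNReal.ofReal _), ← ENNReal.ofReal_mul (by positivity)]
            congr 2
            have e1 : (ρ ^ s) ^ j * bdist Ω y ^ s = τ * τ ^ (s - 1) := by
              rw [Real.rpow_pow_comm hρ0.le, ← Real.mul_rpow (by positivity) hδ.le, ← hτ,
                ← Real.rpow_one_add' hτ0.le (by linarith)]
              congr 1; ring
            rw [hK]
            linear_combination (-(240 ^ n / lam * (lam / 2) ^ (-|s - 1|))) * e1
    calc ‖whitneyMean Ω κ u y - trace Ω a c u x‖ₑ ≤ ∑' j, e j := he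
      _ ≤ ∑' j, ENNReal.ofReal (K * bdist Ω y ^ s) * (ENNReal.ofReal ((ρ ^ s) ^ j) * M) :=
          ENNReal.tsum_le_tsum hej
      _ = _ := by
          rw [ENNReal.tsum_mul_left, ENNReal.tsum_mul_right,
            ← ENNReal.ofReal_tsum_of_nonneg (fun j => by positivity)
            (summable_geometric_of_lt_one hρs0.le hρs1), tsum_geometric_of_lt_one hρs0.le hρs1,
            ← mul_assoc, ← ENNReal.ofReal_mul (by positivity)]
          congr 2
          ring
  calc _ ≤ ∫⁻ x, ENNReal.ofReal (K * (1 - ρ ^ s)⁻¹ * bdist Ω y ^ s) * M ∂(surfaceAvg d F) :=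
        lintegral_mono_ae hae
    _ = _ := by simp

end TraceEstimate

/-! ### The boundary Poincaré inequality. -/

section Main

variable {n : ℕ} {Ω : Set (E n)}

/-- Minkowski's inequality; for a probability measure the `L^β` norm of a constant is its absolute
value for every `β`. -/
theorem whitneyAvg_sub_le {c : ℝ} {β : ℝ≥0∞} (hβ : 1 ≤ β) {u : E n → ℝ} {y : E n}
    (hc : 0 < c) (hδ : 0 < bdist Ω y)
    (hu : AEStronglyMeasurable u (volume.restrict (Metric.ball y (c * bdist Ω y)))) (v b : ℝ) :
    whitneyAvg Ω c β (fun z => u z - b) y ≤ whitneyAvg Ω c β (fun z => u z - v) y + ‖v - b‖ₑ := by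
  have := isProbabilityMeasure_avgMeasure y (mul_pos hc hδ)
  have hu' : AEStronglyMeasurable u (avgMeasure y (c * bdist Ω y)) := hu.smul_measure _
  change eLpNorm _ β (avgMeasure y (c * bdist Ω y)) ≤
    eLpNorm _ β (avgMeasure y (c * bdist Ω y)) + _
  have h1 : (fun z => u z - b) = (fun z => u z - v) + fun _ => v - b := by
    ext z; simp
  rw [h1]
  refine (eLpNorm_add_le (hu'.sub aestronglyMeasurable_const) aestronglyMeasurable_const
    hβ).trans ?_
  rw [eLpNorm_const _ (one_pos.trans_le hβ).ne' (IsProbabilityMeasure.ne_zero _)]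
  simp only [measure_univ, ENNReal.one_rpow, mul_one]
  exact le_rfl

variable {d A lam N ϑ a c s : ℝ}

/-- Pointwise form of the boundary Poincaré inequality: an interior term plus a boundary term. -/
theorem IsTraceSet.whitneyAvg_sub_average_trace_le {ξ y : E n} {R κ c' : ℝ} {u : E n → ℝ}
    {Du : E n → E n} {F : Set (E n)} (hF : IsTraceSet Ω d lam N ϑ a c u y F)
    (hB : IsBoundaryBall Ω d A ξ R) (hlam : 0 < lam) (hN : 2 ≤ N) (hϑ : 0 < ϑ) (hd : 0 < d)
    (hA : 0 < A) (hc : 0 < c) (hcc' : c < c') (hc'1 : c' < 1) (hκ : κ = c / 10)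
    (h : HasWeakGradient (Ω ∩ Metric.ball ξ (2 * ((N + 1 / lam + 1) * R))) u Du)
    (hy : y ∈ Ω) (hyR : dist y ξ < R) {β : ℝ≥0∞} (hβ : 1 ≤ β)
    (hint : IntegrableOn (trace Ω a c u) F μH[d]) :
    whitneyAvg Ω c β (fun z => u z - ⨍ x in F, trace Ω a c u x ∂μH[d]) y ≤
      ENNReal.ofReal (2 * (20 / c) ^ n) * ENNReal.ofReal (bdist Ω y) * whitneyAvg Ω c' β Du y +
        ∫⁻ x, ‖whitneyMean Ω κ u y - trace Ω a c u x‖ₑ ∂(surfaceAvg d F) := by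
  have hδ := hB.bdist_pos hy
  have hR := hB.pos
  have hyR' : dist y ξ < (N + 1 / lam + 1) * R := by
    have : 0 < 1 / lam * R := by positivity
    nlinarith
  have hsub : Metric.closedBall y (c' * bdist Ω y) ⊆
      Ω ∩ Metric.ball ξ (2 * ((N + 1 / lam + 1) * R)) :=
    closedBall_subset_inter hB.isOpen hB.mem hc'1 hy hyR'
  have hu : AEStronglyMeasurable u (volume.restrict (Metric.ball y (c * bdist Ω y))) :=
    ((h.1.integrableOn_compact_subset hsub (isCompact_closedBall _ _)).mono_set
      ((Metric.ball_subset_ball (by gcongr)).trans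
        Metric.ball_subset_closedBall)).aestronglyMeasurable
  refine (whitneyAvg_sub_le hβ hc hδ hu (whitneyMean Ω κ u y) _).trans ?_
  gcongr
  · exact h.eLpNorm_sub_whitneyMean_le hc hcc' hc'1 hκ hδ hsub hβ
  · exact hF.enorm_sub_average_trace_le hB hN hϑ hd hA hy hyR hint _

theorem gradAvg_le_mul_whitneyAvg {ξ : E n} {R c' : ℝ} {u : E n → ℝ} {Du : E n → E n}
    (hB : IsBoundaryBall Ω d A ξ R) (hc : 0 < c) (hcc' : c < c') (hc'1 : c' < 1)
    (h : HasWeakGradient (Ω ∩ Metric.ball ξ (2 * ((N + 1 / lam + 1) * R))) u Du)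
    {β : ℝ≥0∞} (hβ : 1 ≤ β) {w : E n}
    (hw : w ∈ Metric.ball ξ ((N + 1 / lam + 1) * R) ∩ Ω) :
    gradAvg Ω c Du w ≤ ENNReal.ofReal ((1 / c) ^ n) * whitneyAvg Ω c' β Du w :=
  gradAvg_le_whitneyAvg hc hcc' hc'1 (hB.bdist_pos hw.2) hβ
    ((h.2.1.integrableOn_compact_subset (closedBall_subset_inter hB.isOpen hB.mem hc'1 hw.2 hw.1)
      (isCompact_closedBall _ _)).mono_set Metric.ball_subset_closedBall).aestronglyMeasurable

/-- The boundary Poincaré inequality for the exponent `∞`. -/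
theorem exists_boundary_poincare_top (n : ℕ) (hd : 0 < d) (hA : 0 < A) (hlam : 0 < lam)
    (hlam1 : lam ≤ 1) (hN : 2 ≤ N) (hϑ : 0 < ϑ) (ha : (1 - lam) / lam < a) (hc : 0 < c)
    (hc1 : c < 1) (hs : 0 < s) :
    ∃ C : ℝ, 0 < C ∧ ∀ (Ω : Set (E n)) (ξ : E n) (R : ℝ), IsBoundaryBall Ω d A ξ R →
      ∀ (c' : ℝ) (β : ℝ≥0∞), c < c' → c' < 1 → 1 ≤ β → ∀ (u : E n → ℝ) (Du : E n → E n),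
      HasWeakGradient (Ω ∩ Metric.ball ξ (2 * ((N + 1 / lam + 1) * R))) u Du →
      ∀ (Ψ : Set (E n)) (F : E n → Set (E n)), NullMeasurableSet Ψ volume →
      Ψ ⊆ Ω ∩ Metric.ball ξ R → (∀ y ∈ Ψ, IsTraceSet Ω d lam N ϑ a c u y (F y)) →
      (weightedFunctional Ω d ⊤ (s - 1) (Metric.ball ξ ((N + 1 / lam + 1) * R) ∩ Ω)
          (whitneyAvg Ω c' β Du) < ⊤ →
        ∀ y ∈ Ψ, IntegrableOn (trace Ω a c u) (F y) μH[d]) ∧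
      weightedFunctional Ω d ⊤ s Ψ (fun y => whitneyAvg Ω c β
          (fun z => u z - ⨍ x in F y, trace Ω a c u x ∂μH[d]) y) ≤
        ENNReal.ofReal C * weightedFunctional Ω d ⊤ (s - 1)
          (Metric.ball ξ ((N + 1 / lam + 1) * R) ∩ Ω) (whitneyAvg Ω c' β Du) := by
  obtain ⟨K, hK, hKe⟩ := exists_trace_estimate_top (ϑ := ϑ) (κ := c / 10) n hd hA hlam hlam1 hN hϑ
    ha hc hc1 hs rfl rfl
  refine ⟨2 * (20 / c) ^ n + K * (1 / c) ^ n, by positivity,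
    fun Ω ξ R hB c' β hcc' hc'1 hβ u Du h Ψ F hΨ hΨΩ hF => ?_⟩
  set D := Metric.ball ξ ((N + 1 / lam + 1) * R) ∩ Ω with hD
  have hDm : MeasurableSet D := measurableSet_ball.inter hB.isOpen.measurableSet
  have hΨD : Ψ ⊆ D := fun y hy => ⟨by
    have h1 : dist y ξ < R := (hΨΩ hy).2
    have := hB.pos
    have : 0 < 1 / lam * R := by positivity
    rw [Metric.mem_ball]
    nlinarith, (hΨΩ hy).1⟩
  simp only [weightedFunctional, if_true]
  set M := essSup (fun y => whitneyAvg Ω c' β Du y * ENNReal.ofReal (bdist Ω y ^ (-(s - 1))))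
    (volume.restrict D) with hM
  have hMae : ∀ᵐ w ∂volume, w ∈ D →
      whitneyAvg Ω c' β Du w * ENNReal.ofReal (bdist Ω w ^ (-(s - 1))) ≤ M := by
    rw [← ae_restrict_iff' hDm]
    exact ENNReal.ae_le_essSup _
  have hest : ∀ y ∈ Ψ, ∫⁻ x, ‖whitneyMean Ω (c / 10) u y - trace Ω a c u x‖ₑ
      ∂(surfaceAvg d (F y)) ≤
      ENNReal.ofReal (K * bdist Ω y ^ s) * (ENNReal.ofReal ((1 / c) ^ n) * M) := fun y hy => by
    refine hKe Ω ξ R hB u Du h _ ?_ y (hΨΩ hy).1 (hΨΩ hy).2 (F y) (hF y hy)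
    filter_upwards [hMae] with w hw hwD
    refine (mul_le_mul' (gradAvg_le_mul_whitneyAvg hB hc hcc' hc'1 h hβ hwD) le_rfl).trans ?_
    rw [mul_assoc]
    gcongr
    exact hw hwD
  have hintegrable : M < ⊤ → ∀ y ∈ Ψ, IntegrableOn (trace Ω a c u) (F y) μH[d] :=
    fun hfin y hy => (hF y hy).integrableOn_trace hB hlam hN hd hA hc hc1 h (hΨΩ hy).1 (hΨΩ hy).2
      ((hest y hy).trans_lt (by finiteness))
  refine ⟨hintegrable, ?_⟩
  rcases eq_or_ne M ⊤ with htop | htop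
  · rw [htop, ENNReal.mul_top (by simpa using (by positivity))]
    exact le_top
  refine essSup_le_of_ae_le _ ?_
  filter_upwards [ae_restrict_mem₀ hΨ, ae_restrict_of_ae hMae] with y hy hyM
  have hδ := hB.bdist_pos (hΨΩ hy).1
  calc _ ≤ (ENNReal.ofReal (2 * (20 / c) ^ n) * ENNReal.ofReal (bdist Ω y) *
          whitneyAvg Ω c' β Du y +
        ENNReal.ofReal (K * bdist Ω y ^ s) * (ENNReal.ofReal ((1 / c) ^ n) * M)) *
          ENNReal.ofReal (bdist Ω y ^ (-s)) := by
        refine mul_le_mul' (((hF y hy).whitneyAvg_sub_average_trace_le hB hlam hN hϑ hd hA hc hcc'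
          hc'1 rfl h (hΨΩ hy).1 (hΨΩ hy).2 hβ (hintegrable htop.lt_top y hy)).trans ?_) le_rfl
        gcongr
        exact hest y hy
    _ = ENNReal.ofReal (2 * (20 / c) ^ n) * (whitneyAvg Ω c' β Du y *
          (ENNReal.ofReal (bdist Ω y) * ENNReal.ofReal (bdist Ω y ^ (-s)))) +
        (ENNReal.ofReal (K * bdist Ω y ^ s) * ENNReal.ofReal (bdist Ω y ^ (-s))) *
          (ENNReal.ofReal ((1 / c) ^ n) * M) := by ring
    _ = ENNReal.ofReal (2 * (20 / c) ^ n) * (whitneyAvg Ω c' β Du y *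
          ENNReal.ofReal (bdist Ω y ^ (-(s - 1)))) +
        ENNReal.ofReal K * (ENNReal.ofReal ((1 / c) ^ n) * M) := by
        rw [← ENNReal.ofReal_mul hδ.le, ← ENNReal.ofReal_mul (by positivity), mul_assoc K,
          ← Real.rpow_add hδ, add_neg_cancel, Real.rpow_zero, mul_one,
          show -(s - 1) = 1 + -s by ring, Real.rpow_add hδ, Real.rpow_one]
    _ ≤ ENNReal.ofReal (2 * (20 / c) ^ n) * M +
        ENNReal.ofReal K * (ENNReal.ofReal ((1 / c) ^ n) * M) := by
        gcongr
        exact hyM (hΨD hy)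
    _ = _ := by
        rw [← mul_assoc, ← ENNReal.ofReal_mul hK.le, ← add_mul,
          ← ENNReal.ofReal_add (by positivity) (by positivity)]

/-- The boundary Poincaré inequality for finite exponents. -/
theorem exists_boundary_poincare_of_ne_top (n : ℕ) {p : ℝ≥0∞} (hp : 1 ≤ p) (hp' : p ≠ ⊤)
    (hd : 0 < d) (hA : 0 < A) (hlam : 0 < lam)
    (hlam1 : lam ≤ 1) (hN : 2 ≤ N) (hϑ : 0 < ϑ) (ha : (1 - lam) / lam < a) (hc : 0 < c)
    (hc1 : c < 1) (hs : 0 < s) :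
    ∃ C : ℝ, 0 < C ∧ ∀ (Ω : Set (E n)) (ξ : E n) (R : ℝ), IsBoundaryBall Ω d A ξ R →
      ∀ (c' : ℝ) (β : ℝ≥0∞), c < c' → c' < 1 → 1 ≤ β → ∀ (u : E n → ℝ) (Du : E n → E n),
      HasWeakGradient (Ω ∩ Metric.ball ξ (2 * ((N + 1 / lam + 1) * R))) u Du →
      ∀ (Ψ : Set (E n)) (F : E n → Set (E n)), NullMeasurableSet Ψ volume →
      Ψ ⊆ Ω ∩ Metric.ball ξ R → (∀ y ∈ Ψ, IsTraceSet Ω d lam N ϑ a c u y (F y)) →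
      (weightedFunctional Ω d p (s - 1) (Metric.ball ξ ((N + 1 / lam + 1) * R) ∩ Ω)
          (whitneyAvg Ω c' β Du) < ⊤ →
        ∀ y ∈ Ψ, IntegrableOn (trace Ω a c u) (F y) μH[d]) ∧
      weightedFunctional Ω d p s Ψ (fun y => whitneyAvg Ω c β
          (fun z => u z - ⨍ x in F y, trace Ω a c u x ∂μH[d]) y) ≤
        ENNReal.ofReal C * weightedFunctional Ω d p (s - 1)
          (Metric.ball ξ ((N + 1 / lam + 1) * R) ∩ Ω) (whitneyAvg Ω c' β Du) := by
  set P := p.toReal with hPdef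
  have hP : 1 ≤ P := by
    rw [hPdef, ← ENNReal.toReal_one]; exact ENNReal.toReal_mono hp' hp
  have hP0 : 0 < P := by linarith
  set κ := c / 10 with hκ
  set ρ := 1 - lam * κ with hρ
  have hκ0 : 0 < κ := by positivity
  have hlamκ : 0 < lam * κ := mul_pos hlam hκ0
  have hlamκ1 : lam * κ < 1 := by nlinarith
  have hρ0 : 0 < ρ := by rw [hρ]; linarith
  have hρ1 : ρ < 1 := by rw [hρ]; linarith
  set θ := ρ ^ (P * s / 2) with hθ
  have hθ0 : 0 < θ := by positivity
  have hθ1 : θ < 1 := Real.rpow_lt_one hρ0.le hρ1 (by positivity)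
  have h1θ : 0 < 1 - θ := by linarith
  obtain ⟨K, hK, hKe⟩ := exists_trace_estimate_rpow (ϑ := ϑ) n hd hA hlam hlam1 hN hϑ
    ha hc hc1 hs hκ hρ hP
  have hV : 0 < (volume (Metric.ball (0 : E n) 1)).toReal :=
    ENNReal.toReal_pos (volume_ball_ne_zero _ one_pos) (volume_ball_ne_top _ _)
  set L := 2 / lam + N with hL
  have hL0 : 0 < L := by positivity
  set K₂ := K * (8 * L / lam ^ 2) ^ n * (volume (Metric.ball (0 : E n) 1)).toReal * (1 - θ)⁻¹
    with hK₂
  have hK₂0 : 0 < K₂ := by positivity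
  set k₁ := 2 * (20 / c) ^ n with hk₁
  have hk₁0 : 0 < k₁ := by positivity
  set k₂ := (1 / c) ^ n with hk₂
  have hk₂0 : 0 < k₂ := by positivity
  refine ⟨2 ^ (P - 1) * (k₁ ^ P + K₂ * k₂ ^ P), by positivity,
    fun Ω ξ R hB c' β hcc' hc'1 hβ u Du h Ψ F hΨ hΨΩ hF => ?_⟩
  set D := Metric.ball ξ ((N + 1 / lam + 1) * R) ∩ Ω with hD
  have hDm : MeasurableSet D := measurableSet_ball.inter hB.isOpen.measurableSet
  have hDδ : ∀ w ∈ D, 0 < bdist Ω w := fun w hw => hB.bdist_pos hw.2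
  have hΨD : Ψ ⊆ D := fun y hy => ⟨by
    have h1 : dist y ξ < R := (hΨΩ hy).2
    have := hB.pos
    have : 0 < 1 / lam * R := by positivity
    rw [Metric.mem_ball]
    nlinarith, (hΨΩ hy).1⟩
  have hδm := (continuous_bdist Ω).measurable
  have hWm : AEStronglyMeasurable Du
      (volume.restrict (Ω ∩ Metric.ball ξ (2 * ((N + 1 / lam + 1) * R)))) :=
    h.2.1.aestronglyMeasurable
  obtain ⟨H, hHm, hH⟩ := exists_measurable_gradAvg (D := D) hc hWm hDδ fun w hw =>
    Metric.ball_subset_closedBall.trans (closedBall_subset_inter hB.isOpen hB.mem hc1 hw.2 hw.1)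
  set α := d - n - P * (s - 1) with hα
  simp only [weightedFunctional, if_neg hp']
  set I := ∫⁻ y in D, whitneyAvg Ω c' β Du y ^ P * ENNReal.ofReal (bdist Ω y ^ α) with hI
  set m : E n → ℝ≥0∞ := fun w => H w ^ P * ENNReal.ofReal (bdist Ω w ^ α) with hm
  have hmm : Measurable m := by fun_prop
  have hmI : ∫⁻ w in D, m w ≤ ENNReal.ofReal (k₂ ^ P) * I := by
    rw [hI, ← lintegral_const_mul' _ _ ENNReal.ofReal_ne_top]
    refine setLIntegral_mono' hDm fun w hw => ?_
    rw [hm, ← ENNReal.ofReal_rpow_of_pos hk₂0, ← mul_assoc,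
      ← ENNReal.mul_rpow_of_nonneg _ _ hP0.le]
    dsimp only
    rw [hH w hw]
    gcongr
    exact gradAvg_le_mul_whitneyAvg hB hc hcc' hc'1 h hβ hw
  set G : E n → ℝ≥0∞ := fun y => ENNReal.ofReal (K * (bdist Ω y ^ n)⁻¹) *
        ∑' j : ℕ, ENNReal.ofReal (θ ^ j) * ∫⁻ w in shadowRegion Ω D lam L (ρ ^ j) y, m w with hG
  have hGm : Measurable G := by
    refine Measurable.mul (by fun_prop) (Measurable.tsum fun j => ?_)
    exact (measurable_setLIntegral_section
      (measurableSet_shadowRegion_prod hDm lam L (ρ ^ j)) hmm).const_mul _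
  have hest : ∀ y ∈ Ψ, (∫⁻ x, ‖whitneyMean Ω κ u y - trace Ω a c u x‖ₑ
      ∂(surfaceAvg d (F y))) ^ P * ENNReal.ofReal (bdist Ω y ^ (d - n - P * s)) ≤ G y :=
    fun y hy => hKe Ω ξ R hB u Du h H hHm hH y (hΨΩ hy).1 (hΨΩ hy).2 (F y) (hF y hy)
  -- Every shadow region lies in `D`, so the series is dominated by a geometric one. Finiteness at
  -- every `y`, not just almost every `y`, gives integrability on each `F y`.
  have hGfin : I < ⊤ → ∀ y, G y < ⊤ := by
    intro hfin y
    have hmfin : ∫⁻ w in D, m w < ⊤ := hmI.trans_lt (by finiteness)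
    refine ENNReal.mul_lt_top ENNReal.ofReal_lt_top (lt_of_le_of_lt (b :=
      ∑' j : ℕ, ENNReal.ofReal (θ ^ j) * ∫⁻ w in D, m w) ?_ ?_)
    · gcongr with j
      exact fun w hw => hw.1
    · rw [ENNReal.tsum_mul_right, ← ENNReal.ofReal_tsum_of_nonneg (fun j => by positivity)
        (summable_geometric_of_lt_one hθ0.le hθ1)]
      finiteness
  have hintegrable : I < ⊤ → ∀ y ∈ Ψ, IntegrableOn (trace Ω a c u) (F y) μH[d] := by
    intro hfin y hy
    have hδ := hB.bdist_pos (hΨΩ hy).1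
    refine (hF y hy).integrableOn_trace hB hlam hN hd hA hc hc1 h (hΨΩ hy).1 (hΨΩ hy).2
      (b := whitneyMean Ω κ u y) ?_
    have h1 := ENNReal.lt_top_of_mul_ne_top_left ((hest y hy).trans_lt (hGfin hfin y)).ne
      (ENNReal.ofReal_pos.2 (Real.rpow_pos_of_pos hδ _)).ne'
    exact (ENNReal.rpow_lt_top_iff_of_pos hP0).1 h1
  refine ⟨hintegrable, ?_⟩
  rcases eq_or_ne I ⊤ with htop | htop
  · rw [htop, ENNReal.mul_top (ENNReal.ofReal_pos.2 (by positivity)).ne']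
    exact le_top
  have hpt : ∀ y ∈ Ψ, whitneyAvg Ω c β (fun z => u z - ⨍ x in F y, trace Ω a c u x ∂μH[d]) y ^ P *
      ENNReal.ofReal (bdist Ω y ^ (d - n - P * s)) ≤ ENNReal.ofReal (2 ^ (P - 1)) *
      (ENNReal.ofReal (k₁ ^ P) * (whitneyAvg Ω c' β Du y ^ P * ENNReal.ofReal (bdist Ω y ^ α)) +
        G y) := by
    intro y hy
    have hδ := hB.bdist_pos (hΨΩ hy).1
    have h1 := (hF y hy).whitneyAvg_sub_average_trace_le hB hlam hN hϑ hd hA hc hcc'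
          hc'1 hκ h (hΨΩ hy).1 (hΨΩ hy).2 hβ (hintegrable htop.lt_top y hy)
    have h2 := (ENNReal.rpow_le_rpow h1 hP0.le).trans
      (ENNReal.rpow_add_le_mul_rpow_add_rpow _ _ hP)
    refine (mul_le_mul' h2 le_rfl).trans ?_
    rw [mul_assoc, add_mul, ← ENNReal.ofReal_rpow_of_pos two_pos, ENNReal.ofReal_ofNat]
    refine mul_le_mul' le_rfl (add_le_add (le_of_eq ?_) (hest y hy))
    rw [ENNReal.mul_rpow_of_nonneg _ _ hP0.le, ENNReal.mul_rpow_of_nonneg _ _ hP0.le,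
      ENNReal.ofReal_rpow_of_pos hk₁0, ENNReal.ofReal_rpow_of_pos hδ]
    have e1 : bdist Ω y ^ α = bdist Ω y ^ P * bdist Ω y ^ (d - n - P * s) := by
      rw [← Real.rpow_add hδ, hα]; congr 1; ring
    rw [e1, ENNReal.ofReal_mul (by positivity)]
    ring
  calc _ ≤ ∫⁻ y in Ψ, ENNReal.ofReal (2 ^ (P - 1)) * (ENNReal.ofReal (k₁ ^ P) *
          (whitneyAvg Ω c' β Du y ^ P * ENNReal.ofReal (bdist Ω y ^ α)) + G y) := by
        refine lintegral_mono_ae ?_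
        filter_upwards [ae_restrict_mem₀ hΨ] with y hy using hpt y hy
    _ = ENNReal.ofReal (2 ^ (P - 1)) * (ENNReal.ofReal (k₁ ^ P) *
          (∫⁻ y in Ψ, whitneyAvg Ω c' β Du y ^ P * ENNReal.ofReal (bdist Ω y ^ α)) +
          ∫⁻ y in Ψ, G y) := by
        -- Additivity needs only one measurable summand, so no measurability of the Whitney averages
        -- is involved.
        rw [lintegral_const_mul' _ _ ENNReal.ofReal_ne_top, lintegral_add_right _ hGm,
          lintegral_const_mul' _ _ ENNReal.ofReal_ne_top]
    _ ≤ ENNReal.ofReal (2 ^ (P - 1)) * (ENNReal.ofReal (k₁ ^ P) * I +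
          ENNReal.ofReal K₂ * (ENNReal.ofReal (k₂ ^ P) * I)) := by
        gcongr
        · exact lintegral_mono_set hΨD
        exact (setLIntegral_tsum_shadow_le hlam hL0 hρ0 hθ0 hθ1 hK hDm hDδ hmm hΨ
          (g := G) fun y _ => le_rfl).trans (mul_le_mul' le_rfl hmI)
    _ = _ := by
        rw [ENNReal.ofReal_mul (p := 2 ^ (P - 1)) (by positivity),
          ENNReal.ofReal_add (p := k₁ ^ P) (by positivity) (by positivity),
          ENNReal.ofReal_mul (p := K₂) hK₂0.le]
        ring

theorem exists_boundary_poincare (n : ℕ) {p : ℝ≥0∞} (hp : 1 ≤ p)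
    (hd : 0 < d) (hA : 0 < A) (hlam : 0 < lam)
    (hlam1 : lam ≤ 1) (hN : 2 ≤ N) (hϑ : 0 < ϑ) (ha : (1 - lam) / lam < a) (hc : 0 < c)
    (hc1 : c < 1) (hs : 0 < s) :
    ∃ C : ℝ, 0 < C ∧ ∀ (Ω : Set (E n)) (ξ : E n) (R : ℝ), IsBoundaryBall Ω d A ξ R →
      ∀ (c' : ℝ) (β : ℝ≥0∞), c < c' → c' < 1 → 1 ≤ β → ∀ (u : E n → ℝ) (Du : E n → E n),
      HasWeakGradient (Ω ∩ Metric.ball ξ (2 * ((N + 1 / lam + 1) * R))) u Du →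
      ∀ (Ψ : Set (E n)) (F : E n → Set (E n)), NullMeasurableSet Ψ volume →
      Ψ ⊆ Ω ∩ Metric.ball ξ R → (∀ y ∈ Ψ, IsTraceSet Ω d lam N ϑ a c u y (F y)) →
      (weightedFunctional Ω d p (s - 1) (Metric.ball ξ ((N + 1 / lam + 1) * R) ∩ Ω)
          (whitneyAvg Ω c' β Du) < ⊤ →
        ∀ y ∈ Ψ, IntegrableOn (trace Ω a c u) (F y) μH[d]) ∧
      weightedFunctional Ω d p s Ψ (fun y => whitneyAvg Ω c β
          (fun z => u z - ⨍ x in F y, trace Ω a c u x ∂μH[d]) y) ≤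
        ENNReal.ofReal C * weightedFunctional Ω d p (s - 1)
          (Metric.ball ξ ((N + 1 / lam + 1) * R) ∩ Ω) (whitneyAvg Ω c' β Du) := by
  rcases eq_or_ne p ⊤ with rfl | hp'
  · exact exists_boundary_poincare_top n hd hA hlam hlam1 hN hϑ ha hc hc1 hs
  · exact exists_boundary_poincare_of_ne_top n hp hp' hd hA hlam hlam1 hN hϑ ha hc hc1 hs

/-- In a weak local John domain, a function with vanishing trace vanishes on trace sets. -/
theorem IsWeakLocalJohnPoint.exists_isTraceSet {θ : ℝ} {ξ y : E n} {R : ℝ} {u : E n → ℝ}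
    {Du : E n → E n} (hJ : IsWeakLocalJohnPoint Ω d θ lam N y)
    (hB : IsBoundaryBall Ω d A ξ R) (hlam : 0 < lam)
    (hN : 2 ≤ N) (hϑθ : ϑ ≤ θ) (ha : (1 - lam) / lam < a) (hc : 0 < c) (hc1 : c < 1)
    (h : HasWeakGradient (Ω ∩ Metric.ball ξ (2 * ((N + 1 / lam + 1) * R))) u Du)
    (hy : y ∈ Ω) (hyR : dist y ξ < R)
    (hzero : ∀ᵐ x ∂μH[d], x ∈ Metric.ball ξ ((N + 1 / lam + 1) * R) ∩ frontier Ω →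
      x ∈ closure (cone Ω a x) → HasTrace Ω a c u x 0) :
    ∃ F, IsTraceSet Ω d lam N ϑ a c u y F ∧ ⨍ x in F, trace Ω a c u x ∂μH[d] = 0 := by
  obtain ⟨F, hFm, hFs, hFl, hFp⟩ := hJ
  have hcarrot : F ⊆ carrotSet Ω lam N y := fun x hx => ⟨hFs hx, hFp x hx⟩
  have hdist : ∀ x ∈ F, dist x ξ < (N + 1 / lam + 1) * R := fun x hx =>
    dist_lt_of_mem_carrotSet hlam (by linarith) hB.mem hyR (hcarrot hx)
  have htr : ∀ᵐ x ∂μH[d], x ∈ F → HasTrace Ω a c u x 0 := by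
    filter_upwards [hzero] with x hx hxF
    exact hx ⟨hdist x hxF, (hFs hxF).2⟩
      ((hFp x hxF).mem_closure_cone hB.isOpen hlam ha (hFs hxF).2 hy)
  refine ⟨F, ⟨hFm.nullMeasurableSet, hcarrot, le_trans ?_ hFl, ?_⟩, ?_⟩
  · gcongr
  · filter_upwards [htr] with x hx hxF using ⟨0, hx hxF⟩
  · have : trace Ω a c u =ᵐ[μH[d].restrict F] fun _ => 0 := by
      filter_upwards [ae_restrict_mem hFm, ae_restrict_of_ae htr] with x hxF hx
      have h0 := hx hxF
      have h1 := hasTrace_trace ⟨0, h0⟩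
      have := mem_closure_iff_nhdsWithin_neBot.1 h0.1
      -- `trace` is some admissible value picked by choice. It equals zero because both values are
      -- limits of the same Whitney means along a nontrivial filter.
      exact tendsto_nhds_unique
        (h1.tendsto_whitneyMean_of_dist_lt hB.isOpen hB.mem h hc le_rfl hc1 (hdist x hxF))
        (h0.tendsto_whitneyMean_of_dist_lt hB.isOpen hB.mem h hc le_rfl hc1 (hdist x hxF))
    rw [average_congr this]
    simp [average_eq]

end Main

end BoundaryPoincare

theorem mainTheorem8 (n : ℕ) (d A θ lam N ϑ a c s : ℝ) (p : ℝ≥0∞)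
    (hd : 0 < d) (hdn : d < n) (hA : 0 < A)
    (hθ : 0 < θ) (hθ' : θ ≤ 1) (hlam : 0 < lam) (hlam' : lam ≤ 1) (hN : 2 ≤ N)
    (hϑ : 0 < ϑ) (hϑ' : ϑ ≤ θ) (ha : (1 - lam) / lam < a)
    (hc : 0 < c) (hc' : c < 1) (hs : 0 < s) (hp : 1 ≤ p) :
    ∃ C : ℝ, 0 < C ∧
      ∀ Ω : Set (BoundaryPoincare.E n), BoundaryPoincare.IsWeakLocalJohnDomain Ω d A θ lam N →
      ∀ ξ ∈ frontier Ω, ∀ R : ℝ, 0 < R → ENNReal.ofReal R < 2 * Metric.ediam (frontier Ω) →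
      ∀ (c' : ℝ) (β : ℝ≥0∞), c < c' → c' < 1 → 1 ≤ β →
      ∀ (u : BoundaryPoincare.E n → ℝ) (Du : BoundaryPoincare.E n → BoundaryPoincare.E n),
        BoundaryPoincare.MemSobolevLoc
          (Ω ∩ Metric.ball ξ (2 * (N + 1 / lam + 1) * R)) β u Du →
        -- the general inequality, with averages of the trace
        (∀ (Ψ : Set (BoundaryPoincare.E n)) (F : BoundaryPoincare.E n → Set (BoundaryPoincare.E n)),
          NullMeasurableSet Ψ volume → Ψ ⊆ Ω ∩ Metric.ball ξ R →
          (∀ y ∈ Ψ, NullMeasurableSet (F y) μH[d] ∧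
            F y ⊆ BoundaryPoincare.carrotSet Ω lam N y ∧
            ENNReal.ofReal ϑ *
              μH[d] (Metric.ball y (N * BoundaryPoincare.bdist Ω y) ∩ frontier Ω) ≤ μH[d] (F y)) →
          (∀ᵐ x ∂μH[d], x ∈ ⋃ y ∈ Ψ, F y → ∃ U : ℝ, BoundaryPoincare.HasTrace Ω a c u x U) →
          (BoundaryPoincare.weightedFunctional Ω d p (s - 1)
              (Metric.ball ξ ((N + 1 / lam + 1) * R) ∩ Ω)
              (BoundaryPoincare.whitneyAvg Ω c' β Du) < ⊤ →
            ∀ y ∈ Ψ, IntegrableOn (BoundaryPoincare.trace Ω a c u) (F y) μH[d]) ∧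
          BoundaryPoincare.weightedFunctional Ω d p s Ψ
              (fun y => BoundaryPoincare.whitneyAvg Ω c β
                (fun z => u z - ⨍ x in F y, BoundaryPoincare.trace Ω a c u x ∂μH[d]) y) ≤
            ENNReal.ofReal C * BoundaryPoincare.weightedFunctional Ω d p (s - 1)
              (Metric.ball ξ ((N + 1 / lam + 1) * R) ∩ Ω)
              (BoundaryPoincare.whitneyAvg Ω c' β Du)) ∧
        -- the inequality for functions with vanishing trace
        ((∀ᵐ x ∂μH[d], x ∈ Metric.ball ξ ((N + 1 / lam + 1) * R) ∩ frontier Ω →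
            x ∈ closure (BoundaryPoincare.cone Ω a x) → BoundaryPoincare.HasTrace Ω a c u x 0) →
          BoundaryPoincare.weightedFunctional Ω d p s (Metric.ball ξ R ∩ Ω)
              (BoundaryPoincare.whitneyAvg Ω c β u) ≤
            ENNReal.ofReal C * BoundaryPoincare.weightedFunctional Ω d p (s - 1)
              (Metric.ball ξ ((N + 1 / lam + 1) * R) ∩ Ω)
              (BoundaryPoincare.whitneyAvg Ω c' β Du)) := by
  obtain ⟨C, hC, hCe⟩ := BoundaryPoincare.exists_boundary_poincare n hp hd hA hlam hlam' hN hϑ ha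
    hc hc' hs
  refine ⟨C, hC, fun Ω hΩ ξ hξ R hR hRd c' β hcc' hc'1 hβ u Du hu => ?_⟩
  have hB : BoundaryPoincare.IsBoundaryBall Ω d A ξ R := ⟨hΩ.1, hΩ.2.1, hξ, hR, hRd⟩
  have h := hu.1
  rw [mul_assoc] at h
  refine ⟨fun Ψ F hΨ hΨΩ hF htr => hCe Ω ξ R hB c' β hcc' hc'1 hβ u Du h Ψ F hΨ hΨΩ fun y hy =>
    ⟨(hF y hy).1, (hF y hy).2.1, (hF y hy).2.2, ?_⟩, fun hzero => ?_⟩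
  · filter_upwards [htr] with x hx hxF using hx (mem_biUnion hy hxF)
  -- Outside the ball the empty set, whose average is zero, serves as a default; the average then
  -- vanishes for all `y` and can be rewritten under the binder.
  · have hex : ∀ y, ∃ F : Set (BoundaryPoincare.E n), (y ∈ Metric.ball ξ R ∩ Ω →
        BoundaryPoincare.IsTraceSet Ω d lam N ϑ a c u y F) ∧
        ⨍ x in F, BoundaryPoincare.trace Ω a c u x ∂μH[d] = 0 := by
      intro y
      by_cases hy : y ∈ Metric.ball ξ R ∩ Ω
      · obtain ⟨F, hF, hF0⟩ := (hΩ.2.2 y hy.2).exists_isTraceSet hB hlam hN hϑ' ha hc hc' h hy.2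
          hy.1 hzero
        exact ⟨F, fun _ => hF, hF0⟩
      · exact ⟨∅, fun h => absurd h hy, by simp⟩
    choose F hF hF0 using hex
    have := (hCe Ω ξ R hB c' β hcc' hc'1 hβ u Du h (Metric.ball ξ R ∩ Ω) F
      (measurableSet_ball.inter hΩ.1.measurableSet).nullMeasurableSet (fun y hy => ⟨hy.2, hy.1⟩)
      hF).2
    simpa only [hF0, sub_zero] using this
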